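/- Let $X$ be a compact complex manifold of complex dimension $n$, let $\omega_0$ be a Kähler form on $X$, let $\alpha_0$ be a smooth closed real $(1,1)$-form, and let $\lambda\in\mathbb R$, $\kappa>0$. Write $Ric(\omega)=-i\partial\bar\partial\log\omega^n$, $V=\int_X\omega_0^n$, and $\omega_\psi=\omega_0+i\partial\bar\partial\psi$; a smooth real function $\psi$ with $\omega_\psi>0$ is called a Kähler potential of $\omega_0$. Assume that there is a smooth real function $H_0$ with $$Ric(\omega_0)-\lambda\omega_0-\alpha_0=i\partial\bar\partial H_0,\qquad \int_X e^{H_0}\omega_0^n=\int_X\omega_0^n ,$$ and set $b=\frac nV\int_X\alpha_0\wedge\omega_0^{n-1}$. Let $0<T\le\infty$ and let $(\varphi,F)$ be a pair of real functions, smooth on $X\times[0,T)$, such that $\omega_t=\omega_0+i\partial\bar\partial\varphi_t>0$ for all $t\in[0,T)$ and $$\frac{\partial\varphi}{\partial t}=\log\Big(\frac{\omega_t^n}{\omega_0^n}\Big)-H_0+\lambda\varphi-F,\qquad \frac{\partial F}{\partial t}=\kappa\,\Delta_{\omega_t}F-\kappa\,\mathrm{tr}_{\omega_t}\alpha_0+\kappa\,b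 ,$$ where $\mathrm{tr}_\omega\alpha=g^{j\bar k}\alpha_{j\bar k}$ and $\Delta_\omega f=g^{j\bar k}\partial_j\partial_{\bar k}f$ for $\omega=i\sum g_{j\bar k}\,dz^j\wedge d\bar z^k$ and $\alpha=i\sum\alpha_{j\bar k}\,dz^j\wedge d\bar z^k$. For a Kähler potential $\psi$ of $\omega_0$ define $$\mu_{\omega_0}(\psi)=-\frac nV\int_0^1\int_X\psi_s'\,\big(Ric(\omega_{\psi_s})-\lambda\,\omega_{\psi_s}-\alpha_0\big)\wedge\omega_{\psi_s}^{n-1}\,ds,$$ where $(\psi_s)_{0\le s\le1}$ is a smooth path of Kähler potentials of $\omega_0$ from $0$ to $\psi$, and put $$M_{\omega_0}(\psi,G)=\mu_{\omega_0}(\psi)-\frac1V\int_X G\,\omega_\psi^n .$$ Then the value $\mu_{\omega_0}(\psi)$ does not depend on the choice of the path. Moreover $t\mapsto M_{\omega_0}(\varphi_t,F_t)$ is non-increasing on $[0,T)$, and for every $t\in[0,T)$ (with a one-sided derivative at $t=0$) $$\frac{d}{dt}M_{\omega_0}(\varphi_t,F_t)=-\frac1V\int_X|\nabla\dot\varphi_t|^2_{\omega_t}\,\omega_t^n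 ,\qquad |\nabla u|^2_\omega=g^{j\bar k}\,\partial_ju\,\partial_{\bar k}u .$$ -/

import Mathlib

open Set MeasureTheory
open scoped Manifold ContDiff Topology

noncomputable section

namespace KahlerFlow

/-- The model space `ℂⁿ`. -/
abbrev Cn (n : ℕ) : Type := Fin n → ℂ

section Flat

variable {n : ℕ}

/-- The `j`-th standard basis vector of `ℂⁿ` (the real coordinate direction `∂/∂xʲ`). -/
def stdVec (n : ℕ) (j : Fin n) : Cn n := Pi.single j 1

/-- The complex structure `J` of `ℂⁿ` (multiplication by `i`) as a real-linear map. -/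
def cplxJ (n : ℕ) : Cn n →L[ℝ] Cn n :=
  (Complex.I • ContinuousLinearMap.id ℂ (Cn n)).restrictScalars ℝ

/-- The form `i∂∂̄f` of a real function `f` on an open part of `ℂⁿ`, as a real 2-form:
`i∂∂̄f = (1/2) d dᶜf` with `dᶜf = i(∂̄ - ∂)f = - df ∘ J`. -/
def ddbarFlat (f : Cn n → ℝ) (z : Cn n) : Cn n [⋀^Fin 2]→L[ℝ] ℝ :=
  (-(1 / 2) : ℝ) • extDeriv (fun y : Cn n =>
    ContinuousAlternatingMap.ofSubsingleton ℝ (Cn n) ℝ (0 : Fin 1)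
      ((fderiv ℝ f y).comp (cplxJ n))) z

/-- The coefficients `a_{j k̄}` of a real `(1,1)`-covector `β = i ∑ a_{j k̄} dzʲ ∧ dz̄ᵏ`, that is
`i a_{j k̄} = β(∂_j, ∂_k̄)` with `∂_j = (e_j - i J e_j)/2`, `∂_k̄ = (e_k + i J e_k)/2`. -/
def coeffMatrix (β : Cn n [⋀^Fin 2]→L[ℝ] ℝ) : Matrix (Fin n) (Fin n) ℂ :=
  Matrix.of fun j k =>
    (1 / 2 : ℂ) * ((β ![stdVec n j, cplxJ n (stdVec n k)] : ℂ)
      - Complex.I * (β ![stdVec n j, stdVec n k] : ℂ))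

/-- The wedge product of `n` real `(1,1)`-covectors `β₀, …, β_{n-1}` on `ℂⁿ`, as a multiple of the
standard volume form `dx¹ ∧ dy¹ ∧ ⋯ ∧ dxⁿ ∧ dyⁿ`. With `βₘ = i ∑ aᵐ_{j k̄} dzʲ ∧ dz̄ᵏ`, expanding the
product gives `∑_{σ, τ} sgn σ sgn τ ∏ₘ aᵐ_{σ(m) τ(m)}` times `∏ⱼ (i dzʲ ∧ dz̄ʲ)`, and
`i dzʲ ∧ dz̄ʲ = 2 dxʲ ∧ dyʲ`. -/
def wedgeDensity (β : Fin n → (Cn n [⋀^Fin 2]→L[ℝ] ℝ)) : ℝ :=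
  2 ^ n * (∑ σ : Equiv.Perm (Fin n), ∑ τ : Equiv.Perm (Fin n),
    (((Equiv.Perm.sign σ : ℤ) : ℂ) * ((Equiv.Perm.sign τ : ℤ) : ℂ)
      * ∏ m : Fin n, coeffMatrix (β m) (σ m) (τ m))).re

/-- The holomorphic derivatives `∂_j f = (∂f/∂xʲ - i ∂f/∂yʲ)/2` of a real function. -/
def delFlat (f : Cn n → ℝ) (z : Cn n) : Fin n → ℂ := fun j =>
  (1 / 2 : ℂ) * ((fderiv ℝ f z (stdVec n j) : ℂ)
    - Complex.I * (fderiv ℝ f z (cplxJ n (stdVec n j)) : ℂ))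

end Flat

section Manifold

variable {n : ℕ} {X : Type*} [TopologicalSpace X] [ChartedSpace (Cn n) X]

/-- Real differential 2-forms (without regularity) on a complex manifold `X` of dimension `n`. -/
abbrev TwoForm (n : ℕ) (X : Type*) [TopologicalSpace X] [ChartedSpace (Cn n) X] : Type _ :=
  ∀ x : X, TangentSpace 𝓘(ℂ, Cn n) x [⋀^Fin 2]→L[ℝ] ℝ

/-- The expression of a 2-form in a chart `c`: its pullback under `c⁻¹`. -/
def inChart (α : TwoForm n X) (c : OpenPartialHomeomorph X (Cn n)) (z : Cn n) :
    Cn n [⋀^Fin 2]→L[ℝ] ℝ :=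
  (α (c.symm z)).compContinuousLinearMap
    ((mfderiv 𝓘(ℂ, Cn n) 𝓘(ℂ, Cn n) c.symm z).restrictScalars ℝ)

/-- A 2-covector field `β` on (an open part of) `ℂⁿ`, pulled back to the point `x` of `X` under
the chart at `x`. -/
def pullAt (x : X) (β : Cn n → (Cn n [⋀^Fin 2]→L[ℝ] ℝ)) :
    TangentSpace 𝓘(ℂ, Cn n) x [⋀^Fin 2]→L[ℝ] ℝ :=
  (β (chartAt (Cn n) x x)).compContinuousLinearMap
    ((mfderiv 𝓘(ℂ, Cn n) 𝓘(ℂ, Cn n) (chartAt (Cn n) x) x).restrictScalars ℝ)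

/-- `α` is a smooth closed real `(1,1)`-form. -/
structure IsClosedOneOne (α : TwoForm n X) : Prop where
  type_one_one : ∀ (x : X) (u v : TangentSpace 𝓘(ℂ, Cn n) x),
    α x ![Complex.I • u, Complex.I • v] = α x ![u, v]
  smooth : ∀ c ∈ atlas (Cn n) X, ContDiffOn ℝ ∞ (inChart α c) c.target
  closed : ∀ c ∈ atlas (Cn n) X, ∀ z ∈ c.target, extDeriv (inChart α c) z = 0

/-- Positivity of a real `(1,1)`-form: `α(u, Ju) > 0` for all tangent vectors `u ≠ 0`. -/
def IsPositive (α : TwoForm n X) : Prop :=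
  ∀ (x : X) (u : TangentSpace 𝓘(ℂ, Cn n) x), u ≠ 0 → 0 < α x ![u, Complex.I • u]

/-- `α` is (the form of) a Kähler metric. -/
structure IsKahler (α : TwoForm n X) : Prop extends IsClosedOneOne α where
  pos : IsPositive α

/-- Smoothness of a real function on `X`. -/
def IsSmooth (n : ℕ) {X : Type*} [TopologicalSpace X] [ChartedSpace (Cn n) X] (f : X → ℝ) : Prop :=
  ContMDiff 𝓘(ℝ, Cn n) 𝓘(ℝ, ℝ) ∞ f

/-- Smoothness on `J × X` of a family of functions on `X` with parameter in `J ⊆ ℝ`. -/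
def IsSmoothFamily (n : ℕ) {X : Type*} [TopologicalSpace X] [ChartedSpace (Cn n) X]
    (J : Set ℝ) (f : ℝ → X → ℝ) : Prop :=
  ContMDiffOn (𝓘(ℝ, ℝ).prod 𝓘(ℝ, Cn n)) 𝓘(ℝ, ℝ) ∞ (fun p : ℝ × X => f p.1 p.2) (J ×ˢ univ)

/-- The real `(1,1)`-form `i∂∂̄f`. -/
def ddbar (n : ℕ) {X : Type*} [TopologicalSpace X] [ChartedSpace (Cn n) X] (f : X → ℝ) :
    TwoForm n X :=
  fun x => pullAt x (ddbarFlat (f ∘ (chartAt (Cn n) x).symm))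

/-- The density, with respect to Lebesgue measure in the chart `c`, of `α₀ ∧ ⋯ ∧ α_{n-1}`. -/
def wedgeInChart (α : Fin n → TwoForm n X) (c : OpenPartialHomeomorph X (Cn n)) (z : Cn n) : ℝ :=
  wedgeDensity fun m => inChart (α m) c z

/-- The `n`-tuple of forms whose wedge product is `ηⁿ`. -/
def powTop (η : TwoForm n X) : Fin n → TwoForm n X := fun _ => η

/-- The `n`-tuple of forms whose wedge product is `α ∧ ηⁿ⁻¹`. -/
def wedgePow (α η : TwoForm n X) : Fin n → TwoForm n X :=
  fun m => if (m : ℕ) = 0 then α else η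

/-- The Ricci form `Ric(η) = - i∂∂̄ log ηⁿ`, where `ηⁿ` stands for its density in a holomorphic
chart. -/
def ricci (η : TwoForm n X) : TwoForm n X :=
  fun x => - pullAt x (ddbarFlat fun z =>
    Real.log (wedgeInChart (powTop η) (chartAt (Cn n) x) z))

/-- The coefficient matrix of a form at `x`, in the chart at `x`. -/
def coeffAt (α : TwoForm n X) (x : X) : Matrix (Fin n) (Fin n) ℂ :=
  coeffMatrix (inChart α (chartAt (Cn n) x) (chartAt (Cn n) x x))

/-- The trace `tr_η α = η^{j k̄} α_{j k̄}`. -/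
def traceForm (η α : TwoForm n X) (x : X) : ℝ :=
  (Matrix.trace ((coeffAt η x)⁻¹ * coeffAt α x)).re

/-- The Laplacian `Δ_η f = η^{j k̄} ∂_j ∂_k̄ f`. -/
def laplacian (η : TwoForm n X) (f : X → ℝ) : X → ℝ := traceForm η (ddbar n f)

/-- The squared norm of the gradient, `|∇f|²_η = η^{j k̄} ∂_j f ∂_k̄ f`. -/
def gradSq (η : TwoForm n X) (f : X → ℝ) (x : X) : ℝ :=
  let d := delFlat (f ∘ (chartAt (Cn n) x).symm) (chartAt (Cn n) x x)
  (∑ j, ∑ k, (coeffAt η x)⁻¹ k j * (d j * (starRingEnd ℂ) (d k))).re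

/-- The function `η₁ⁿ / η₀ⁿ`. -/
def volRatio (η₁ η₀ : TwoForm n X) (x : X) : ℝ :=
  wedgeInChart (powTop η₁) (chartAt (Cn n) x) (chartAt (Cn n) x x)
    / wedgeInChart (powTop η₀) (chartAt (Cn n) x) (chartAt (Cn n) x x)

end Manifold

section Integration

variable {n : ℕ} {X : Type*} [TopologicalSpace X] [CompactSpace X] [T2Space X]
  [ChartedSpace (Cn n) X]

theorem exists_chartPartition (n : ℕ) (X : Type*) [TopologicalSpace X] [CompactSpace X] [T2Space X]
    [ChartedSpace (Cn n) X] :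
    ∃ ρ : PartitionOfUnity X X univ, ρ.IsSubordinate fun x => (chartAt (Cn n) x).source :=
  PartitionOfUnity.exists_isSubordinate isClosed_univ _ (fun x => (chartAt (Cn n) x).open_source)
    (fun x _ => mem_iUnion.2 ⟨x, mem_chart_source (Cn n) x⟩)

/-- A partition of unity on `X` subordinate to the charts. -/
def chartPartition (n : ℕ) (X : Type*) [TopologicalSpace X] [CompactSpace X] [T2Space X]
    [ChartedSpace (Cn n) X] : PartitionOfUnity X X univ :=
  (exists_chartPartition n X).choose

/-- The integral `∫_X f α₀ ∧ ⋯ ∧ α_{n-1}` over the compact complex manifold `X`, with its complex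
orientation, by means of a partition of unity subordinate to the charts. -/
def integral (f : X → ℝ) (α : Fin n → TwoForm n X) : ℝ :=
  ∑ᶠ i : X, ∫ z in (chartAt (Cn n) i).target,
    chartPartition n X i ((chartAt (Cn n) i).symm z) * f ((chartAt (Cn n) i).symm z)
      * wedgeInChart α (chartAt (Cn n) i) z

/-- The volume `V = ∫_X ηⁿ`. -/
def vol (η : TwoForm n X) : ℝ := integral (fun _ => 1) (powTop η)

end Integration

section Energy

variable {n : ℕ} {X : Type*} [TopologicalSpace X] [CompactSpace X] [T2Space X]
  [ChartedSpace (Cn n) X]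

/-- `ψ` is a Kähler potential of `ω₀`: it is smooth and `ω₀ + i∂∂̄ψ > 0`. -/
def IsPotential (ω₀ : TwoForm n X) (ψ : X → ℝ) : Prop :=
  IsSmooth n ψ ∧ IsPositive (ω₀ + ddbar n ψ)

/-- `γ` is a smooth path `[0,1] ∋ s ↦ γ_s` of Kähler potentials of `ω₀` from `0` to `ψ`. -/
structure IsPotentialPath (ω₀ : TwoForm n X) (ψ : X → ℝ) (γ : ℝ → X → ℝ) : Prop where
  smooth : IsSmoothFamily n (Icc 0 1) γ
  pos : ∀ s ∈ Icc (0 : ℝ) 1, IsPositive (ω₀ + ddbar n (γ s))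
  source : γ 0 = 0
  target : γ 1 = ψ

/-- The path integral
`-(n/V) ∫₀¹ ∫_X γ_s' (Ric(ω_{γ_s}) - λ ω_{γ_s} - α₀) ∧ ω_{γ_s}ⁿ⁻¹ ds`, `ω_{γ_s} = ω₀ + i∂∂̄γ_s`. -/
def muAlong (ω₀ α₀ : TwoForm n X) (lam : ℝ) (γ : ℝ → X → ℝ) : ℝ :=
  -(n / vol ω₀) * ∫ s in (0 : ℝ)..1,
    integral (fun x => derivWithin (fun r => γ r x) (Icc 0 1) s)
      (wedgePow (ricci (ω₀ + ddbar n (γ s)) - lam • (ω₀ + ddbar n (γ s)) - α₀)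
        (ω₀ + ddbar n (γ s)))

/-- The functional `μ_{ω₀}`, computed along the linear path `s ↦ s ψ` (every path gives the same
value). -/
def mu (ω₀ α₀ : TwoForm n X) (lam : ℝ) (ψ : X → ℝ) : ℝ :=
  muAlong ω₀ α₀ lam fun s => s • ψ

/-- The modified Mabuchi energy `M_{ω₀}(φ, F) = μ_{ω₀}(φ) - (1/V) ∫_X F ω_φⁿ`. -/
def mabuchi (ω₀ α₀ : TwoForm n X) (lam : ℝ) (φ F : X → ℝ) : ℝ :=
  mu ω₀ α₀ lam φ - 1 / vol ω₀ * integral F (powTop (ω₀ + ddbar n φ))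

/-- `H₀` is the normalized Ricci potential: `Ric(ω₀) - λ ω₀ - α₀ = i∂∂̄H₀` and
`∫_X e^{H₀} ω₀ⁿ = ∫_X ω₀ⁿ`. -/
structure IsRicciPotential (ω₀ α₀ : TwoForm n X) (lam : ℝ) (H₀ : X → ℝ) : Prop where
  smooth : IsSmooth n H₀
  eq : ricci ω₀ - lam • ω₀ - α₀ = ddbar n H₀
  normalized : integral (fun x => Real.exp (H₀ x)) (powTop ω₀) = vol ω₀

/-- The constant `b = (n/V) ∫_X α₀ ∧ ω₀ⁿ⁻¹`. -/
def bConst (ω₀ α₀ : TwoForm n X) : ℝ :=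
  n / vol ω₀ * integral (fun _ => 1) (wedgePow α₀ ω₀)

/-- The time interval `[0, T)`, `T ≤ ∞`. -/
def timeInterval (T : EReal) : Set ℝ := {t | 0 ≤ t ∧ (t : EReal) < T}

/-- `(φ, F)` is a smooth solution on `[0, T)` of the potential flow
`∂φ/∂t = log(ω_tⁿ/ω₀ⁿ) - H₀ + λ φ - F`, `∂F/∂t = κ Δ_{ω_t} F - κ tr_{ω_t} α₀ + κ b`,
with `ω_t = ω₀ + i∂∂̄φ_t` a Kähler metric. -/
structure IsPotentialFlow (ω₀ α₀ : TwoForm n X) (lam κ : ℝ) (H₀ : X → ℝ) (T : EReal)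
    (φ F : ℝ → X → ℝ) : Prop where
  smooth_φ : IsSmoothFamily n (timeInterval T) φ
  smooth_F : IsSmoothFamily n (timeInterval T) F
  pos : ∀ t ∈ timeInterval T, IsPositive (ω₀ + ddbar n (φ t))
  eq_φ : ∀ t ∈ timeInterval T, ∀ x : X,
    HasDerivWithinAt (fun s => φ s x)
      (Real.log (volRatio (ω₀ + ddbar n (φ t)) ω₀ x) - H₀ x + lam * φ t x - F t x)
      (timeInterval T) t
  eq_F : ∀ t ∈ timeInterval T, ∀ x : X,
    HasDerivWithinAt (fun s => F s x)
      (κ * laplacian (ω₀ + ddbar n (φ t)) (F t) x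
        - κ * traceForm (ω₀ + ddbar n (φ t)) α₀ x + κ * bConst ω₀ α₀)
      (timeInterval T) t

end Energy

end KahlerFlow

end

/-! Write `R` for `ω_ψⁿ/ω₀ⁿ` and `h_ψ = H₀ - λψ - log R`. Since `Ric(ω_ψ)` differs from `Ric(ω₀)` by
`-i∂∂̄ log R`, the function `h_ψ` is a Ricci potential: `Ric(ω_ψ) - λω_ψ - α₀ = i∂∂̄h_ψ`
(`ricci_sub_eq_ddbar`). The operator `v ↦ n i∂∂̄v ∧ ηⁿ⁻¹` is self-adjoint for every closed real
`(1,1)`-form `η`, with quadratic form minus the integrated squared gradient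
(`integral_mul_mixRel_ddbar` and its symmetric version). So the integrand in the definition of `μ`
equals `∫ h n i∂∂̄ψ' ∧ ωⁿ⁻¹`, and this is the derivative of the explicit functional `∫ (H₀ - log R)
ω_ψⁿ - λ (∫ ψ ω_ψⁿ - A(ψ))`, where `A` is a primitive of `ψ' ↦ ∫ ψ' ω_ψⁿ`
(`hasDerivWithinAt_entropyFunctional`). Hence `μ` is `-1/V` times a difference of endpoint values
(`muAlong_eq`), which is independence of the path.

Along the flow the first equation reads `φ̇ = -(h + F)`. Differentiating `M` gives `-(1/V) ∫ (h + F)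
n i∂∂̄φ̇ ∧ ω_tⁿ⁻¹ - (1/V) ∫ Ḟ ω_tⁿ`. The last term vanishes, because `∫ ΔF ω_tⁿ = 0` and `∫ tr α₀
ω_tⁿ = bV` by cohomological invariance. The first is `(1/V) ∫ φ̇ n i∂∂̄φ̇ ∧ ω_tⁿ⁻¹ = -(1/V) ∫ |∇φ̇|²
ω_tⁿ`.

Integration by parts is reduced to matrices. In a chart `n α ∧ ηⁿ⁻¹` is a constant times `tr(adj(a)
b)`, with `a`, `b` the coefficients of `η`, `α`, and for closed `η` the adjugate is divergence free
(`sum_dAdjugate_eq_zero`). Adjugates rather than inverses keep this valid without positivity of `η`.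
Partitions of unity then pass from a chart to `X`.

All integrals are taken against the one fixed density `ω₀ⁿ`, the varying factor being a function
(`volRatio`, `mixRel`, `gradRel`). Integration is thus a bounded linear functional on continuous
functions, and differentiation under the integral sign is uniform convergence on a compact space,
valid at endpoints of the time interval as well. -/

noncomputable section

namespace KahlerFlow

/-! ### Derivatives of the determinant and of the adjugate -/

section MatrixDerivatives

open Matrix

variable {ι : Type*} [Fintype ι] [DecidableEq ι]

/-- Cramer's rule for each diagonal entry. The right-hand side is the form in which the product rule
produces the derivative of a determinant. -/
theorem trace_adjugate_mul (a b : Matrix ι ι ℂ) :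
    trace (adjugate a * b) = ∑ p, (a.updateCol p (fun i => b i p)).det := by
  unfold trace
  refine Finset.sum_congr rfl fun p _ => ?_
  rw [← cramer_apply, cramer_eq_adjugate_mulVec]
  simp [Matrix.mul_apply, mulVec, dotProduct]

theorem trace_adjugate_mul_eq_sum_updateRow (a b : Matrix ι ι ℂ) :
    trace (adjugate a * b) = ∑ p, (a.updateRow p (b p)).det := by
  rw [trace_mul_comm, ← trace_transpose, transpose_mul, adjugate_transpose, trace_adjugate_mul]
  refine Finset.sum_congr rfl fun p _ => ?_
  rw [← det_transpose, updateCol_transpose, transpose_transpose]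
  rfl

/-- Jacobi's formula, from the product rule in the Leibniz expansion. With the adjugate no
invertibility is needed, and the derivative within a set covers one-sided derivatives. -/
theorem hasDerivWithinAt_det {a : ℝ → Matrix ι ι ℂ} {a' : Matrix ι ι ℂ} {s : Set ℝ} {t : ℝ}
    (h : ∀ i j, HasDerivWithinAt (fun r => a r i j) (a' i j) s t) :
    HasDerivWithinAt (fun r => (a r).det) (trace (adjugate (a t) * a')) s t := by
  have h1 : ∀ σ : Equiv.Perm ι, HasDerivWithinAt
      (fun r => ((Equiv.Perm.sign σ : ℤ) : ℂ) * ∏ p, a r (σ p) p)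
      (((Equiv.Perm.sign σ : ℤ) : ℂ) *
        ∑ p, (∏ q ∈ Finset.univ.erase p, a t (σ q) q) • a' (σ p) p) s t := fun σ =>
    (HasDerivWithinAt.fun_finsetProd (u := Finset.univ)
      (f := fun p r => a r (σ p) p) fun p _ => h (σ p) p).const_mul _
  have h2 := HasDerivWithinAt.fun_sum (u := (Finset.univ : Finset (Equiv.Perm ι))) fun σ _ => h1 σ
  simp only [det_apply']
  refine h2.congr_deriv ?_
  rw [trace_adjugate_mul]
  simp only [det_apply', Finset.mul_sum]
  rw [Finset.sum_comm]
  refine Finset.sum_congr rfl fun p _ => Finset.sum_congr rfl fun σ _ => ?_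
  congr 1
  rw [← Finset.mul_prod_erase _ _ (Finset.mem_univ p), smul_eq_mul, mul_comm]
  congr 1
  · simp
  · refine Finset.prod_congr rfl fun q hq => ?_
    simp [updateCol_ne (Finset.ne_of_mem_erase hq)]

/-- The derivative of `adjugate` at `a` in the direction `b`. -/
def dAdjugate (a b : Matrix ι ι ℂ) : Matrix ι ι ℂ :=
  of fun k j => trace (adjugate (a.updateRow j (Pi.single k 1)) * b.updateRow j 0)

/-- An entry of the adjugate is a determinant in which row `j` is the constant vector `e_k`.
Jacobi's formula therefore applies with row `j` of the derivative equal to zero, whence the shape of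
`dAdjugate`. -/
theorem hasDerivWithinAt_adjugate {a : ℝ → Matrix ι ι ℂ} {a' : Matrix ι ι ℂ} {s : Set ℝ} {t : ℝ}
    (h : ∀ i j, HasDerivWithinAt (fun r => a r i j) (a' i j) s t) (k j : ι) :
    HasDerivWithinAt (fun r => adjugate (a r) k j) (dAdjugate (a t) a' k j) s t := by
  simp only [adjugate_apply]
  refine hasDerivWithinAt_det (a := fun r => (a r).updateRow j (Pi.single k 1)) fun p q => ?_
  by_cases hp : p = j
  · subst hp
    simpa using hasDerivWithinAt_const t s _
  · simpa [updateRow_ne hp] using h p q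

/-- Differentiate `adj(a) a = det(a) 1` along the line `a + r b` at `r = 0`. -/
theorem dAdjugate_mul_self (a b : Matrix ι ι ℂ) :
    dAdjugate a b * a = trace (adjugate a * b) • (1 : Matrix ι ι ℂ) - adjugate a * b := by
  have ha : ∀ i j, HasDerivWithinAt (fun r : ℝ => (a + (r : ℂ) • b) i j) (b i j) univ 0 := by
    intro i j
    have := ((Complex.ofRealCLM.hasDerivAt (x := (0 : ℝ))).mul_const (b i j)).const_add (a i j)
    simpa using this.hasDerivWithinAt (s := univ)
  have h0 : a + ((0 : ℝ) : ℂ) • b = a := by simp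
  ext k j
  have h1 : HasDerivWithinAt
      (fun r : ℝ => (adjugate (a + (r : ℂ) • b) * (a + (r : ℂ) • b)) k j)
      ((dAdjugate a b * a + adjugate a * b) k j) univ 0 := by
    simp only [Matrix.mul_apply, Matrix.add_apply (_ * _), ← Finset.sum_add_distrib]
    refine HasDerivWithinAt.fun_sum fun p _ => ?_
    have := (hasDerivWithinAt_adjugate ha k p).mul (ha p j)
    rw [h0] at this
    exact this
  have h2 : HasDerivWithinAt
      (fun r : ℝ => (adjugate (a + (r : ℂ) • b) * (a + (r : ℂ) • b)) k j)
      ((trace (adjugate a * b) • (1 : Matrix ι ι ℂ)) k j) univ 0 := by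
    simp only [adjugate_mul, Matrix.smul_apply, smul_eq_mul]
    have := (hasDerivWithinAt_det ha).mul_const ((1 : Matrix ι ι ℂ) k j)
    rwa [h0] at this
  have := uniqueDiffWithinAt_univ.eq_deriv _ h1 h2
  rw [Matrix.sub_apply, ← this]
  simp

/-- For a `∂`-closed coefficient matrix, the adjugate is divergence free. -/
theorem sum_dAdjugate_eq_zero (a : Matrix ι ι ℂ) (b : ι → Matrix ι ι ℂ)
    (hb : ∀ j l m, b j l m = b l j m) (k : ι) : ∑ j, dAdjugate a (b j) k j = 0 := by
  -- After multiplication by `det a` the derivative is `tr(adj(a) b_j) adj(a) - adj(a) b_j adj(a)`.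
  -- Summed over `j`, the two terms cancel because `b` is symmetric in its first two indices.
  -- Invertibility serves only to remove the factor `det a`.
  have key : ∀ a : Matrix ι ι ℂ, a.det ≠ 0 → ∑ j, dAdjugate a (b j) k j = 0 := by
    intro a ha
    have h1 : ∀ j, a.det * dAdjugate a (b j) k j
        = ∑ l, ∑ m, (adjugate a m l * adjugate a k j * b j l m
            - adjugate a k l * adjugate a m j * b j l m) := by
      intro j
      have : a.det • dAdjugate a (b j)
          = trace (adjugate a * b j) • adjugate a - adjugate a * b j * adjugate a := by
        rw [← mul_one (dAdjugate a (b j)), ← Matrix.mul_smul, ← mul_adjugate, ← Matrix.mul_assoc,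
          dAdjugate_mul_self, sub_mul]
        simp
      have := congrFun (congrFun this k) j
      rw [Matrix.smul_apply, smul_eq_mul] at this
      rw [this]
      simp only [Matrix.sub_apply, Matrix.smul_apply, smul_eq_mul, trace, diag_apply,
        Matrix.mul_apply, Finset.sum_mul, Finset.sum_sub_distrib]
      congr 1
      · rw [Finset.sum_comm]
        exact Finset.sum_congr rfl fun _ _ => Finset.sum_congr rfl fun _ _ => by ring
      · rw [Finset.sum_comm]
        exact Finset.sum_congr rfl fun _ _ => Finset.sum_congr rfl fun _ _ => by ring
    have h2 : a.det * ∑ j, dAdjugate a (b j) k j = 0 := by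
      rw [Finset.mul_sum]
      simp only [h1, Finset.sum_sub_distrib]
      rw [sub_eq_zero]
      conv_rhs => rw [Finset.sum_comm]
      refine Finset.sum_congr rfl fun j _ => Finset.sum_congr rfl fun l _ =>
        Finset.sum_congr rfl fun m _ => ?_
      rw [hb j l m]
      ring
    exact (mul_eq_zero.1 h2).resolve_left ha
  -- Singular `a` follow by density: the sum is continuous in `a`, and `a + s 1` is invertible for
  -- all small `s ≠ 0`, the exceptions being roots of the characteristic polynomial of `-a`.
  have hcont : Continuous fun s : ℂ => ∑ j, dAdjugate (a + s • (1 : Matrix ι ι ℂ)) (b j) k j := by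
    refine continuous_finsetSum _ fun j _ => ?_
    have : Continuous fun s : ℂ => a + s • (1 : Matrix ι ι ℂ) := by fun_prop
    refine Continuous.matrix_trace (Continuous.matrix_mul (Continuous.matrix_adjugate
      (this.matrix_updateRow j continuous_const)) continuous_const)
  have hfin : ∀ᶠ s : ℂ in 𝓝[≠] 0, (a + s • (1 : Matrix ι ι ℂ)).det ≠ 0 := by
    have hp : (-a).charpoly ≠ 0 := (Matrix.charpoly_monic _).ne_zero
    have h0 : {s : ℂ | (-a).charpoly.IsRoot s}.Finite := Polynomial.finite_setOfPred_isRoot hp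
    have : ∀ᶠ s : ℂ in 𝓝[≠] 0, s ∉ {s : ℂ | (-a).charpoly.IsRoot s} := by
      have h3 : ({s : ℂ | (-a).charpoly.IsRoot s} \ {0})ᶜ ∈ 𝓝 (0 : ℂ) :=
        (h0.subset sdiff_subset).isClosed.isOpen_compl.mem_nhds (by simp)
      filter_upwards [mem_nhdsWithin_of_mem_nhds h3, self_mem_nhdsWithin] with s hs hs0 hs1
      exact hs ⟨hs1, hs0⟩
    filter_upwards [this] with s hs hs'
    apply hs
    change (-a).charpoly.eval s = 0
    rw [Matrix.eval_charpoly, ← hs', sub_neg_eq_add, add_comm, Matrix.scalar_apply, Matrix.smul_one_eq_diagonal]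
  have hlim : Filter.Tendsto (fun s : ℂ => ∑ j, dAdjugate (a + s • (1 : Matrix ι ι ℂ)) (b j) k j)
      (𝓝[≠] 0) (𝓝 (∑ j, dAdjugate a (b j) k j)) := by
    have := hcont.tendsto 0
    simp only [zero_smul, add_zero] at this
    exact this.mono_left nhdsWithin_le_nhds
  refine tendsto_nhds_unique hlim ((tendsto_const_nhds (x := (0 : ℂ))).congr' ?_)
  filter_upwards [hfin] with s hs
  exact (key _ hs).symm

theorem dAdjugate_add (a b c : Matrix ι ι ℂ) :
    dAdjugate a (b + c) = dAdjugate a b + dAdjugate a c := by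
  ext k j
  simp only [dAdjugate, of_apply, Matrix.add_apply, ← trace_add, ← Matrix.mul_add]
  congr 2
  ext p q
  by_cases hp : p = j
  · subst hp; simp
  · simp [updateRow_ne hp]

theorem dAdjugate_smul (a b : Matrix ι ι ℂ) (r : ℂ) :
    dAdjugate a (r • b) = r • dAdjugate a b := by
  ext k j
  simp only [dAdjugate, of_apply, Matrix.smul_apply, ← trace_smul, ← Matrix.mul_smul]
  congr 2
  ext p q
  by_cases hp : p = j
  · subst hp; simp
  · simp [updateRow_ne hp]

end MatrixDerivatives

/-! ### Top-degree wedge products as determinants -/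

section WedgeDensity

open Matrix

variable {n : ℕ}

/-- The substitution `τ ↦ τσ` absorbs `sgn σ`, and reindexing the factors by `i = σ m` leaves a
Leibniz expansion whose row `i` comes from the matrix with index `σ⁻¹ i`. -/
theorem sum_sign_mul_sign_mul_prod {ι : Type*} [Fintype ι] [DecidableEq ι]
    (b : ι → Matrix ι ι ℂ) (σ : Equiv.Perm ι) :
    ∑ τ : Equiv.Perm ι, ((Equiv.Perm.sign σ : ℤ) : ℂ) * ((Equiv.Perm.sign τ : ℤ) : ℂ)
      * ∏ m, b m (σ m) (τ m) = det (of fun i => b (σ.symm i) i) := by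
  rw [← det_transpose, det_apply', ← Equiv.sum_comp (Equiv.mulRight σ)]
  refine Finset.sum_congr rfl fun τ _ => ?_
  have hs : ((Equiv.Perm.sign σ : ℤ) : ℂ) * ((Equiv.Perm.sign σ : ℤ) : ℂ) = 1 := by
    rw [← Int.cast_mul, ← Units.val_mul, Int.units_mul_self]; simp
  have hp : ∏ m, b m (σ m) (Equiv.mulRight σ τ m)
      = ∏ i, (of fun i => b (σ.symm i) i)ᵀ (τ i) i := by
    rw [← Equiv.prod_comp σ (fun i => (of fun i => b (σ.symm i) i)ᵀ (τ i) i)]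
    simp
  rw [hp, Equiv.coe_mulRight, Equiv.Perm.sign_mul, Units.val_mul, Int.cast_mul]
  linear_combination (((Equiv.Perm.sign τ : ℤ) : ℂ)
    * ∏ i, (of fun i => b (σ.symm i) i)ᵀ (τ i) i) * hs

theorem wedgeDensity_const (β : Cn n [⋀^Fin 2]→L[ℝ] ℝ) :
    wedgeDensity (fun _ : Fin n => β) = 2 ^ n * (n.factorial * ((coeffMatrix β).det).re) := by
  unfold wedgeDensity
  congr 1
  simp only [sum_sign_mul_sign_mul_prod (fun _ => coeffMatrix β)]
  have : (of fun i => coeffMatrix β i) = coeffMatrix β := rfl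
  simp [this, Fintype.card_perm]

/-- For each `σ` the determinant has exactly one row from `α`, namely row `σ 0`. The factor `n`
replaces `σ 0` by a sum over all `σ m`, which counts every row `n!` times. With the factor on the
left, the case `n = 0` is included: both sides vanish. -/
theorem natCast_mul_wedgeDensity (α η : Cn n [⋀^Fin 2]→L[ℝ] ℝ) :
    n * wedgeDensity (fun m : Fin n => if (m : ℕ) = 0 then α else η)
      = 2 ^ n * (n.factorial * (trace (adjugate (coeffMatrix η) * coeffMatrix α)).re) := by
  rcases n with _ | n
  · simp
  unfold wedgeDensity
  have h0 : ∀ m : Fin (n + 1), ((m : ℕ) = 0) ↔ m = 0 := fun m => by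
    rw [Fin.ext_iff]; simp
  simp only [sum_sign_mul_sign_mul_prod, h0]
  have h1 : ∀ σ : Equiv.Perm (Fin (n + 1)),
      det (of fun i => coeffMatrix (if σ.symm i = 0 then α else η) i)
        = det ((coeffMatrix η).updateRow (σ 0) (coeffMatrix α (σ 0))) := by
    intro σ
    congr 1
    ext i j
    by_cases hi : i = σ 0
    · subst hi; simp
    · have : σ.symm i ≠ 0 := fun h => hi (by rw [← h]; simp)
      simp [updateRow_ne hi, this]
  have h2 : ∀ (f : Fin (n + 1) → ℂ), ((n + 1 : ℕ) : ℂ) * ∑ σ : Equiv.Perm (Fin (n + 1)), f (σ 0)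
      = (n + 1).factorial * ∑ p, f p := by
    intro f
    have h3 : ∀ m : Fin (n + 1), ∑ σ : Equiv.Perm (Fin (n + 1)), f (σ m)
        = ∑ σ : Equiv.Perm (Fin (n + 1)), f (σ 0) := by
      intro m
      rw [← Equiv.sum_comp (Equiv.mulRight (Equiv.swap 0 m))]
      simp
    have h4 : ∑ m : Fin (n + 1), ∑ σ : Equiv.Perm (Fin (n + 1)), f (σ m)
        = (n + 1).factorial * ∑ p, f p := by
      rw [Finset.sum_comm]
      simp only [Equiv.sum_comp]
      simp [Fintype.card_perm]
    rw [← h4]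
    simp [h3]
  have h3 := h2 fun p => det ((coeffMatrix η).updateRow p (coeffMatrix α p))
  simp only [h1]
  rw [trace_adjugate_mul_eq_sum_updateRow]
  have h4 := congrArg Complex.re h3
  simp only [Complex.mul_re, Complex.natCast_re, Complex.natCast_im, zero_mul, sub_zero] at h4
  rw [← h4]
  ring

end WedgeDensity

/-! ### Linear algebra of real (1,1)-covectors -/

section Covectors

open Matrix ComplexConjugate ComplexOrder

variable {n : ℕ} (β : Cn n [⋀^Fin 2]→L[ℝ] ℝ)

theorem cplxJ_apply (u : Cn n) : cplxJ n u = Complex.I • u := rfl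

theorem cplxJ_cplxJ (u : Cn n) : cplxJ n (cplxJ n u) = -u := by
  simp [cplxJ_apply, smul_smul]

theorem covector_swap (u v : Cn n) : β ![u, v] = -β ![v, u] := by
  have := β.map_swap ![v, u] (i := 0) (j := 1) (by decide)
  refine Eq.trans ?_ this
  change β _ = β _
  congr 1
  ext i
  fin_cases i <;> rfl

theorem covector_add_left (u u' v : Cn n) : β ![u + u', v] = β ![u, v] + β ![u', v] :=
  β.toAlternatingMap.map_vecCons_add ![v] u u'

theorem covector_smul_left (r : ℝ) (u v : Cn n) : β ![r • u, v] = r * β ![u, v] :=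
  β.toAlternatingMap.map_vecCons_smul ![v] r u

theorem covector_smul_right (r : ℝ) (u v : Cn n) : β ![u, r • v] = r * β ![u, v] := by
  rw [covector_swap, covector_smul_left, covector_swap β v u]; ring

theorem covector_neg_right (u v : Cn n) : β ![u, -v] = -β ![u, v] := by
  simpa using covector_smul_right β (-1) u v

theorem covector_self (u : Cn n) : β ![u, u] = 0 := by
  have := covector_swap β u u
  linarith

/-- A real 2-covector is of type `(1,1)` if it is invariant under the complex structure. -/
def IsOneOne : Prop := ∀ u v : Cn n, β ![cplxJ n u, cplxJ n v] = β ![u, v]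

/-- The sesquilinear form attached to a real `(1,1)`-covector. -/
def sesq (u v : Cn n) : ℂ :=
  (1 / 2 : ℂ) * ((β ![u, cplxJ n v] : ℂ) - Complex.I * (β ![u, v] : ℂ))

theorem coeffMatrix_apply (j k : Fin n) :
    coeffMatrix β j k = sesq β (stdVec n j) (stdVec n k) := rfl

variable {β}

theorem IsOneOne.apply_cplxJ_left (h : IsOneOne β) (u v : Cn n) :
    β ![cplxJ n u, v] = -β ![u, cplxJ n v] := by
  have := h u (cplxJ n v)
  rw [cplxJ_cplxJ, covector_neg_right] at this
  linarith

theorem IsOneOne.conj_sesq (h : IsOneOne β) (u v : Cn n) : conj (sesq β u v) = sesq β v u := by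
  have h1 : β ![v, cplxJ n u] = β ![u, cplxJ n v] := by
    rw [covector_swap, h.apply_cplxJ_left, neg_neg]
  simp only [sesq, map_mul, map_sub, Complex.conj_I, Complex.conj_ofReal, h1, covector_swap β v u,
    map_div₀, map_one, map_ofNat]
  push_cast
  ring

/-- Here type `(1,1)` enters: it moves `J` from one slot to the other at the cost of a sign, which
turns multiplication by `i` in the first slot into multiplication by `i` of the value. -/
theorem IsOneOne.sesq_smul_left (h : IsOneOne β) (c : ℂ) (u v : Cn n) :
    sesq β (c • u) v = c * sesq β u v := by
  have h1 : c • u = c.re • u + c.im • cplxJ n u := by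
    ext i
    simp only [cplxJ_apply, Pi.smul_apply, Pi.add_apply, smul_eq_mul, Complex.real_smul]
    conv_lhs => rw [← Complex.re_add_im c]
    ring
  have hI := Complex.I_mul_I
  rw [h1]
  conv_rhs => rw [← Complex.re_add_im c]
  simp only [sesq, covector_add_left, covector_smul_left, h u v, h.apply_cplxJ_left u v]
  push_cast
  linear_combination (1 / 2 * c.im * β ![u, v] : ℂ) * hI

theorem sesq_add_left (u u' v : Cn n) : sesq β (u + u') v = sesq β u v + sesq β u' v := by
  simp only [sesq, covector_add_left]
  push_cast
  ring

theorem IsOneOne.sesq_eq_sum_left (h : IsOneOne β) (u v : Cn n) :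
    sesq β u v = ∑ j, u j * sesq β (stdVec n j) v := by
  let f : Cn n →ₗ[ℂ] ℂ :=
    { toFun := fun u => sesq β u v
      map_add' := fun a b => sesq_add_left a b v
      map_smul' := fun c a => h.sesq_smul_left c a v }
  have := f.pi_apply_eq_sum_univ u
  change sesq β u v = _ at this
  rw [this]
  refine Finset.sum_congr rfl fun j _ => ?_
  have h1 : (fun i : Fin n => if j = i then (1 : ℂ) else 0) = stdVec n j := by
    funext i
    simp [stdVec, Pi.single_apply, eq_comm]
  rw [h1]
  rfl

theorem IsOneOne.sesq_eq_sum (h : IsOneOne β) (u v : Cn n) :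
    sesq β u v = ∑ j, ∑ k, u j * coeffMatrix β j k * conj (v k) := by
  rw [h.sesq_eq_sum_left]
  refine Finset.sum_congr rfl fun j _ => ?_
  rw [← h.conj_sesq, h.sesq_eq_sum_left, map_sum, Finset.mul_sum]
  refine Finset.sum_congr rfl fun k _ => ?_
  rw [map_mul, h.conj_sesq, coeffMatrix_apply]
  ring

theorem IsOneOne.isHermitian_coeffMatrix (h : IsOneOne β) : (coeffMatrix β).IsHermitian := by
  refine Matrix.IsHermitian.ext fun j k => ?_
  rw [coeffMatrix_apply, coeffMatrix_apply]
  exact h.conj_sesq _ _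

/-- A complex-linear `A` commutes with `J`, so pulling back only evaluates the sesquilinear form on
the columns of `A`. -/
theorem IsOneOne.coeffMatrix_comp (h : IsOneOne β) (A : Cn n →L[ℂ] Cn n) :
    coeffMatrix (β.compContinuousLinearMap (A.restrictScalars ℝ))
      = (LinearMap.toMatrix' (A : Cn n →ₗ[ℂ] Cn n))ᵀ * coeffMatrix β
        * (LinearMap.toMatrix' (A : Cn n →ₗ[ℂ] Cn n))ᵀᴴ := by
  have hc : ∀ u v : Cn n, (β.compContinuousLinearMap (A.restrictScalars ℝ)) ![u, v]
      = β ![A u, A v] := by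
    intro u v
    rw [ContinuousAlternatingMap.compContinuousLinearMap_apply]
    congr 1
    ext i
    fin_cases i <;> rfl
  ext j k
  have h1 : coeffMatrix (β.compContinuousLinearMap (A.restrictScalars ℝ)) j k
      = sesq β (A (stdVec n j)) (A (stdVec n k)) := by
    rw [coeffMatrix_apply, sesq, sesq, hc, hc, cplxJ_apply, map_smul, cplxJ_apply]
  have h2 : ∀ p j, LinearMap.toMatrix' (A : Cn n →ₗ[ℂ] Cn n) p j = A (stdVec n j) p := by
    intro p j
    rw [LinearMap.toMatrix'_apply]
    congr 2
  rw [h1, h.sesq_eq_sum]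
  simp only [Matrix.mul_apply, conjTranspose_apply, transpose_apply, h2, Finset.sum_mul]
  rw [Finset.sum_comm]
  rfl

theorem IsOneOne.posDef_coeffMatrix (h : IsOneOne β)
    (hpos : ∀ u : Cn n, u ≠ 0 → 0 < β ![u, cplxJ n u]) : (coeffMatrix β).PosDef := by
  refine PosDef.of_dotProduct_mulVec_pos h.isHermitian_coeffMatrix fun x hx => ?_
  have hx' : star x ≠ 0 := by simpa using hx
  -- The conjugate vector appears because `sesq` is antilinear in its second slot, whereas the
  -- matrix form conjugates its first vector.
  have h1 : star x ⬝ᵥ (coeffMatrix β *ᵥ x) = sesq β (star x) (star x) := by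
    rw [h.sesq_eq_sum]
    simp [dotProduct, mulVec, Finset.mul_sum, mul_assoc]
  rw [h1, sesq, covector_self]
  have := hpos _ hx'
  have h2 : (1 / 2 : ℂ) * ((β ![star x, cplxJ n (star x)] : ℂ) - Complex.I * ((0 : ℝ) : ℂ))
      = ((1 / 2 * β ![star x, cplxJ n (star x)] : ℝ) : ℂ) := by
    push_cast; ring
  rw [h2]
  exact_mod_cast (by positivity : 0 < 1 / 2 * β ![star x, cplxJ n (star x)])

theorem det_restrictScalars (A : Cn n →L[ℂ] Cn n) :
    (A.restrictScalars ℝ).det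
      = Complex.normSq (LinearMap.toMatrix' (A : Cn n →ₗ[ℂ] Cn n)).det := by
  rw [LinearMap.det_toMatrix', ← Algebra.norm_complex_apply]
  exact LinearMap.det_restrictScalars (R := ℝ) (S := ℂ) (f := (A : Cn n →ₗ[ℂ] Cn n))

variable (β)

theorem coeffMatrix_add (γ : Cn n [⋀^Fin 2]→L[ℝ] ℝ) :
    coeffMatrix (β + γ) = coeffMatrix β + coeffMatrix γ := by
  ext j k
  simp only [coeffMatrix, of_apply, Matrix.add_apply, ContinuousAlternatingMap.add_apply]
  push_cast
  ring

theorem coeffMatrix_smul (r : ℝ) : coeffMatrix (r • β) = (r : ℂ) • coeffMatrix β := by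
  ext j k
  simp only [coeffMatrix, of_apply, Matrix.smul_apply, ContinuousAlternatingMap.smul_apply,
    smul_eq_mul]
  push_cast
  ring

variable {β}

theorem IsOneOne.add {γ : Cn n [⋀^Fin 2]→L[ℝ] ℝ} (h : IsOneOne β) (h' : IsOneOne γ) :
    IsOneOne (β + γ) := fun u v => by
  simp [h u v, h' u v]

theorem IsOneOne.smul (r : ℝ) (h : IsOneOne β) : IsOneOne (r • β) := fun u v => by
  simp [h u v]

/-- The adjugate reverses products, so `adj(P) P` and `Pᴴ adj(Pᴴ)` collapse to determinants. The
trace thus acquires the same factor as `det a`, as the density of an `(n,n)`-form should. -/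
theorem coeffMatrix_comp_adjugate {a P b : Matrix (Fin n) (Fin n) ℂ} :
    trace (adjugate (P * a * Pᴴ) * (P * b * Pᴴ))
      = Complex.normSq P.det * trace (adjugate a * b) := by
  rw [adjugate_mul_distrib, adjugate_mul_distrib]
  have h1 : adjugate Pᴴ * (adjugate a * adjugate P) * (P * b * Pᴴ)
      = adjugate Pᴴ * (adjugate a * (adjugate P * P) * b * Pᴴ) := by
    simp only [Matrix.mul_assoc]
  rw [h1, trace_mul_comm, Matrix.mul_assoc, mul_adjugate, adjugate_mul, det_conjTranspose,
    Complex.normSq_eq_conj_mul_self]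
  simp [mul_comm, mul_left_comm, mul_assoc]

theorem det_mul_mul_conjTranspose {a P : Matrix (Fin n) (Fin n) ℂ} :
    (P * a * Pᴴ).det = Complex.normSq P.det * a.det := by
  rw [det_mul, det_mul, det_conjTranspose, Complex.normSq_eq_conj_mul_self]
  simp only [starRingEnd_apply]
  ring

end Covectors

/-! ### The operator i∂∂̄ and closed (1,1)-forms on ℂⁿ -/

section FlatForms

open Matrix ComplexConjugate

variable {n : ℕ}

theorem two_le_infty : (2 : WithTop ℕ∞) ≤ ∞ := by
  exact WithTop.coe_le_coe.2 (le_top : (2 : ℕ∞) ≤ ⊤)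

/-- The 1-form `df ∘ J = -dᶜf`. -/
def dJ (f : Cn n → ℝ) (y : Cn n) : Cn n [⋀^Fin 1]→L[ℝ] ℝ :=
  ContinuousAlternatingMap.ofSubsingleton ℝ (Cn n) ℝ (0 : Fin 1) ((fderiv ℝ f y).comp (cplxJ n))

theorem ddbarFlat_eq (f : Cn n → ℝ) (z : Cn n) :
    ddbarFlat f z = (-(1 / 2) : ℝ) • extDeriv (dJ f) z := rfl

theorem dJ_apply (f : Cn n → ℝ) (y : Cn n) (v : Fin 1 → Cn n) :
    dJ f y v = fderiv ℝ f y (cplxJ n (v 0)) := rfl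

theorem contDiffAt_dJ {f : Cn n → ℝ} {z : Cn n} {m k : WithTop ℕ∞} (hf : ContDiffAt ℝ m f z)
    (hk : k + 1 ≤ m) : ContDiffAt ℝ k (dJ f) z := by
  have h1 : ContDiffAt ℝ k (fderiv ℝ f) z := hf.fderiv_right hk
  have h2 : ContDiffAt ℝ k (fun y => (fderiv ℝ f y).comp (cplxJ n)) z :=
    h1.clm_comp contDiffAt_const
  exact (ContinuousAlternatingMap.ofSubsingletonLIE (𝕜 := ℝ) (E := Cn n) (F := ℝ)
    (0 : Fin 1)).toContinuousLinearEquiv.contDiff.contDiffAt.comp z h2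

theorem ddbarFlat_congr {f g : Cn n → ℝ} {z : Cn n} (h : f =ᶠ[𝓝 z] g) :
    ddbarFlat f z = ddbarFlat g z := by
  rw [ddbarFlat_eq, ddbarFlat_eq]
  have h1 : extDeriv (dJ f) z = extDeriv (dJ g) z := by
    refine Filter.EventuallyEq.extDeriv_eq ?_
    filter_upwards [h.fderiv (𝕜 := ℝ)] with y hy
    rw [dJ, dJ, hy]
  rw [h1]

theorem ddbarFlat_add {f g : Cn n → ℝ} {z : Cn n} (hf : ContDiffAt ℝ 2 f z)
    (hg : ContDiffAt ℝ 2 g z) :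
    ddbarFlat (fun y => f y + g y) z = ddbarFlat f z + ddbarFlat g z := by
  have h1 : dJ (fun y => f y + g y) =ᶠ[𝓝 z] dJ f + dJ g := by
    filter_upwards [hf.eventually (by simp), hg.eventually (by simp)] with y hfy hgy
    ext v
    simp only [dJ_apply, Pi.add_apply, ContinuousAlternatingMap.add_apply]
    rw [fderiv_fun_add (hfy.differentiableAt (by simp)) (hgy.differentiableAt (by simp))]
    rfl
  rw [ddbarFlat_eq, h1.extDeriv_eq, extDeriv_add, smul_add]
  · rfl
  · exact (contDiffAt_dJ hf (k := 1) (by norm_num)).differentiableAt (by simp)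
  · exact (contDiffAt_dJ hg (k := 1) (by norm_num)).differentiableAt (by simp)

theorem ddbarFlat_smul (r : ℝ) (f : Cn n → ℝ) (z : Cn n) :
    ddbarFlat (fun y => r * f y) z = r • ddbarFlat f z := by
  have h1 : dJ (fun y => r * f y) = r • dJ f := by
    funext y
    ext v
    simp only [dJ_apply, Pi.smul_apply, ContinuousAlternatingMap.smul_apply]
    have : (fun y => r * f y) = r • f := rfl
    rw [this, fderiv_const_smul_field]
    rfl
  rw [ddbarFlat_eq, h1, extDeriv_smul, smul_comm]
  rfl

/-- The second derivative of `f` in the directions `u` and `v`. -/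
def secondDeriv (f : Cn n → ℝ) (z u v : Cn n) : ℝ :=
  fderiv ℝ (fun y => fderiv ℝ f y v) z u

theorem secondDeriv_eq {f : Cn n → ℝ} {z : Cn n} (hf : ContDiffAt ℝ 2 f z) (u v : Cn n) :
    secondDeriv f z u v = fderiv ℝ (fderiv ℝ f) z u v := by
  have h1 : DifferentiableAt ℝ (fderiv ℝ f) z :=
    (hf.fderiv_right (m := 1) (by norm_num)).differentiableAt (by simp)
  rw [secondDeriv, fderiv_clm_apply h1 (differentiableAt_const v)]
  simp

theorem secondDeriv_symm {f : Cn n → ℝ} {z : Cn n} (hf : ContDiffAt ℝ 2 f z) (u v : Cn n) :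
    secondDeriv f z u v = secondDeriv f z v u := by
  rw [secondDeriv_eq hf, secondDeriv_eq hf]
  exact hf.isSymmSndFDerivAt (by simp) u v

theorem secondDeriv_neg_right {f : Cn n → ℝ} {z : Cn n} (hf : ContDiffAt ℝ 2 f z) (u v : Cn n) :
    secondDeriv f z u (-v) = -secondDeriv f z u v := by
  rw [secondDeriv_eq hf, secondDeriv_eq hf, map_neg]

theorem ddbarFlat_apply {f : Cn n → ℝ} {z : Cn n} (hf : ContDiffAt ℝ 2 f z) (u v : Cn n) :
    ddbarFlat f z ![u, v]
      = -(1 / 2) * (secondDeriv f z u (cplxJ n v) - secondDeriv f z v (cplxJ n u)) := by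
  have h1 : DifferentiableAt ℝ (dJ f) z :=
    (contDiffAt_dJ hf (k := 1) (by norm_num)).differentiableAt (by simp)
  rw [ddbarFlat_eq, ContinuousAlternatingMap.smul_apply, extDeriv_apply h1, Fin.sum_univ_two]
  simp only [dJ_apply, secondDeriv]
  simp [Fin.removeNth]
  ring

/-- Symmetry of the second derivative together with `J² = -1`. -/
theorem isOneOne_ddbarFlat {f : Cn n → ℝ} {z : Cn n} (hf : ContDiffAt ℝ 2 f z) :
    IsOneOne (ddbarFlat f z) := by
  intro u v
  rw [ddbarFlat_apply hf, ddbarFlat_apply hf, cplxJ_cplxJ, cplxJ_cplxJ,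
    secondDeriv_neg_right hf, secondDeriv_neg_right hf, secondDeriv_symm hf (cplxJ n u) v,
    secondDeriv_symm hf (cplxJ n v) u]
  ring

theorem contDiffAt_ddbarFlat {f : Cn n → ℝ} {z : Cn n} (hf : ContDiffAt ℝ ∞ f z) :
    ContDiffAt ℝ ∞ (ddbarFlat f) z := by
  have h1 : ContDiffAt ℝ ∞ (fderiv ℝ (dJ f)) z :=
    (contDiffAt_dJ hf (k := ∞) (by simp)).fderiv_right (m := ∞) (by simp)
  have h2 := (ContinuousAlternatingMap.alternatizeUncurryFinCLM ℝ (Cn n) ℝ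
    (n := 1)).contDiff.contDiffAt.comp z h1
  exact (contDiffAt_const (c := (-(1 / 2) : ℝ))).smul h2

theorem extDeriv_ddbarFlat {f : Cn n → ℝ} {z : Cn n} (hf : ContDiffAt ℝ ∞ f z) :
    extDeriv (ddbarFlat f) z = 0 := by
  have h1 : ddbarFlat f = (-(1 / 2) : ℝ) • extDeriv (dJ f) := rfl
  rw [h1, extDeriv_smul, extDeriv_extDeriv_apply (contDiffAt_dJ hf (k := ∞) (by simp))
    (by simpa using two_le_infty),
    smul_zero]

/-- The differential of a holomorphic `h` commutes with `J`, so `df ∘ J` pulls back to `d(f ∘ h) ∘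
J`; then the exterior derivative commutes with pullback. -/
theorem ddbarFlat_comp {f : Cn n → ℝ} {h : Cn n → Cn n} {U : Set (Cn n)} {z : Cn n}
    (hU : IsOpen U) (hz : z ∈ U) (hh : ContDiffOn ℂ 2 h U)
    (hf : ContDiffAt ℝ 2 f (h z)) :
    ddbarFlat (f ∘ h) z
      = (ddbarFlat f (h z)).compContinuousLinearMap ((fderiv ℂ h z).restrictScalars ℝ) := by
  have hhd : ∀ y ∈ U, DifferentiableAt ℂ h y := fun y hy => 
    (hh.contDiffAt (hU.mem_nhds hy)).differentiableAt (by simp)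
  have hr : ∀ y ∈ U, fderiv ℝ h y = (fderiv ℂ h y).restrictScalars ℝ := fun y hy =>
    (hhd y hy).fderiv_restrictScalars ℝ
  have hhc : ContDiffAt ℝ 2 h z :=
    (hh.contDiffAt (hU.mem_nhds hz)).restrict_scalars ℝ
  have hfe : ∀ᶠ y in 𝓝 z, ContDiffAt ℝ 2 f (h y) :=
    hhc.continuousAt.eventually (hf.eventually (by simp))
  have h1 : dJ (f ∘ h) =ᶠ[𝓝 z] fun y => (dJ f (h y)).compContinuousLinearMap (fderiv ℝ h y) := by
    filter_upwards [hfe, hU.mem_nhds hz] with y hfy hy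
    ext v
    rw [ContinuousAlternatingMap.compContinuousLinearMap_apply, dJ_apply, dJ_apply,
      fderiv_comp y (hfy.differentiableAt (by simp)) ((hhd y hy).restrictScalars ℝ), hr y hy]
    simp [cplxJ_apply]
  rw [ddbarFlat_eq, h1.extDeriv_eq, extDeriv_pullback _ hhc (by simp), hr z hz, ddbarFlat_eq]
  · rfl
  · exact (contDiffAt_dJ hf (k := 1) (by norm_num)).differentiableAt (by simp)

/-- The holomorphic derivative `∂_j` of a complex function with real differential `L`. -/
def delOp (j : Fin n) (L : Cn n →L[ℝ] ℂ) : ℂ :=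
  (1 / 2 : ℂ) * (L (stdVec n j) - Complex.I * L (cplxJ n (stdVec n j)))

theorem delFlat_eq_delOp {f : Cn n → ℝ} {z : Cn n} (hf : DifferentiableAt ℝ f z) (j : Fin n) :
    delFlat f z j = delOp j (fderiv ℝ (fun y => (f y : ℂ)) z) := by
  have : fderiv ℝ (fun y => (f y : ℂ)) z = Complex.ofRealCLM.comp (fderiv ℝ f z) :=
    (Complex.ofRealCLM.hasFDerivAt.comp z hf.hasFDerivAt).fderiv
  rw [this]
  rfl

theorem conj_delFlat (f : Cn n → ℝ) (z : Cn n) (k : Fin n) :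
    conj (delFlat f z k) = (1 / 2 : ℂ) * ((fderiv ℝ f z (stdVec n k) : ℂ)
      + Complex.I * (fderiv ℝ f z (cplxJ n (stdVec n k)) : ℂ)) := by
  simp only [delFlat, map_mul, map_sub, Complex.conj_I, Complex.conj_ofReal, map_div₀, map_one,
    map_ofNat]
  ring

theorem hasFDerivAt_fderiv_apply {f : Cn n → ℝ} {z : Cn n} (hf : ContDiffAt ℝ 2 f z) (v : Cn n) :
    HasFDerivAt (fun y => ((fderiv ℝ f y v : ℝ) : ℂ))
      (Complex.ofRealCLM.comp (fderiv ℝ (fun y => fderiv ℝ f y v) z)) z := by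
  have h1 : DifferentiableAt ℝ (fderiv ℝ f) z :=
    (hf.fderiv_right (m := 1) (by norm_num)).differentiableAt (by simp)
  exact Complex.ofRealCLM.hasFDerivAt.comp z
    (h1.clm_apply (differentiableAt_const v)).hasFDerivAt

theorem coeffMatrix_ddbarFlat {f : Cn n → ℝ} {z : Cn n} (hf : ContDiffAt ℝ 2 f z) (j k : Fin n) :
    coeffMatrix (ddbarFlat f z) j k
      = delOp j (fderiv ℝ (fun y => conj (delFlat f y k)) z) := by
  simp only [conj_delFlat]
  have h1 := ((hasFDerivAt_fderiv_apply hf (stdVec n k)).add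
    ((hasFDerivAt_fderiv_apply hf (cplxJ n (stdVec n k))).const_mul Complex.I)).const_mul
      (1 / 2 : ℂ)
  have h2 : fderiv ℝ (fun y => (1 / 2 : ℂ) * ((fderiv ℝ f y (stdVec n k) : ℂ)
      + Complex.I * (fderiv ℝ f y (cplxJ n (stdVec n k)) : ℂ))) z = _ := h1.fderiv
  rw [h2, coeffMatrix_apply, sesq, ddbarFlat_apply hf, ddbarFlat_apply hf, cplxJ_cplxJ,
    secondDeriv_neg_right hf, secondDeriv_symm hf (cplxJ n (stdVec n k)),
    secondDeriv_symm hf (stdVec n k) (cplxJ n (stdVec n j))]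
  have e : ∀ u v : Cn n, (fderiv ℝ (fun y => fderiv ℝ f y v) z) u = secondDeriv f z u v :=
    fun _ _ => rfl
  simp only [delOp, _root_.smul_apply, _root_.add_apply,
    ContinuousLinearMap.comp_apply, Complex.ofRealCLM_apply, e, smul_eq_mul]
  push_cast
  linear_combination (1 / 4 * (secondDeriv f z (cplxJ n (stdVec n j)) (cplxJ n (stdVec n k)))) *
    Complex.I_mul_I

theorem contDiffAt_coeffMatrix {α : Cn n → Cn n [⋀^Fin 2]→L[ℝ] ℝ} {z : Cn n} {m : WithTop ℕ∞}
    (h : ContDiffAt ℝ m α z) (j k : Fin n) :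
    ContDiffAt ℝ m (fun y => coeffMatrix (α y) j k) z := by
  have h1 : ∀ v : Fin 2 → Cn n, ContDiffAt ℝ m (fun y => ((α y v : ℝ) : ℂ)) z := fun v =>
    Complex.ofRealCLM.contDiff.contDiffAt.comp z
      ((ContinuousAlternatingMap.apply ℝ (Cn n) ℝ v).contDiff.contDiffAt.comp z h)
  exact contDiffAt_const.mul ((h1 _).sub (contDiffAt_const.mul (h1 _)))

/-- This is the `(2,1)`-part of `dα = 0`. Type `(1,1)` is required in a neighbourhood, since the
relations that move `J` are differentiated. -/
theorem delOp_coeffMatrix_symm {α : Cn n → Cn n [⋀^Fin 2]→L[ℝ] ℝ} {z : Cn n}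
    (h : DifferentiableAt ℝ α z) (hα : ∀ᶠ y in 𝓝 z, IsOneOne (α y)) (hd : extDeriv α z = 0)
    (j l m : Fin n) :
    delOp j (fderiv ℝ (fun y => coeffMatrix (α y) l m) z)
      = delOp l (fderiv ℝ (fun y => coeffMatrix (α y) j m) z) := by
  let D : Cn n → Cn n → Cn n → ℝ := fun u v w => fderiv ℝ (fun y => α y ![v, w]) z u
  have hdv : ∀ v : Fin 2 → Cn n, DifferentiableAt ℝ (fun y => α y v) z := fun v =>
    (ContinuousAlternatingMap.apply ℝ (Cn n) ℝ v).differentiableAt.comp z h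
  have hcl : ∀ u v w, D u v w - D v u w + D w u v = 0 := by
    intro u v w
    have := extDeriv_apply h ![u, v, w]
    rw [hd, Fin.sum_univ_three, ContinuousAlternatingMap.coe_zero, Pi.zero_apply] at this
    have e0 : Fin.removeNth (0 : Fin 3) ![u, v, w] = ![v, w] := by
      ext i; fin_cases i <;> rfl
    have e1 : Fin.removeNth (1 : Fin 3) ![u, v, w] = ![u, w] := by
      ext i; fin_cases i <;> rfl
    have e2 : Fin.removeNth (2 : Fin 3) ![u, v, w] = ![u, v] := by
      ext i; fin_cases i <;> rfl
    rw [e0, e1, e2] at this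
    simp at this
    simp only [D]
    linarith
  have hJ : ∀ u v w, D u (cplxJ n v) w = -D u v (cplxJ n w) := by
    intro u v w
    simp only [D]
    have : (fun y => α y ![cplxJ n v, w]) =ᶠ[𝓝 z] fun y => -α y ![v, cplxJ n w] := by
      filter_upwards [hα] with y hy
      exact hy.apply_cplxJ_left v w
    rw [this.fderiv_eq, fderiv_fun_neg]
    rfl
  have hc : ∀ (p q : Fin n) (u : Cn n), fderiv ℝ (fun y => coeffMatrix (α y) p q) z u
      = (1 / 2 : ℂ) * ((D u (stdVec n p) (cplxJ n (stdVec n q)) : ℂ)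
        - Complex.I * (D u (stdVec n p) (stdVec n q) : ℂ)) := by
    intro p q u
    have hv : ∀ v : Fin 2 → Cn n, HasFDerivAt (fun y => ((α y v : ℝ) : ℂ))
        (Complex.ofRealCLM.comp (fderiv ℝ (fun y => α y v) z)) z := fun v =>
      Complex.ofRealCLM.hasFDerivAt.comp z (hdv v).hasFDerivAt
    have := ((hv ![stdVec n p, cplxJ n (stdVec n q)]).sub
      ((hv ![stdVec n p, stdVec n q]).const_mul Complex.I)).const_mul (1 / 2 : ℂ)
    have h2 : fderiv ℝ (fun y => coeffMatrix (α y) p q) z = _ := this.fderiv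
    rw [h2]
    rfl
  simp only [delOp, hc]
  set e := stdVec n j
  set f := stdVec n l
  set g := stdVec n m
  have hsw : ∀ u v w, D u v w = -D u w v := by
    intro u v w
    simp only [D]
    have : (fun y => α y ![v, w]) = fun y => -α y ![w, v] := funext fun y => covector_swap _ _ _
    rw [this, fderiv_fun_neg]
    rfl
  have hJJ : ∀ u v w, D u (cplxJ n v) (cplxJ n w) = D u v w := by
    intro u v w
    simp only [D]
    have : (fun y => α y ![cplxJ n v, cplxJ n w]) =ᶠ[𝓝 z] fun y => α y ![v, w] := by
      filter_upwards [hα] with y hy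
      exact hy v w
    rw [this.fderiv_eq]
  -- Closedness is tested on all eight ways of applying `J` to the three vectors; `re` and `im`
  -- below are linear combinations of these relations.
  have r1 := hcl e f (cplxJ n g)
  have r2 := hcl (cplxJ n e) f g
  have r3 := hcl e (cplxJ n f) g
  have r4 := hcl (cplxJ n e) (cplxJ n f) (cplxJ n g)
  have r5 := hcl e f g
  have r6 := hcl (cplxJ n e) (cplxJ n f) g
  have r7 := hcl (cplxJ n e) f (cplxJ n g)
  have r8 := hcl e (cplxJ n f) (cplxJ n g)
  simp only [hJJ, hJ] at r1 r2 r3 r4 r5 r6 r7 r8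
  have re : D e f (cplxJ n g) - D (cplxJ n e) f g
      = D f e (cplxJ n g) - D (cplxJ n f) e g := by
    linarith
  have im : D e f g + D (cplxJ n e) f (cplxJ n g) = D f e g + D (cplxJ n f) e (cplxJ n g) := by
    linarith
  have re' := congrArg (fun x : ℝ => (x : ℂ)) re
  have im' := congrArg (fun x : ℝ => (x : ℂ)) im
  push_cast at re' im'
  linear_combination (1 / 4 : ℂ) * re' - (1 / 4 : ℂ) * Complex.I * im' +
    (1 / 4 * D (cplxJ n e) f g - 1 / 4 * D (cplxJ n f) e g : ℂ) * Complex.I_mul_I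

end FlatForms

/-! ### Integration by parts in ℂⁿ -/

section FlatParts

open Matrix ComplexConjugate

variable {n : ℕ}

theorem contDiffWithinAt_det {E ι : Type*} [NormedAddCommGroup E] [NormedSpace ℝ E] [Fintype ι]
    [DecidableEq ι] {a : E → Matrix ι ι ℂ} {s : Set E} {z : E} {m : WithTop ℕ∞}
    (h : ∀ i j, ContDiffWithinAt ℝ m (fun y => a y i j) s z) :
    ContDiffWithinAt ℝ m (fun y => (a y).det) s z := by
  simp only [det_apply']
  exact ContDiffWithinAt.sum fun σ _ => contDiffWithinAt_const.mul
    (contDiffWithinAt_prod fun p _ => h _ _)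

theorem contDiffAt_adjugate {E ι : Type*} [NormedAddCommGroup E] [NormedSpace ℝ E] [Fintype ι]
    [DecidableEq ι] {a : E → Matrix ι ι ℂ} {z : E} {m : WithTop ℕ∞}
    (h : ∀ i j, ContDiffAt ℝ m (fun y => a y i j) z) (k j : ι) :
    ContDiffAt ℝ m (fun y => adjugate (a y) k j) z := by
  simp only [adjugate_apply]
  rw [← contDiffWithinAt_univ]
  refine contDiffWithinAt_det (a := fun y => (a y).updateRow j (Pi.single k 1)) fun p q => ?_
  by_cases hp : p = j
  · subst hp
    simpa using contDiffWithinAt_const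
  · simpa [updateRow_ne hp] using (h p q).contDiffWithinAt

theorem fderiv_adjugate_apply {E ι : Type*} [NormedAddCommGroup E] [NormedSpace ℝ E] [Fintype ι]
    [DecidableEq ι] {a : E → Matrix ι ι ℂ} {z : E}
    (h : ∀ i j, ContDiffAt ℝ 1 (fun y => a y i j) z) (k j : ι) (v : E) :
    fderiv ℝ (fun y => adjugate (a y) k j) z v
      = dAdjugate (a z) (of fun p q => fderiv ℝ (fun y => a y p q) z v) k j := by
  have h1 : HasDerivAt (fun t : ℝ => adjugate (a (z + t • v)) k j)
      (fderiv ℝ (fun y => adjugate (a y) k j) z v) 0 :=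
    ((contDiffAt_adjugate h k j).differentiableAt (by simp)).hasFDerivAt.hasLineDerivAt v
  have h2 : ∀ p q, HasDerivWithinAt (fun t : ℝ => a (z + t • v) p q)
      ((of fun p q => fderiv ℝ (fun y => a y p q) z v) p q) univ 0 := fun p q =>
    HasDerivAt.hasDerivWithinAt
      (((h p q).differentiableAt (by simp)).hasFDerivAt.hasLineDerivAt v)
  have h3 := hasDerivWithinAt_adjugate h2 k j
  rw [hasDerivWithinAt_univ] at h3
  have := h1.unique h3
  simpa using this

/-- The sesquilinear pairing `∑ adj(a)^{j k̄} d_j d'_k̄` of two `(1,0)`-covectors. -/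
def gradPair (a : Matrix (Fin n) (Fin n) ℂ) (d d' : Fin n → ℂ) : ℂ :=
  ∑ j, ∑ k, adjugate a k j * (d j * conj (d' k))

/-- `dAdjugate` is linear in the direction, so it may be evaluated on the complex combination of
real derivatives that defines `∂_j`. Closedness supplies the symmetry which makes the divergence of
the adjugate cancel. -/
theorem sum_delOp_adjugate {α : Cn n → Cn n [⋀^Fin 2]→L[ℝ] ℝ} {z : Cn n}
    (h : ContDiffAt ℝ ∞ α z) (hα : ∀ᶠ y in 𝓝 z, IsOneOne (α y)) (hd : extDeriv α z = 0)
    (k : Fin n) :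
    ∑ j, delOp j (fderiv ℝ (fun y => adjugate (coeffMatrix (α y)) k j) z) = 0 := by
  have hc : ∀ p q, ContDiffAt ℝ 1 (fun y => coeffMatrix (α y) p q) z := fun p q =>
    (contDiffAt_coeffMatrix h p q).of_le (by simp)
  let b : Fin n → Matrix (Fin n) (Fin n) ℂ := fun j =>
    of fun p q => delOp j (fderiv ℝ (fun y => coeffMatrix (α y) p q) z)
  have h1 : ∀ j, delOp j (fderiv ℝ (fun y => adjugate (coeffMatrix (α y)) k j) z)
      = dAdjugate (coeffMatrix (α z)) (b j) k j := by
    intro j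
    have hb : b j = (1 / 2 : ℂ) •
        ((of fun p q => fderiv ℝ (fun y => coeffMatrix (α y) p q) z (stdVec n j))
          + (-Complex.I) • (of fun p q =>
            fderiv ℝ (fun y => coeffMatrix (α y) p q) z (cplxJ n (stdVec n j)))) := by
      ext p q
      simp only [b, delOp, of_apply, Matrix.smul_apply, Matrix.add_apply, smul_eq_mul]
      ring
    rw [hb, dAdjugate_smul, dAdjugate_add, dAdjugate_smul, delOp, fderiv_adjugate_apply hc,
      fderiv_adjugate_apply hc]
    simp only [Matrix.smul_apply, Matrix.add_apply, smul_eq_mul]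
    ring
  simp only [h1]
  exact sum_dAdjugate_eq_zero _ _ (fun j l m =>
    delOp_coeffMatrix_symm (h.differentiableAt (by simp)) hα hd j l m) k

theorem delOp_add (j : Fin n) (L L' : Cn n →L[ℝ] ℂ) :
    delOp j (L + L') = delOp j L + delOp j L' := by
  simp only [delOp, _root_.add_apply]; ring

theorem delOp_smul (j : Fin n) (c : ℂ) (L : Cn n →L[ℝ] ℂ) :
    delOp j (c • L) = c * delOp j L := by
  simp only [delOp, _root_.smul_apply, smul_eq_mul]; ring

theorem delOp_sum {ι : Type*} (s : Finset ι) (j : Fin n) (L : ι → Cn n →L[ℝ] ℂ) :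
    delOp j (∑ i ∈ s, L i) = ∑ i ∈ s, delOp j (L i) := by
  classical
  induction s using Finset.induction_on with
  | empty => simp [delOp]
  | insert i s hi ih => rw [Finset.sum_insert hi, Finset.sum_insert hi, delOp_add, ih]

theorem contDiffAt_conj_delFlat {v : Cn n → ℝ} {z : Cn n} (hv : ContDiffAt ℝ ∞ v z) (k : Fin n) :
    ContDiffAt ℝ ∞ (fun y => conj (delFlat v y k)) z := by
  simp only [conj_delFlat]
  have h1 : ∀ e : Cn n, ContDiffAt ℝ ∞ (fun y => ((fderiv ℝ v y e : ℝ) : ℂ)) z := fun e =>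
    Complex.ofRealCLM.contDiff.contDiffAt.comp z
      ((hv.fderiv_right (m := ∞) (by simp)).clm_apply contDiffAt_const)
  exact contDiffAt_const.mul ((h1 _).add (contDiffAt_const.mul (h1 _)))

/-- The flux `adj(a)^{j k̄} ∂_k̄ v`. -/
def flux (α : Cn n → Cn n [⋀^Fin 2]→L[ℝ] ℝ) (v : Cn n → ℝ) (j : Fin n) (y : Cn n) : ℂ :=
  ∑ k, adjugate (coeffMatrix (α y)) k j * conj (delFlat v y k)

theorem contDiffAt_flux {α : Cn n → Cn n [⋀^Fin 2]→L[ℝ] ℝ} {v : Cn n → ℝ} {z : Cn n}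
    (h : ContDiffAt ℝ ∞ α z) (hv : ContDiffAt ℝ ∞ v z) (j : Fin n) :
    ContDiffAt ℝ ∞ (flux α v j) z :=
  ContDiffAt.sum fun k _ => (contDiffAt_adjugate (contDiffAt_coeffMatrix h) k j).mul
    (contDiffAt_conj_delFlat hv k)

/-- Divergence form of the operator: in the product rule for the flux, the terms that differentiate
the adjugate sum to zero. -/
theorem trace_adjugate_mul_ddbarFlat {α : Cn n → Cn n [⋀^Fin 2]→L[ℝ] ℝ} {v : Cn n → ℝ} {z : Cn n}
    (h : ContDiffAt ℝ ∞ α z) (hα : ∀ᶠ y in 𝓝 z, IsOneOne (α y)) (hd : extDeriv α z = 0)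
    (hv : ContDiffAt ℝ ∞ v z) :
    trace (adjugate (coeffMatrix (α z)) * coeffMatrix (ddbarFlat v z))
      = ∑ j, delOp j (fderiv ℝ (flux α v j) z) := by
  have hadj := fun k j => (contDiffAt_adjugate (contDiffAt_coeffMatrix h) k j).differentiableAt
    (𝕜 := ℝ) (by simp)
  have hdel := fun k => (contDiffAt_conj_delFlat hv k).differentiableAt (𝕜 := ℝ) (by simp)
  have h1 : ∀ j, delOp j (fderiv ℝ (flux α v j) z)
      = ∑ k, (adjugate (coeffMatrix (α z)) k j * coeffMatrix (ddbarFlat v z) j k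
          + conj (delFlat v z k) *
            delOp j (fderiv ℝ (fun y => adjugate (coeffMatrix (α y)) k j) z)) := by
    intro j
    have : fderiv ℝ (flux α v j) z = ∑ k, (adjugate (coeffMatrix (α z)) k j •
          fderiv ℝ (fun y => conj (delFlat v y k)) z
        + conj (delFlat v z k) • fderiv ℝ (fun y => adjugate (coeffMatrix (α y)) k j) z) := by
      unfold flux
      rw [fderiv_fun_sum (A := fun k y => adjugate (coeffMatrix (α y)) k j * conj (delFlat v y k))
        fun k _ => (hadj k j).fun_mul (hdel k)]
      exact Finset.sum_congr rfl fun k _ => fderiv_fun_mul (hadj k j) (hdel k)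
    rw [this, delOp_sum]
    refine Finset.sum_congr rfl fun k _ => ?_
    rw [delOp_add, delOp_smul, delOp_smul, coeffMatrix_ddbarFlat (hv.of_le two_le_infty)]
  simp only [h1, Finset.sum_add_distrib]
  have h2 : ∑ j, ∑ k, conj (delFlat v z k) *
      delOp j (fderiv ℝ (fun y => adjugate (coeffMatrix (α y)) k j) z) = 0 := by
    rw [Finset.sum_comm]
    refine Finset.sum_eq_zero fun k _ => ?_
    rw [← Finset.mul_sum, sum_delOp_adjugate h hα hd, mul_zero]
  rw [h2, add_zero, trace, Finset.sum_comm]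
  simp [Matrix.mul_apply]

/-- Regularity is asked only at points of `K`, so that coordinate expressions without meaning
outside a chart are admissible once multiplied by a cut-off. -/
theorem integrable_of_continuousAt_tsupport {E : Type*} [NormedAddCommGroup E]
    {g : Cn n → E} {K : Set (Cn n)} (hK : IsCompact K)
    (hg : ∀ z ∈ K, ContinuousAt g z) (h0 : ∀ z, z ∉ K → g z = 0) : Integrable g := by
  have hsub : tsupport g ⊆ K :=
    closure_minimal (fun z hz => by by_contra h; exact hz (h0 z h)) hK.isClosed
  exact (continuous_of_tsupport fun z hz => hg z (hsub hz)).integrable_of_hasCompactSupport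
    (hK.of_isClosed_subset (isClosed_tsupport g) hsub)

/-- Integration by parts for the operator `v ↦ adj(a)^{j k̄} ∂_j ∂_k̄ v` of a closed form. -/
theorem integral_mul_trace_adjugate {U : Set (Cn n)} (hU : IsOpen U)
    {α : Cn n → Cn n [⋀^Fin 2]→L[ℝ] ℝ} {v w : Cn n → ℝ}
    (h : ∀ z ∈ U, ContDiffAt ℝ ∞ α z) (hα : ∀ z ∈ U, IsOneOne (α z))
    (hd : ∀ z ∈ U, extDeriv α z = 0) (hv : ∀ z ∈ U, ContDiffAt ℝ ∞ v z)
    (hw : ContDiff ℝ ∞ w) (hc : HasCompactSupport w) (hs : tsupport w ⊆ U) :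
    ∫ z, w z * (trace (adjugate (coeffMatrix (α z)) * coeffMatrix (ddbarFlat v z))).re
      = -∫ z, (gradPair (coeffMatrix (α z)) (delFlat w z) (delFlat v z)).re := by
  have hα' : ∀ z ∈ U, ∀ᶠ y in 𝓝 z, IsOneOne (α y) := fun z hz =>
    Filter.eventually_of_mem (hU.mem_nhds hz) hα
  have hw0 : ∀ z, z ∉ tsupport w → w z = 0 := fun z hz => image_eq_zero_of_notMem_tsupport hz
  have hwc : ContDiff ℝ ∞ fun y => (w y : ℂ) := Complex.ofRealCLM.contDiff.comp hw
  have hts : tsupport (fun y => (w y : ℂ)) = tsupport w := by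
    unfold tsupport
    congr 1
    ext z
    simp
  have hdw0 : ∀ z, z ∉ tsupport w → fderiv ℝ (fun y => (w y : ℂ)) z = 0 := fun z hz =>
    fderiv_of_notMem_tsupport ℝ (by rwa [hts])
  have hflux : ∀ j, ∀ z ∈ U, ContDiffAt ℝ ∞ (flux α v j) z := fun j z hz =>
    contDiffAt_flux (h z hz) (hv z hz) j
  have hdwc : ∀ e z, ContinuousAt (fun y => fderiv ℝ (fun y => (w y : ℂ)) y e) z := fun e z =>
    (((hwc.fderiv_right (m := ∞) (by simp)).clm_apply contDiff_const).continuous).continuousAt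
  have hfluxd : ∀ j e, ∀ z ∈ U, ContinuousAt (fun y => fderiv ℝ (flux α v j) y e) z :=
    fun j e z hz => ((((hflux j z hz).fderiv_right (m := ∞) (by simp)).clm_apply
      contDiffAt_const).continuousAt)
  have i1 : ∀ j e, Integrable fun y => (w y : ℂ) * fderiv ℝ (flux α v j) y e := fun j e =>
    integrable_of_continuousAt_tsupport hc
      (fun z hz => hwc.continuous.continuousAt.mul (hfluxd j e z (hs hz)))
      (fun z hz => by simp [hw0 z hz])
  have i2 : ∀ j e, Integrable fun y => fderiv ℝ (fun y => (w y : ℂ)) y e * flux α v j y :=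
    fun j e => integrable_of_continuousAt_tsupport hc
      (fun z hz => (hdwc e z).mul (hflux j z (hs hz)).continuousAt)
      (fun z hz => by simp [hdw0 z hz])
  have i3 : ∀ j, Integrable fun y => (w y : ℂ) * flux α v j y :=
    fun j => integrable_of_continuousAt_tsupport hc
      (fun z hz => hwc.continuous.continuousAt.mul (hflux j z (hs hz)).continuousAt)
      (fun z hz => by simp [hw0 z hz])
  have ibp : ∀ j e, ∫ y, (w y : ℂ) * fderiv ℝ (flux α v j) y e
      = -∫ y, fderiv ℝ (fun y => (w y : ℂ)) y e * flux α v j y := fun j e =>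
    integral_mul_fderiv_eq_neg_fderiv_mul_of_integrable (i2 j e) (i1 j e) (i3 j)
      (fun z _ => hwc.differentiable (by simp) z)
      (fun z hz => (hflux j z (hs (hts ▸ hz))).differentiableAt (by simp))
  -- Each `∂_j` is split into its two real directions, so that `ibp` applies to each. Off the
  -- support of `w` nothing is known about `α` and `v`, but there the factor `w` vanishes.
  have e1 : ∀ z, w z * (trace (adjugate (coeffMatrix (α z)) * coeffMatrix (ddbarFlat v z))).re
      = (∑ j, (1 / 2 : ℂ) * ((w z : ℂ) * fderiv ℝ (flux α v j) z (stdVec n j)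
          - Complex.I * ((w z : ℂ) * fderiv ℝ (flux α v j) z (cplxJ n (stdVec n j))))).re := by
    intro z
    by_cases hz : z ∈ tsupport w
    · have hzU := hs hz
      rw [trace_adjugate_mul_ddbarFlat (h z hzU) (hα' z hzU) (hd z hzU) (hv z hzU),
        ← Complex.re_ofReal_mul, Finset.mul_sum]
      congr 1
      refine Finset.sum_congr rfl fun j _ => ?_
      rw [delOp]
      ring
    · simp [hw0 z hz]
  have e2 : ∀ z, (gradPair (coeffMatrix (α z)) (delFlat w z) (delFlat v z)).re
      = (∑ j, (1 / 2 : ℂ) * (fderiv ℝ (fun y => (w y : ℂ)) z (stdVec n j) * flux α v j z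
          - Complex.I * (fderiv ℝ (fun y => (w y : ℂ)) z (cplxJ n (stdVec n j))
            * flux α v j z))).re := by
    intro z
    congr 1
    unfold gradPair
    refine Finset.sum_congr rfl fun j _ => ?_
    have : (1 / 2 : ℂ) * (fderiv ℝ (fun y => (w y : ℂ)) z (stdVec n j) * flux α v j z
          - Complex.I * (fderiv ℝ (fun y => (w y : ℂ)) z (cplxJ n (stdVec n j)) * flux α v j z))
        = delFlat w z j * flux α v j z := by
      rw [delFlat_eq_delOp (hw.differentiable (by simp) z), delOp]
      ring
    rw [this, flux, Finset.mul_sum]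
    exact Finset.sum_congr rfl fun k _ => by ring
  simp only [e1, e2]
  have hre : ∀ {g : Cn n → ℂ}, Integrable g → ∫ z, (g z).re = (∫ z, g z).re := fun hg =>
    integral_re hg
  have j1 : ∀ j, Integrable fun z => (1 / 2 : ℂ) * ((w z : ℂ) * fderiv ℝ (flux α v j) z (stdVec n j)
      - Complex.I * ((w z : ℂ) * fderiv ℝ (flux α v j) z (cplxJ n (stdVec n j)))) := fun j =>
    ((i1 j _).sub ((i1 j _).const_mul _)).const_mul _
  have j2 : ∀ j, Integrable fun z => (1 / 2 : ℂ) *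
      (fderiv ℝ (fun y => (w y : ℂ)) z (stdVec n j) * flux α v j z
        - Complex.I * (fderiv ℝ (fun y => (w y : ℂ)) z (cplxJ n (stdVec n j))
          * flux α v j z)) := fun j =>
    ((i2 j _).sub ((i2 j _).const_mul _)).const_mul _
  rw [hre (integrable_finsetSum _ fun j _ => j1 j), hre (integrable_finsetSum _ fun j _ => j2 j),
    integral_finsetSum _ fun j _ => j1 j, integral_finsetSum _ fun j _ => j2 j, ← Complex.neg_re,
    ← Finset.sum_neg_distrib]
  congr 1
  refine Finset.sum_congr rfl fun j _ => ?_
  rw [integral_const_mul, integral_const_mul, integral_sub (i1 j _) ((i1 j _).const_mul _),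
    integral_sub (i2 j _) ((i2 j _).const_mul _), integral_const_mul, integral_const_mul,
    ibp, ibp]
  ring

end FlatParts

/-! ### Forms in holomorphic charts -/

section Charts

open Matrix ComplexConjugate

variable {n : ℕ} {X : Type*} [TopologicalSpace X] [ChartedSpace (Cn n) X]

/-- The manifold derivative is a complex-linear map at every point, also where it is only a default
value, so no condition on `z` is needed. -/
theorem IsClosedOneOne.isOneOne_inChart {α : TwoForm n X} (hα : IsClosedOneOne α)
    (c : OpenPartialHomeomorph X (Cn n)) (z : Cn n) : IsOneOne (inChart α c z) := by
  intro u v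
  have h := hα.type_one_one (c.symm z) ((mfderiv 𝓘(ℂ, Cn n) 𝓘(ℂ, Cn n) c.symm z) u)
    ((mfderiv 𝓘(ℂ, Cn n) 𝓘(ℂ, Cn n) c.symm z) v)
  have key : ∀ u v : Cn n, inChart α c z ![u, v]
      = α (c.symm z) ![(mfderiv 𝓘(ℂ, Cn n) 𝓘(ℂ, Cn n) c.symm z) u,
          (mfderiv 𝓘(ℂ, Cn n) 𝓘(ℂ, Cn n) c.symm z) v] := by
    intro u v
    refine congrArg (fun w : Fin 2 → Cn n => α (c.symm z) w) (funext fun i => ?_)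
    fin_cases i <;> rfl
  rw [key, key, ← h, cplxJ_apply, cplxJ_apply]
  erw [map_smul, map_smul]

theorem IsClosedOneOne.contDiffAt {α : TwoForm n X} (hα : IsClosedOneOne α)
    {c : OpenPartialHomeomorph X (Cn n)} (hc : c ∈ atlas (Cn n) X) {z : Cn n}
    (hz : z ∈ c.target) : ContDiffAt ℝ ∞ (inChart α c) z :=
  (hα.smooth c hc).contDiffAt (c.open_target.mem_nhds hz)

theorem inChart_add (α β : TwoForm n X) (c : OpenPartialHomeomorph X (Cn n)) (z : Cn n) :
    inChart (α + β) c z = inChart α c z + inChart β c z := rfl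

theorem inChart_smul (r : ℝ) (α : TwoForm n X) (c : OpenPartialHomeomorph X (Cn n)) (z : Cn n) :
    inChart (r • α) c z = r • inChart α c z := rfl

theorem IsClosedOneOne.add {α β : TwoForm n X} (hα : IsClosedOneOne α) (hβ : IsClosedOneOne β) :
    IsClosedOneOne (α + β) where
  type_one_one x u v := by
    have h1 := hα.type_one_one x u v
    have h2 := hβ.type_one_one x u v
    simp only [Pi.add_apply, ContinuousAlternatingMap.add_apply, h1, h2]
  smooth c hc := (hα.smooth c hc).add (hβ.smooth c hc)
  closed c hc z hz := by
    have : inChart (α + β) c = inChart α c + inChart β c := rfl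
    rw [this, extDeriv_add ((hα.contDiffAt hc hz).differentiableAt (by simp))
      ((hβ.contDiffAt hc hz).differentiableAt (by simp)), hα.closed c hc z hz, hβ.closed c hc z hz,
      add_zero]

theorem IsClosedOneOne.smul {α : TwoForm n X} (r : ℝ) (hα : IsClosedOneOne α) :
    IsClosedOneOne (r • α) where
  type_one_one x u v := by
    have h1 := hα.type_one_one x u v
    simp only [Pi.smul_apply, ContinuousAlternatingMap.smul_apply, h1]
  smooth c hc := (contDiffOn_const (c := r)).smul (hα.smooth c hc)
  closed c hc z hz := by
    have : inChart (r • α) c = r • inChart α c := rfl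
    rw [this, extDeriv_smul, hα.closed c hc z hz, smul_zero]

section Transition

variable [IsManifold 𝓘(ℂ, Cn n) ω X]

theorem contDiffOn_transition {c c' : OpenPartialHomeomorph X (Cn n)} (hc : c ∈ atlas (Cn n) X)
    (hc' : c' ∈ atlas (Cn n) X) :
    ContDiffOn ℂ ω (c' ∘ c.symm) (c.symm.trans c').source := by
  have h := HasGroupoid.compatible (G := contDiffGroupoid ω 𝓘(ℂ, Cn n)) hc hc'
  have h1 := (mem_groupoid_of_pregroupoid.1 h).1
  simpa [contDiffPregroupoid] using h1

variable (n X) in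
theorem isManifold_real : IsManifold 𝓘(ℝ, Cn n) ∞ X := by
  refine isManifold_of_contDiffOn _ _ _ fun c c' hc hc' => ?_
  have := ((contDiffOn_transition hc hc').restrict_scalars ℝ).of_le (m := ∞) le_top
  simpa using this

theorem mdifferentiableAt_chart_symm {c : OpenPartialHomeomorph X (Cn n)} (hc : c ∈ atlas (Cn n) X)
    {z : Cn n} (hz : z ∈ c.target) : MDifferentiableAt 𝓘(ℂ, Cn n) 𝓘(ℂ, Cn n) c.symm z :=
  haveI : IsManifold 𝓘(ℂ, Cn n) 1 X := IsManifold.of_le (n := ω) le_top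
  mdifferentiableAt_atlas_symm hc hz

theorem mdifferentiableAt_chart {c : OpenPartialHomeomorph X (Cn n)} (hc : c ∈ atlas (Cn n) X)
    {x : X} (hx : x ∈ c.source) : MDifferentiableAt 𝓘(ℂ, Cn n) 𝓘(ℂ, Cn n) c x :=
  haveI : IsManifold 𝓘(ℂ, Cn n) 1 X := IsManifold.of_le (n := ω) le_top
  mdifferentiableAt_atlas hc hx

theorem mfderiv_chart_comp_symm {c c' : OpenPartialHomeomorph X (Cn n)} (hc : c ∈ atlas (Cn n) X)
    (hc' : c' ∈ atlas (Cn n) X) {z : Cn n} (hz : z ∈ (c.symm.trans c').source) :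
    (mfderiv 𝓘(ℂ, Cn n) 𝓘(ℂ, Cn n) c' (c.symm z)).comp
      (mfderiv 𝓘(ℂ, Cn n) 𝓘(ℂ, Cn n) c.symm z) = fderiv ℂ (c' ∘ c.symm) z := by
  rw [OpenPartialHomeomorph.trans_source] at hz
  rw [← mfderiv_eq_fderiv]
  exact (mfderiv_comp z (mdifferentiableAt_chart hc' hz.2)
    (mdifferentiableAt_chart_symm hc hz.1)).symm

theorem mfderiv_symm_eq_comp {c c' : OpenPartialHomeomorph X (Cn n)} (hc : c ∈ atlas (Cn n) X)
    (hc' : c' ∈ atlas (Cn n) X) {z : Cn n} (hz : z ∈ (c.symm.trans c').source) :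
    mfderiv 𝓘(ℂ, Cn n) 𝓘(ℂ, Cn n) c.symm z
      = (mfderiv 𝓘(ℂ, Cn n) 𝓘(ℂ, Cn n) c'.symm (c' (c.symm z))).comp
        (fderiv ℂ (c' ∘ c.symm) z) := by
  have h1 : c.symm =ᶠ[𝓝 z] c'.symm ∘ (c' ∘ c.symm) := by
    filter_upwards [(c.symm.trans c').open_source.mem_nhds hz] with y hy
    rw [OpenPartialHomeomorph.trans_source] at hy
    exact (c'.left_inv hy.2).symm
  have hd := ((contDiffOn_transition hc hc').contDiffAt
    ((c.symm.trans c').open_source.mem_nhds hz)).differentiableAt (by simp)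
  have hz' := hz
  rw [OpenPartialHomeomorph.trans_source] at hz'
  rw [h1.mfderiv_eq, mfderiv_comp z (I' := 𝓘(ℂ, Cn n))
    (mdifferentiableAt_chart_symm hc' (c'.map_source hz'.2)) hd.mdifferentiableAt,
    mfderiv_eq_fderiv]
  rfl

theorem inChart_transition {c c' : OpenPartialHomeomorph X (Cn n)} (hc : c ∈ atlas (Cn n) X)
    (hc' : c' ∈ atlas (Cn n) X) {z : Cn n} (hz : z ∈ (c.symm.trans c').source) (α : TwoForm n X) :
    inChart α c z = (inChart α c' (c' (c.symm z))).compContinuousLinearMap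
      ((fderiv ℂ (c' ∘ c.symm) z).restrictScalars ℝ) := by
  have hz' := hz
  rw [OpenPartialHomeomorph.trans_source] at hz'
  have e : c'.symm (c' (c.symm z)) = c.symm z := c'.left_inv hz'.2
  have h1 := mfderiv_symm_eq_comp hc hc' hz
  ext v
  simp only [inChart, ContinuousAlternatingMap.compContinuousLinearMap_apply]
  rw [h1]
  -- The base points `c'.symm (c' (c.symm z))` and `c.symm z` agree only propositionally. As every
  -- tangent space is `ℂⁿ` by definition, the base point can be replaced while the vectors stay
  -- fixed.
  have key : ∀ (x : X) (hx : x = c.symm z) (B : Cn n →L[ℂ] Cn n),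
      (α x) (fun i => B (v i)) = (α (c.symm z)) (fun i => B (v i)) := by
    rintro x rfl B
    rfl
  exact (key _ e ((mfderiv 𝓘(ℂ, Cn n) 𝓘(ℂ, Cn n) c'.symm (c' (c.symm z))).comp
        (fderiv ℂ (c' ∘ c.symm) z))).symm

theorem det_transition_ne_zero {c c' : OpenPartialHomeomorph X (Cn n)} (hc : c ∈ atlas (Cn n) X)
    (hc' : c' ∈ atlas (Cn n) X) {z : Cn n} (hz : z ∈ (c.symm.trans c').source) :
    (LinearMap.toMatrix' (fderiv ℂ (c' ∘ c.symm) z : Cn n →ₗ[ℂ] Cn n)).det ≠ 0 := by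
  have hz' := hz
  rw [OpenPartialHomeomorph.trans_source] at hz'
  have hw : c' (c.symm z) ∈ (c'.symm.trans c).source := by
    rw [OpenPartialHomeomorph.trans_source]
    refine ⟨c'.map_source hz'.2, ?_⟩
    rw [mem_preimage, c'.left_inv hz'.2]
    exact c.map_target hz'.1
  have hd := ((contDiffOn_transition hc hc').contDiffAt
    ((c.symm.trans c').open_source.mem_nhds hz)).differentiableAt (by simp)
  have hd' := ((contDiffOn_transition hc' hc).contDiffAt
    ((c'.symm.trans c).open_source.mem_nhds hw)).differentiableAt (by simp)
  have h1 : (c ∘ c'.symm) ∘ (c' ∘ c.symm) =ᶠ[𝓝 z] id := by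
    filter_upwards [(c.symm.trans c').open_source.mem_nhds hz] with y hy
    rw [OpenPartialHomeomorph.trans_source] at hy
    simp only [Function.comp_apply, c'.left_inv hy.2, c.right_inv hy.1, id]
  have h2 := h1.fderiv_eq (𝕜 := ℂ)
  rw [fderiv_comp z hd' hd, fderiv_id] at h2
  have h3 := congrArg (fun L : Cn n →L[ℂ] Cn n => LinearMap.det (L : Cn n →ₗ[ℂ] Cn n)) h2
  simp only [ContinuousLinearMap.toLinearMap_comp, LinearMap.det_comp] at h3
  rw [LinearMap.det_toMatrix']
  intro h0
  simp only [Function.comp_apply] at h3 h0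
  rw [h0, mul_zero] at h3
  simpa using h3.symm

/-- The preferred chart varies with the point, so this is a pointwise identity: at each `z` the
chart at `c.symm z` is frozen and only the derivative of the transition at `z` remains. -/
theorem inChart_pullAt (B : X → Cn n → Cn n [⋀^Fin 2]→L[ℝ] ℝ)
    {c : OpenPartialHomeomorph X (Cn n)} (hc : c ∈ atlas (Cn n) X) {z : Cn n} (hz : z ∈ c.target) :
    inChart (fun x => pullAt x (B x)) c z
      = (B (c.symm z) (chartAt (Cn n) (c.symm z) (c.symm z))).compContinuousLinearMap
        ((fderiv ℂ (chartAt (Cn n) (c.symm z) ∘ c.symm) z).restrictScalars ℝ) := by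
  have hz' : z ∈ (c.symm.trans (chartAt (Cn n) (c.symm z))).source := by
    rw [OpenPartialHomeomorph.trans_source]
    exact ⟨hz, mem_chart_source _ _⟩
  rw [← mfderiv_chart_comp_symm hc (chart_mem_atlas _ _) hz']
  rfl

end Transition

section Smooth

variable [IsManifold 𝓘(ℂ, Cn n) ω X]

theorem IsSmooth.contDiffAt {f : X → ℝ} (hf : IsSmooth n f) {c : OpenPartialHomeomorph X (Cn n)}
    (hc : c ∈ atlas (Cn n) X) {z : Cn n} (hz : z ∈ c.target) :
    ContDiffAt ℝ ∞ (f ∘ c.symm) z := by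
  have := isManifold_real n X
  have h1 : ContMDiffOn 𝓘(ℝ, Cn n) 𝓘(ℝ, Cn n) ∞ c.symm c.target :=
    contMDiffOn_symm_of_mem_maximalAtlas (IsManifold.subset_maximalAtlas hc)
  exact ((hf.comp_contMDiffOn h1).contMDiffAt (c.open_target.mem_nhds hz)).contDiffAt

theorem isSmooth_of_contDiffAt {f : X → ℝ}
    (hf : ∀ x : X, ContDiffAt ℝ ∞ (f ∘ (chartAt (Cn n) x).symm) (chartAt (Cn n) x x)) :
    IsSmooth n f := by
  have := isManifold_real n X
  intro x
  have h1 : ContMDiffAt 𝓘(ℝ, Cn n) 𝓘(ℝ, Cn n) ∞ (chartAt (Cn n) x) x :=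
    (contMDiffOn_chart (I := 𝓘(ℝ, Cn n)) (x := x)).contMDiffAt
      ((chartAt (Cn n) x).open_source.mem_nhds (mem_chart_source _ _))
  have h2 := (hf x).contMDiffAt.comp x h1
  refine h2.congr_of_eventuallyEq ?_
  filter_upwards [(chartAt (Cn n) x).open_source.mem_nhds (mem_chart_source _ _)] with y hy
  simp [(chartAt (Cn n) x).left_inv hy]

/-- Although `ddbar` is defined point by point in varying charts, it has the flat expression in any
chart, because `i∂∂̄` commutes with holomorphic coordinate changes. -/
theorem inChart_ddbar {f : X → ℝ} (hf : IsSmooth n f) {c : OpenPartialHomeomorph X (Cn n)}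
    (hc : c ∈ atlas (Cn n) X) {z : Cn n} (hz : z ∈ c.target) :
    inChart (ddbar n f) c z = ddbarFlat (f ∘ c.symm) z := by
  set c' := chartAt (Cn n) (c.symm z) with hc'
  have hz' : z ∈ (c.symm.trans c').source := by
    rw [OpenPartialHomeomorph.trans_source]
    exact ⟨hz, mem_chart_source _ _⟩
  have h1 : f ∘ c.symm =ᶠ[𝓝 z] (f ∘ c'.symm) ∘ (c' ∘ c.symm) := by
    filter_upwards [(c.symm.trans c').open_source.mem_nhds hz'] with y hy
    rw [OpenPartialHomeomorph.trans_source] at hy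
    simp only [Function.comp_apply]
    rw [c'.left_inv hy.2]
  rw [ddbarFlat_congr h1, ddbarFlat_comp (c.symm.trans c').open_source hz'
    ((contDiffOn_transition hc (chart_mem_atlas _ _)).of_le le_top)]
  · exact inChart_pullAt (fun x => ddbarFlat (f ∘ (chartAt (Cn n) x).symm)) hc hz
  · exact (hf.contDiffAt (chart_mem_atlas _ _) (mem_chart_target _ _)).of_le two_le_infty

theorem IsPositive.inChart_pos {α : TwoForm n X} (hα : IsPositive α)
    {c : OpenPartialHomeomorph X (Cn n)} (hc : c ∈ atlas (Cn n) X) {z : Cn n} (hz : z ∈ c.target)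
    (u : Cn n) (hu : u ≠ 0) : 0 < inChart α c z ![u, cplxJ n u] := by
  have h1 := mfderiv_chart_comp_symm hc hc (z := z)
    (by rw [OpenPartialHomeomorph.trans_source]; exact ⟨hz, c.map_target hz⟩)
  have h2 : c ∘ c.symm =ᶠ[𝓝 z] id := by
    filter_upwards [c.open_target.mem_nhds hz] with y hy
    exact c.right_inv hy
  rw [h2.fderiv_eq, fderiv_id] at h1
  have hu' : (mfderiv 𝓘(ℂ, Cn n) 𝓘(ℂ, Cn n) c.symm z) u ≠ 0 := by
    intro h0
    apply hu
    have := congrArg (fun L : Cn n →L[ℂ] Cn n => L u) h1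
    simp only [ContinuousLinearMap.id_apply] at this
    rw [← this]
    exact (congrArg (mfderiv 𝓘(ℂ, Cn n) 𝓘(ℂ, Cn n) c (c.symm z)) h0).trans (map_zero _)
  have h3 := hα (c.symm z) _ hu'
  have key : inChart α c z ![u, cplxJ n u]
      = α (c.symm z) ![(mfderiv 𝓘(ℂ, Cn n) 𝓘(ℂ, Cn n) c.symm z) u,
          Complex.I • (mfderiv 𝓘(ℂ, Cn n) 𝓘(ℂ, Cn n) c.symm z) u] := by
    refine congrArg (fun w : Fin 2 → Cn n => α (c.symm z) w) (funext fun i => ?_)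
    fin_cases i
    · rfl
    · exact ContinuousLinearMap.map_smul (mfderiv 𝓘(ℂ, Cn n) 𝓘(ℂ, Cn n) c.symm z) Complex.I u
  rw [key]
  exact h3

theorem isClosedOneOne_ddbar {f : X → ℝ} (hf : IsSmooth n f) : IsClosedOneOne (ddbar n f) where
  type_one_one x u v := by
    have h := isOneOne_ddbarFlat ((hf.contDiffAt (chart_mem_atlas (Cn n) x)
      (mem_chart_target _ x)).of_le two_le_infty)
      ((mfderiv 𝓘(ℂ, Cn n) 𝓘(ℂ, Cn n) (chartAt (Cn n) x) x) u)
      ((mfderiv 𝓘(ℂ, Cn n) 𝓘(ℂ, Cn n) (chartAt (Cn n) x) x) v)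
    have key : ∀ u v : Cn n, ddbar n f x ![u, v]
        = ddbarFlat (f ∘ (chartAt (Cn n) x).symm) (chartAt (Cn n) x x)
          ![(mfderiv 𝓘(ℂ, Cn n) 𝓘(ℂ, Cn n) (chartAt (Cn n) x) x) u,
            (mfderiv 𝓘(ℂ, Cn n) 𝓘(ℂ, Cn n) (chartAt (Cn n) x) x) v] := by
      intro u v
      refine congrArg (fun w : Fin 2 → Cn n => ddbarFlat (f ∘ (chartAt (Cn n) x).symm)
        (chartAt (Cn n) x x) w) (funext fun i => ?_)
      fin_cases i <;> rfl
    refine (key _ _).trans (Eq.trans ?_ (h.trans (key _ _).symm))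
    refine congrArg (fun w : Fin 2 → Cn n => ddbarFlat (f ∘ (chartAt (Cn n) x).symm)
      (chartAt (Cn n) x x) w) (funext fun i => ?_)
    fin_cases i
    · exact ContinuousLinearMap.map_smul
        (mfderiv 𝓘(ℂ, Cn n) 𝓘(ℂ, Cn n) (chartAt (Cn n) x) x) Complex.I u
    · exact ContinuousLinearMap.map_smul
        (mfderiv 𝓘(ℂ, Cn n) 𝓘(ℂ, Cn n) (chartAt (Cn n) x) x) Complex.I v
  smooth c hc := by
    refine ContDiffOn.congr (f := ddbarFlat (f ∘ c.symm)) (fun z hz => ?_)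
      fun z hz => inChart_ddbar hf hc hz
    exact (contDiffAt_ddbarFlat (hf.contDiffAt hc hz)).contDiffWithinAt
  closed c hc z hz := by
    have : inChart (ddbar n f) c =ᶠ[𝓝 z] ddbarFlat (f ∘ c.symm) := by
      filter_upwards [c.open_target.mem_nhds hz] with y hy
      exact inChart_ddbar hf hc hy
    rw [this.extDeriv_eq, extDeriv_ddbarFlat (hf.contDiffAt hc hz)]

end Smooth

end Charts

theorem mem_transition_source {n : ℕ} {X : Type*} [TopologicalSpace X]
    {c c' : OpenPartialHomeomorph X (Cn n)} {x : X} (hx : x ∈ c.source)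
    (hx' : x ∈ c'.source) : c x ∈ (c.symm.trans c').source := by
  rw [OpenPartialHomeomorph.trans_source]
  refine ⟨c.map_source hx, ?_⟩
  rwa [mem_preimage, c.left_inv hx]

/-! ### Densities of (n,n)-forms and their quotients -/

section Densities

open Matrix ComplexConjugate

variable {n : ℕ} {X : Type*} [TopologicalSpace X] [ChartedSpace (Cn n) X]

/-- The transposed complex Jacobian matrix of the coordinate change from `c` to `c'`. -/
def jac (c c' : OpenPartialHomeomorph X (Cn n)) (z : Cn n) : Matrix (Fin n) (Fin n) ℂ :=
  (LinearMap.toMatrix' (fderiv ℂ (c' ∘ c.symm) z : Cn n →ₗ[ℂ] Cn n))ᵀ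

/-- A density on `X`: a family of functions in the charts which transforms as the density of an
`(n,n)`-form. -/
structure IsDensity (D : OpenPartialHomeomorph X (Cn n) → Cn n → ℝ) : Prop where
  transition : ∀ c ∈ atlas (Cn n) X, ∀ c' ∈ atlas (Cn n) X, ∀ z ∈ (c.symm.trans c').source,
    D c z = Complex.normSq (jac c c' z).det * D c' (c' (c.symm z))
  continuousOn : ∀ c ∈ atlas (Cn n) X, ContinuousOn (D c) c.target

/-- The quotient of two densities, as a function on `X`. -/
def relDens (D D₀ : OpenPartialHomeomorph X (Cn n) → Cn n → ℝ) (x : X) : ℝ :=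
  D (chartAt (Cn n) x) (chartAt (Cn n) x x) / D₀ (chartAt (Cn n) x) (chartAt (Cn n) x x)

/-- The factor `2ⁿ n!` between `ηⁿ` and the determinant of the coefficients of `η`. -/
def volConst (n : ℕ) : ℝ := 2 ^ n * n.factorial

theorem volConst_pos (n : ℕ) : 0 < volConst n := by
  unfold volConst
  positivity

/-- The density of `n α ∧ ηⁿ⁻¹`. -/
def mixDens (α η : TwoForm n X) (c : OpenPartialHomeomorph X (Cn n)) (z : Cn n) : ℝ :=
  volConst n *
    (trace (adjugate (coeffMatrix (inChart η c z)) * coeffMatrix (inChart α c z))).re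

/-- The density of `⟨∇u, ∇v⟩ ηⁿ`. -/
def gradDens (η : TwoForm n X) (u v : X → ℝ) (c : OpenPartialHomeomorph X (Cn n)) (z : Cn n) : ℝ :=
  volConst n * (gradPair (coeffMatrix (inChart η c z)) (delFlat (u ∘ c.symm) z)
    (delFlat (v ∘ c.symm) z)).re

theorem wedgeInChart_powTop (η : TwoForm n X) (c : OpenPartialHomeomorph X (Cn n)) (z : Cn n) :
    wedgeInChart (powTop η) c z
      = volConst n * ((coeffMatrix (inChart η c z)).det).re := by
  rw [volConst, mul_assoc, ← wedgeDensity_const]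
  rfl

theorem natCast_mul_wedgeInChart (α η : TwoForm n X) (c : OpenPartialHomeomorph X (Cn n))
    (z : Cn n) : n * wedgeInChart (wedgePow α η) c z = mixDens α η c z := by
  have h : (fun m => inChart (wedgePow α η m) c z)
      = fun m : Fin n => if (m : ℕ) = 0 then inChart α c z else inChart η c z := by
    funext m
    rw [wedgePow]
    split_ifs <;> rfl
  rw [mixDens, volConst, mul_assoc, ← natCast_mul_wedgeDensity, wedgeInChart, h]

theorem gradPair_eq_dotProduct (a : Matrix (Fin n) (Fin n) ℂ) (d d' : Fin n → ℂ) :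
    gradPair a d d' = star d' ⬝ᵥ (adjugate a *ᵥ d) := by
  simp only [gradPair, dotProduct, mulVec, Finset.mul_sum]
  rw [Finset.sum_comm]
  refine Finset.sum_congr rfl fun k _ => Finset.sum_congr rfl fun j _ => ?_
  rw [Pi.star_apply, starRingEnd_apply]
  ring

theorem gradPair_transform (a P : Matrix (Fin n) (Fin n) ℂ) (d d' : Fin n → ℂ) :
    gradPair (P * a * Pᴴ) (P *ᵥ d) (P *ᵥ d') = Complex.normSq P.det * gradPair a d d' := by
  rw [gradPair_eq_dotProduct, gradPair_eq_dotProduct, star_mulVec, adjugate_mul_distrib,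
    adjugate_mul_distrib, mulVec_mulVec, Matrix.mul_assoc, Matrix.mul_assoc, adjugate_mul,
    ← dotProduct_mulVec, mulVec_mulVec, ← Matrix.mul_assoc, mul_adjugate, det_conjTranspose,
    Complex.normSq_eq_conj_mul_self]
  simp only [Matrix.smul_mul, Matrix.mul_smul, Matrix.one_mul, Matrix.mul_one, smul_mulVec,
    dotProduct_smul, smul_eq_mul, starRingEnd_apply]
  ring

theorem gradPair_zero_left (a : Matrix (Fin n) (Fin n) ℂ) (d' : Fin n → ℂ) :
    gradPair a 0 d' = 0 := by
  simp [gradPair_eq_dotProduct]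

/-- For Hermitian `a`, exchanging the arguments conjugates the pairing. This is the source of the
self-adjointness of `v ↦ n i∂∂̄v ∧ ηⁿ⁻¹`. -/
theorem re_gradPair_comm {a : Matrix (Fin n) (Fin n) ℂ} (ha : a.IsHermitian) (d d' : Fin n → ℂ) :
    (gradPair a d d').re = (gradPair a d' d).re := by
  have h : gradPair a d' d = star (gradPair a d d') := by
    rw [gradPair_eq_dotProduct, gradPair_eq_dotProduct, star_dotProduct, star_mulVec,
      adjugate_conjTranspose, ha.eq, dotProduct_mulVec]
  rw [h]
  exact (Complex.conj_re _).symm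

theorem continuousOn_coeffMatrix {α : TwoForm n X}
    {c : OpenPartialHomeomorph X (Cn n)} (hα : IsClosedOneOne α)
    (hc : c ∈ atlas (Cn n) X) :
    ContinuousOn (fun z => coeffMatrix (inChart α c z)) c.target := by
  refine continuousOn_pi.2 fun j => continuousOn_pi.2 fun k => fun z hz => ?_
  exact (contDiffAt_coeffMatrix (hα.contDiffAt hc hz) j k).continuousAt.continuousWithinAt

section Transition

variable [IsManifold 𝓘(ℂ, Cn n) ω X]
  {c c' : OpenPartialHomeomorph X (Cn n)} {z : Cn n}

theorem normSq_det_jac_ne_zero (hc : c ∈ atlas (Cn n) X) (hc' : c' ∈ atlas (Cn n) X)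
    (hz : z ∈ (c.symm.trans c').source) : Complex.normSq (jac c c' z).det ≠ 0 := by
  rw [jac, det_transpose]
  exact fun h => det_transition_ne_zero hc hc' hz (Complex.normSq_eq_zero.1 h)

theorem abs_det_fderiv_transition (hc : c ∈ atlas (Cn n) X) (hc' : c' ∈ atlas (Cn n) X)
    (hz : z ∈ (c.symm.trans c').source) :
    |(fderiv ℝ (c' ∘ c.symm) z).det| = Complex.normSq (jac c c' z).det := by
  have hd := ((contDiffOn_transition hc hc').contDiffAt
    ((c.symm.trans c').open_source.mem_nhds hz)).differentiableAt (by simp)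
  rw [hd.fderiv_restrictScalars ℝ, det_restrictScalars, jac, det_transpose,
    abs_of_nonneg (Complex.normSq_nonneg _)]

theorem IsClosedOneOne.coeffMatrix_transition {α : TwoForm n X} (hα : IsClosedOneOne α)
    (hc : c ∈ atlas (Cn n) X) (hc' : c' ∈ atlas (Cn n) X) (hz : z ∈ (c.symm.trans c').source) :
    coeffMatrix (inChart α c z)
      = jac c c' z * coeffMatrix (inChart α c' (c' (c.symm z))) * (jac c c' z)ᴴ := by
  rw [inChart_transition hc hc' hz, (hα.isOneOne_inChart _ _).coeffMatrix_comp]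
  rfl

theorem delFlat_transition {f : X → ℝ} (hf : IsSmooth n f)
    (hc : c ∈ atlas (Cn n) X) (hc' : c' ∈ atlas (Cn n) X) (hz : z ∈ (c.symm.trans c').source) :
    delFlat (f ∘ c.symm) z = jac c c' z *ᵥ delFlat (f ∘ c'.symm) (c' (c.symm z)) := by
  have hz' := hz
  rw [OpenPartialHomeomorph.trans_source] at hz'
  have hd := ((contDiffOn_transition hc hc').contDiffAt
    ((c.symm.trans c').open_source.mem_nhds hz)).differentiableAt (by simp)
  have hfd : DifferentiableAt ℝ (f ∘ c'.symm) ((c' ∘ c.symm) z) :=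
    (hf.contDiffAt hc' (c'.map_source hz'.2)).differentiableAt (by simp)
  have h1 : f ∘ c.symm =ᶠ[𝓝 z] (f ∘ c'.symm) ∘ (c' ∘ c.symm) := by
    filter_upwards [(c.symm.trans c').open_source.mem_nhds hz] with y hy
    rw [OpenPartialHomeomorph.trans_source] at hy
    simp only [Function.comp_apply]
    rw [c'.left_inv hy.2]
  have h2 : fderiv ℝ (f ∘ c.symm) z
      = (fderiv ℝ (f ∘ c'.symm) ((c' ∘ c.symm) z)).comp
        ((fderiv ℂ (c' ∘ c.symm) z).restrictScalars ℝ) := by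
    rw [h1.fderiv_eq, fderiv_comp z hfd (hd.restrictScalars ℝ), hd.fderiv_restrictScalars ℝ]
  set L : Cn n →L[ℝ] ℝ := fderiv ℝ (f ∘ c'.symm) ((c' ∘ c.symm) z) with hL
  set A : Cn n →L[ℂ] Cn n := fderiv ℂ (c' ∘ c.symm) z with hA
  -- `ℓ` is the complex-linear part of the real differential `L`. Composition with the
  -- complex-linear `A` respects types, so the chain rule reduces to expanding `A e_j` in the basis.
  let ℓ : Cn n →ₗ[ℂ] ℂ :=
    { toFun := fun u => (1 / 2 : ℂ) * ((L u : ℂ) - Complex.I * (L (cplxJ n u) : ℂ))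
      map_add' := fun u v => by simp only [map_add]; push_cast; ring
      map_smul' := fun s u => by
        have h3 : s • u = s.re • u + s.im • cplxJ n u := by
          ext i
          simp only [cplxJ_apply, Pi.smul_apply, Pi.add_apply, smul_eq_mul, Complex.real_smul]
          conv_lhs => rw [← Complex.re_add_im s]
          ring
        rw [h3]
        simp only [map_add, map_smul, cplxJ_cplxJ, map_neg, smul_eq_mul, RingHom.id_apply]
        conv_rhs => rw [← Complex.re_add_im s]
        push_cast
        linear_combination (1 / 2 * s.im * L (cplxJ n u) : ℂ) * Complex.I_mul_I }
  have hℓ : ∀ j, ℓ (stdVec n j) = delFlat (f ∘ c'.symm) (c' (c.symm z)) j := fun j => rfl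
  funext j
  have h4 : delFlat (f ∘ c.symm) z j = ℓ (A (stdVec n j)) := by
    rw [delFlat, h2]
    simp [ℓ, cplxJ_apply]
  rw [h4, ℓ.pi_apply_eq_sum_univ]
  simp only [mulVec, dotProduct, jac, transpose_apply, LinearMap.toMatrix'_apply, smul_eq_mul]
  refine Finset.sum_congr rfl fun p _ => ?_
  have h5 : (fun i : Fin n => if p = i then (1 : ℂ) else 0) = stdVec n p := by
    funext i
    simp [stdVec, Pi.single_apply, eq_comm]
  rw [h5, hℓ]
  congr 2

theorem continuousOn_delFlat {f : X → ℝ} (hf : IsSmooth n f) (hc : c ∈ atlas (Cn n) X) :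
    ContinuousOn (fun z => delFlat (f ∘ c.symm) z) c.target := by
  refine continuousOn_pi.2 fun j => fun z hz => ?_
  have := (contDiffAt_conj_delFlat (hf.contDiffAt hc hz) j).continuousAt
  have h2 : ContinuousAt (fun y => conj (conj (delFlat (f ∘ c.symm) y j))) z :=
    Complex.continuous_conj.continuousAt.comp this
  simpa using h2.continuousWithinAt

theorem isDensity_powTop {η : TwoForm n X} (hη : IsClosedOneOne η) :
    IsDensity (wedgeInChart (powTop η)) where
  transition c hc c' hc' z hz := by
    rw [wedgeInChart_powTop, wedgeInChart_powTop, hη.coeffMatrix_transition hc hc' hz,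
      det_mul_mul_conjTranspose, Complex.re_ofReal_mul]
    ring
  continuousOn c hc := by
    simp only [funext (wedgeInChart_powTop η c)]
    have h : Continuous fun a : Matrix (Fin n) (Fin n) ℂ => volConst n * a.det.re :=
      continuous_const.mul (Complex.continuous_re.comp continuous_id.matrix_det)
    exact h.comp_continuousOn (continuousOn_coeffMatrix hη hc)

theorem isDensity_mixDens {α η : TwoForm n X} (hα : IsClosedOneOne α) (hη : IsClosedOneOne η) :
    IsDensity (mixDens α η) where
  transition c hc c' hc' z hz := by
    rw [mixDens, mixDens, hη.coeffMatrix_transition hc hc' hz,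
      hα.coeffMatrix_transition hc hc' hz, coeffMatrix_comp_adjugate, Complex.re_ofReal_mul]
    ring
  continuousOn c hc := by
    have h : Continuous fun p : Matrix (Fin n) (Fin n) ℂ × Matrix (Fin n) (Fin n) ℂ =>
        volConst n * (trace (adjugate p.1 * p.2)).re :=
      continuous_const.mul (Complex.continuous_re.comp (Continuous.matrix_trace
        (continuous_fst.matrix_adjugate.matrix_mul continuous_snd)))
    have h' := h.comp_continuousOn
      ((continuousOn_coeffMatrix hη hc).prodMk (continuousOn_coeffMatrix hα hc))
    refine h'.congr fun z _ => ?_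
    simp only [mixDens, Function.comp_apply]

theorem isDensity_gradDens {η : TwoForm n X} (hη : IsClosedOneOne η) {u v : X → ℝ}
    (hu : IsSmooth n u) (hv : IsSmooth n v) : IsDensity (gradDens η u v) where
  transition c hc c' hc' z hz := by
    rw [gradDens, gradDens, hη.coeffMatrix_transition hc hc' hz, delFlat_transition hu hc hc' hz,
      delFlat_transition hv hc hc' hz, gradPair_transform, Complex.re_ofReal_mul]
    ring
  continuousOn c hc := by
    have h : Continuous fun p : Matrix (Fin n) (Fin n) ℂ × (Fin n → ℂ) × (Fin n → ℂ) =>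
        volConst n * (gradPair p.1 p.2.1 p.2.2).re := by
      simp only [gradPair_eq_dotProduct]
      exact continuous_const.mul (Complex.continuous_re.comp (continuous_snd.snd.star.dotProduct
        (continuous_fst.matrix_adjugate.matrix_mulVec continuous_snd.fst)))
    have h' := h.comp_continuousOn ((continuousOn_coeffMatrix hη hc).prodMk
      ((continuousOn_delFlat hu hc).prodMk (continuousOn_delFlat hv hc)))
    refine h'.congr fun z _ => ?_
    simp only [gradDens, Function.comp_apply]

/-- Both densities pick up the same nonzero Jacobian factor, which cancels in the quotient. -/
theorem IsDensity.relDens_eq {D D₀ : OpenPartialHomeomorph X (Cn n) → Cn n → ℝ}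
    (hD : IsDensity D) (hD₀ : IsDensity D₀) (hc : c ∈ atlas (Cn n) X) {x : X}
    (hx : x ∈ c.source) : relDens D D₀ x = D c (c x) / D₀ c (c x) := by
  have hz := mem_transition_source hx (mem_chart_source (Cn n) x)
  rw [hD.transition c hc _ (chart_mem_atlas (Cn n) x) _ hz,
    hD₀.transition c hc _ (chart_mem_atlas (Cn n) x) _ hz,
    mul_div_mul_left _ _ (normSq_det_jac_ne_zero hc (chart_mem_atlas _ _) hz), c.left_inv hx]
  rfl

theorem IsDensity.eq_relDens_mul {D D₀ : OpenPartialHomeomorph X (Cn n) → Cn n → ℝ}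
    (hD : IsDensity D) (hD₀ : IsDensity D₀) (hc : c ∈ atlas (Cn n) X) (hz : z ∈ c.target)
    (h0 : D₀ c z ≠ 0) : D c z = relDens D D₀ (c.symm z) * D₀ c z := by
  rw [hD.relDens_eq hD₀ hc (c.map_target hz), c.right_inv hz, div_mul_cancel₀ _ h0]

theorem IsDensity.continuous_relDens {D D₀ : OpenPartialHomeomorph X (Cn n) → Cn n → ℝ}
    (hD : IsDensity D) (hD₀ : IsDensity D₀)
    (h0 : ∀ c ∈ atlas (Cn n) X, ∀ z ∈ c.target, D₀ c z ≠ 0) : Continuous (relDens D D₀) := by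
  rw [continuous_iff_continuousAt]
  intro x
  set c := chartAt (Cn n) x
  have hc : c ∈ atlas (Cn n) X := chart_mem_atlas _ _
  have hx : x ∈ c.source := mem_chart_source _ _
  have h1 : (fun y => D c (c y) / D₀ c (c y)) =ᶠ[𝓝 x] relDens D D₀ := by
    filter_upwards [c.open_source.mem_nhds hx] with y hy
    exact (hD.relDens_eq hD₀ hc hy).symm
  refine ContinuousAt.congr ?_ h1
  have hcx := c.continuousAt hx
  have ht := c.open_target.mem_nhds (c.map_source hx)
  exact ContinuousAt.div₀ (((hD.continuousOn c hc).continuousAt ht).comp hcx)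
    (((hD₀.continuousOn c hc).continuousAt ht).comp hcx) (h0 c hc _ (c.map_source hx))

theorem IsKahler.wedgeInChart_pos {η : TwoForm n X} (hη : IsKahler η)
    (hc : c ∈ atlas (Cn n) X) (hz : z ∈ c.target) : 0 < wedgeInChart (powTop η) c z := by
  rw [wedgeInChart_powTop]
  have h1 := ((hη.isOneOne_inChart c z).posDef_coeffMatrix (hη.pos.inChart_pos hc hz)).det_pos
  exact mul_pos (volConst_pos n) (Complex.lt_def.1 h1).1

end Transition

end Densities

/-! ### Bounded functionals and differentiation under the integral sign -/

section Functional

variable {Y : Type*} [TopologicalSpace Y]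

/-- A functional which is linear and bounded for the supremum norm on continuous functions. -/
structure IsBddFunctional (Λ : (Y → ℝ) → ℝ) : Prop where
  map_add : ∀ f g : Y → ℝ, Continuous f → Continuous g → Λ (fun y => f y + g y) = Λ f + Λ g
  map_smul : ∀ (r : ℝ) (f : Y → ℝ), Continuous f → Λ (fun y => r * f y) = r * Λ f
  bdd : ∃ C : ℝ, 0 ≤ C ∧ ∀ (f : Y → ℝ) (M : ℝ), Continuous f → (∀ y, |f y| ≤ M) → |Λ f| ≤ C * M

theorem IsBddFunctional.map_sub {Λ : (Y → ℝ) → ℝ} (hΛ : IsBddFunctional Λ) {f g : Y → ℝ}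
    (hf : Continuous f) (hg : Continuous g) : Λ (fun y => f y - g y) = Λ f - Λ g := by
  have h := hΛ.map_add f (fun y => (-1) * g y) hf (continuous_const.mul hg)
  rw [hΛ.map_smul _ _ hg] at h
  simpa [sub_eq_add_neg] using h

theorem IsBddFunctional.map_zero {Λ : (Y → ℝ) → ℝ} (hΛ : IsBddFunctional Λ) :
    Λ (fun _ => 0) = 0 := by
  have h := hΛ.map_smul 0 (fun _ => 0) continuous_const
  simpa using h

theorem IsBddFunctional.map_sum {Λ : (Y → ℝ) → ℝ} (hΛ : IsBddFunctional Λ) {ι : Type*}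
    (s : Finset ι) (f : ι → Y → ℝ) (hf : ∀ i, Continuous (f i)) :
    Λ (fun y => ∑ i ∈ s, f i y) = ∑ i ∈ s, Λ (f i) := by
  classical
  induction s using Finset.induction_on with
  | empty => simpa using hΛ.map_zero
  | insert i s hi ih =>
    simp only [Finset.sum_insert hi]
    rw [hΛ.map_add _ _ (hf i) (continuous_finsetSum _ fun j _ => hf j), ih]

theorem isBddFunctional_sum {ι : Type*} (s : Finset ι) {Λ : ι → (Y → ℝ) → ℝ}
    (h : ∀ i ∈ s, IsBddFunctional (Λ i)) : IsBddFunctional fun f => ∑ i ∈ s, Λ i f where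
  map_add f g hf hg := by
    rw [← Finset.sum_add_distrib]
    exact Finset.sum_congr rfl fun i hi => (h i hi).map_add f g hf hg
  map_smul r f hf := by
    rw [Finset.mul_sum]
    exact Finset.sum_congr rfl fun i hi => (h i hi).map_smul r f hf
  bdd := by
    choose! C hC0 hC using fun i hi => (h i hi).bdd
    refine ⟨∑ i ∈ s, C i, Finset.sum_nonneg hC0, fun f M hf hM => ?_⟩
    rw [Finset.sum_mul]
    exact (Finset.abs_sum_le_sum_abs _ _).trans
      (Finset.sum_le_sum fun i hi => hC i hi f M hf hM)

theorem isBddFunctional_integral {Ω : Type*} [MeasurableSpace Ω] (μ : Measure Ω) (p : Ω → Y)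
    (w : Ω → ℝ) (h : ∀ f : Y → ℝ, Continuous f → Integrable (fun z => f (p z) * w z) μ) :
    IsBddFunctional fun f : Y → ℝ => ∫ z, f (p z) * w z ∂μ where
  map_add f g hf hg := by
    rw [← integral_add (h f hf) (h g hg)]
    simp only [add_mul]
  map_smul r f hf := by
    rw [← integral_const_mul]
    simp only [mul_assoc]
  bdd := by
    have hw : Integrable w μ := by simpa using h (fun _ => 1) continuous_const
    refine ⟨∫ z, |w z| ∂μ, integral_nonneg fun z => abs_nonneg _, fun f M hf hM => ?_⟩
    calc |∫ z, f (p z) * w z ∂μ| ≤ ∫ z, |w z| * M ∂μ := by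
          rw [← Real.norm_eq_abs]
          refine norm_integral_le_of_norm_le (hw.abs.mul_const M)
            (Filter.Eventually.of_forall fun z => ?_)
          rw [Real.norm_eq_abs, abs_mul, mul_comm]
          exact mul_le_mul_of_nonneg_left (hM _) (abs_nonneg _)
      _ = (∫ z, |w z| ∂μ) * M := integral_mul_const M _

/-- Integration over `[0,1]` as a functional on continuous functions on the interval. -/
theorem isBddFunctional_unitInterval :
    IsBddFunctional fun f : Icc (0 : ℝ) 1 → ℝ =>
      ∫ r in (0 : ℝ)..1, f (projIcc 0 1 zero_le_one r) := by
  have h := isBddFunctional_integral (volume.restrict (Ioc (0 : ℝ) 1))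
    (projIcc (0 : ℝ) 1 zero_le_one) (fun _ => 1) fun f hf => by
      have : Continuous fun r => f (projIcc (0 : ℝ) 1 zero_le_one r) * 1 :=
        (hf.comp continuous_projIcc).mul continuous_const
      exact (this.integrableOn_Icc (a := 0) (b := 1)).mono_set Ioc_subset_Icc_self
  simpa [intervalIntegral.integral_of_le zero_le_one] using h

theorem continuous_slice {P : Type*} [TopologicalSpace P] {S : Set P} {G : P → Y → ℝ}
    (hG : ContinuousOn (fun p : P × Y => G p.1 p.2) (S ×ˢ univ)) {t : P} (ht : t ∈ S) :
    Continuous (G t) := by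
  have h := hG.comp_continuous (f := fun y : Y => (t, y)) (by fun_prop) fun y => ⟨ht, mem_univ y⟩
  exact h

variable [CompactSpace Y]

/-- Compactness of `Y` upgrades joint continuity to uniform closeness of the slices. -/
theorem eventually_abs_sub_le {P : Type*} [TopologicalSpace P] {S : Set P} {G : P → Y → ℝ}
    (hG : ContinuousOn (fun p : P × Y => G p.1 p.2) (S ×ˢ univ)) {t : P} (ht : t ∈ S) {ε : ℝ}
    (hε : 0 < ε) : ∀ᶠ s in 𝓝[S] t, ∀ y, |G s y - G t y| ≤ ε := by
  obtain ⟨v, hv, h⟩ := isCompact_univ.mem_uniformity_of_prod (f := G) hG ht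
    (Metric.dist_mem_uniformity hε)
  filter_upwards [hv] with s hs y
  exact (h s hs y (mem_univ y)).le

theorem IsBddFunctional.continuousOn {Λ : (Y → ℝ) → ℝ} (hΛ : IsBddFunctional Λ) {P : Type*}
    [TopologicalSpace P] {S : Set P} {G : P → Y → ℝ}
    (hG : ContinuousOn (fun p : P × Y => G p.1 p.2) (S ×ˢ univ)) :
    ContinuousOn (fun s => Λ (G s)) S := by
  intro t ht
  obtain ⟨C, hC0, hC⟩ := hΛ.bdd
  rw [ContinuousWithinAt, Metric.tendsto_nhds]
  intro ε hε
  -- The bound `C` may be zero, hence `C + 1`.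
  have hε' : 0 < ε / (C + 1) := by positivity
  filter_upwards [eventually_abs_sub_le hG ht hε', self_mem_nhdsWithin] with s hs hsS
  have hcs := continuous_slice hG hsS
  have hct := continuous_slice hG ht
  rw [Real.dist_eq, ← hΛ.map_sub hcs hct]
  calc |Λ fun y => G s y - G t y| ≤ C * (ε / (C + 1)) := hC _ _ (hcs.sub hct) hs
    _ < (C + 1) * (ε / (C + 1)) := mul_lt_mul_of_pos_right (by linarith) hε'
    _ = ε := by field_simp

/-- Near `t` the derivatives `G' r` are uniformly close to `G' t`, so the mean value inequality on a
convex piece of `J` bounds the error of linearisation by a small multiple of `|s - t|`, uniformly in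
`y`; boundedness of `Λ` carries the estimate over. Only convexity of `J` is used, so `t` may be an
endpoint. -/
theorem IsBddFunctional.hasDerivWithinAt {Λ : (Y → ℝ) → ℝ} (hΛ : IsBddFunctional Λ) {J : Set ℝ}
    (hJ : Convex ℝ J) {G G' : ℝ → Y → ℝ} (hG : ∀ t ∈ J, Continuous (G t))
    (hG' : ContinuousOn (fun p : ℝ × Y => G' p.1 p.2) (J ×ˢ univ))
    (hd : ∀ t ∈ J, ∀ y, HasDerivWithinAt (fun s => G s y) (G' t y) J t) {t : ℝ} (ht : t ∈ J) :
    HasDerivWithinAt (fun s => Λ (G s)) (Λ (G' t)) J t := by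
  obtain ⟨C, hC0, hC⟩ := hΛ.bdd
  rw [hasDerivWithinAt_iff_isLittleO, Asymptotics.isLittleO_iff]
  intro ε hε
  have hε' : 0 < ε / (C + 1) := by positivity
  have h1 := eventually_abs_sub_le hG' ht hε'
  rw [Filter.Eventually, Metric.mem_nhdsWithin_iff] at h1
  obtain ⟨δ, hδ, hsub⟩ := h1
  have hcG't := continuous_slice hG' ht
  filter_upwards [inter_mem_nhdsWithin J (Metric.ball_mem_nhds t hδ)] with s hs
  have hmv : ∀ y, |G s y - G t y - (s - t) * G' t y| ≤ ε / (C + 1) * |s - t| := by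
    intro y
    have hder : ∀ r ∈ J ∩ Metric.ball t δ, HasDerivWithinAt (fun r => G r y - r * G' t y)
        (G' r y - G' t y) (J ∩ Metric.ball t δ) r := by
      intro r hr
      have hid : HasDerivWithinAt (fun r : ℝ => r) 1 (J ∩ Metric.ball t δ) r :=
        hasDerivWithinAt_id r _
      have := ((hd r hr.1 y).mono inter_subset_left).fun_sub (hid.mul_const (G' t y))
      simpa using this
    have hb : ∀ r ∈ J ∩ Metric.ball t δ, ‖G' r y - G' t y‖ ≤ ε / (C + 1) := fun r hr =>
      hsub ⟨hr.2, hr.1⟩ y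
    have := (hJ.inter (convex_ball t δ)).norm_image_sub_le_of_norm_hasDerivWithin_le hder hb
      ⟨ht, Metric.mem_ball_self hδ⟩ hs
    rw [Real.norm_eq_abs, Real.norm_eq_abs] at this
    convert this using 2
    ring
  have hcs := hG s hs.1
  have hct := hG t ht
  have heq : Λ (G s) - Λ (G t) - (s - t) * Λ (G' t)
      = Λ fun y => G s y - G t y - (s - t) * G' t y := by
    rw [hΛ.map_sub (f := fun y => G s y - G t y) (g := fun y => (s - t) * G' t y) (hcs.sub hct)
      (continuous_const.mul hcG't), hΛ.map_sub hcs hct,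
      hΛ.map_smul _ _ hcG't]
  rw [smul_eq_mul, heq, Real.norm_eq_abs, Real.norm_eq_abs]
  calc |Λ fun y => G s y - G t y - (s - t) * G' t y| ≤ C * (ε / (C + 1) * |s - t|) :=
        hC _ _ ((hcs.sub hct).sub (continuous_const.mul hcG't)) hmv
    _ = C / (C + 1) * (ε * |s - t|) := by ring
    _ ≤ 1 * (ε * |s - t|) := by
        refine mul_le_mul_of_nonneg_right ?_ (by positivity)
        rw [div_le_one (by positivity)]
        linarith
    _ = ε * |s - t| := one_mul _

end Functional

theorem integral_eq_sub_of_hasDerivWithinAt_Icc {f f' : ℝ → ℝ}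
    (hd : ∀ t ∈ Icc (0 : ℝ) 1, HasDerivWithinAt f (f' t) (Icc 0 1) t)
    (hc : ContinuousOn f' (Icc 0 1)) : ∫ t in (0 : ℝ)..1, f' t = f 1 - f 0 := by
  refine intervalIntegral.integral_eq_sub_of_hasDerivAt_of_le zero_le_one
    (fun t ht => (hd t ht).continuousWithinAt)
    (fun t ht => (hd t (Ioo_subset_Icc_self ht)).hasDerivAt (Icc_mem_nhds ht.1 ht.2)) ?_
  rw [intervalIntegrable_iff_integrableOn_Icc_of_le zero_le_one]
  exact hc.integrableOn_compact isCompact_Icc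

/-! ### Functions supported in a chart, and change of chart in integrals -/

section ChartSupport

variable {n : ℕ} {X : Type*} [TopologicalSpace X]

theorem isCompact_image_tsupport [CompactSpace X] {c : OpenPartialHomeomorph X (Cn n)} {g : X → ℝ}
    (hs : tsupport g ⊆ c.source) : IsCompact (c '' tsupport g) :=
  ((isClosed_tsupport g).isCompact).image_of_continuousOn (c.continuousOn.mono hs)

theorem image_tsupport_subset {c : OpenPartialHomeomorph X (Cn n)} {g : X → ℝ}
    (hs : tsupport g ⊆ c.source) : c '' tsupport g ⊆ c.target := by
  rintro _ ⟨x, hx, rfl⟩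
  exact c.map_source (hs hx)

theorem eq_zero_of_notMem_image {c : OpenPartialHomeomorph X (Cn n)} {g : X → ℝ} {z : Cn n}
    (hz : z ∈ c.target) (hz' : z ∉ c '' tsupport g) : g (c.symm z) = 0 := by
  refine image_eq_zero_of_notMem_tsupport fun h => hz' ⟨_, h, c.right_inv hz⟩

theorem integrableOn_chart [CompactSpace X] {c : OpenPartialHomeomorph X (Cn n)} {g : X → ℝ}
    (hg : Continuous g) (hs : tsupport g ⊆ c.source) {D : Cn n → ℝ} (hD : ContinuousOn D c.target) :
    IntegrableOn (fun z => g (c.symm z) * D z) c.target := by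
  rw [← integrable_indicator_iff c.open_target.measurableSet]
  refine integrable_of_continuousAt_tsupport (isCompact_image_tsupport hs) (fun z hz => ?_)
    fun z hz => ?_
  · have hzt := image_tsupport_subset hs hz
    have ht := c.open_target.mem_nhds hzt
    have h1 : ContinuousAt (fun z => g (c.symm z) * D z) z :=
      (hg.continuousAt.comp (c.continuousAt_symm hzt)).mul (hD.continuousAt ht)
    refine h1.congr ?_
    filter_upwards [ht] with y hy
    rw [indicator_of_mem hy]
  · by_cases hzt : z ∈ c.target
    · rw [indicator_of_mem hzt, eq_zero_of_notMem_image hzt hz, zero_mul]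
    · rw [indicator_of_notMem hzt]

end ChartSupport

section Transition

variable {n : ℕ} {X : Type*} [TopologicalSpace X] [ChartedSpace (Cn n) X]
  [IsManifold 𝓘(ℂ, Cn n) ω X]

/-- The real Jacobian of a holomorphic transition is `|det|²`, exactly the factor by which a density
transforms. Change of variables applies on the overlap of the two charts, and outside it the
integrands vanish. -/
theorem setIntegral_transition {D : OpenPartialHomeomorph X (Cn n) → Cn n → ℝ}
    (hD : IsDensity D) {c c' : OpenPartialHomeomorph X (Cn n)} (hc : c ∈ atlas (Cn n) X)
    (hc' : c' ∈ atlas (Cn n) X) {f : X → ℝ} (hf : ∀ x ∉ c.source, f x = 0)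
    (hf' : ∀ x ∉ c'.source, f x = 0) :
    ∫ z in c'.target, f (c'.symm z) * D c' z = ∫ z in c.target, f (c.symm z) * D c z := by
  set S := (c.symm.trans c').source with hS
  have hSo : IsOpen S := (c.symm.trans c').open_source
  have himg : (c' ∘ c.symm) '' S = (c'.symm.trans c).source := by
    have h1 := (c.symm.trans c').image_source_eq_target
    rw [OpenPartialHomeomorph.coe_trans] at h1
    rw [h1, ← OpenPartialHomeomorph.symm_source, OpenPartialHomeomorph.trans_symm_eq_symm_trans_symm,
      OpenPartialHomeomorph.symm_symm]
  have hinj : InjOn (c' ∘ c.symm) S := (c.symm.trans c').injOn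
  have hder : ∀ z ∈ S, HasFDerivWithinAt (c' ∘ c.symm) (fderiv ℝ (c' ∘ c.symm) z) S z := by
    intro z hz
    have hd := ((contDiffOn_transition hc hc').contDiffAt (hSo.mem_nhds hz)).differentiableAt
      (by simp)
    exact (hd.restrictScalars ℝ).hasFDerivAt.hasFDerivWithinAt
  have hcv := integral_image_eq_integral_abs_det_fderiv_smul volume hSo.measurableSet hder hinj
    (fun z => f (c'.symm z) * D c' z)
  have e1 : ∫ z in c'.target, f (c'.symm z) * D c' z
      = ∫ z in (c' ∘ c.symm) '' S, f (c'.symm z) * D c' z := by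
    rw [himg]
    refine setIntegral_eq_of_subset_of_forall_sdiff_eq_zero c'.open_target.measurableSet ?_ ?_
    · rw [OpenPartialHomeomorph.trans_source]
      exact inter_subset_left
    · rintro z ⟨hz, hz'⟩
      rw [hf, zero_mul]
      exact fun h => hz' (by rw [OpenPartialHomeomorph.trans_source]; exact ⟨hz, h⟩)
  have e2 : ∫ z in c.target, f (c.symm z) * D c z = ∫ z in S, f (c.symm z) * D c z := by
    refine setIntegral_eq_of_subset_of_forall_sdiff_eq_zero c.open_target.measurableSet ?_ ?_
    · rw [hS, OpenPartialHomeomorph.trans_source]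
      exact inter_subset_left
    · rintro z ⟨hz, hz'⟩
      rw [hf', zero_mul]
      exact fun h => hz' (by rw [hS, OpenPartialHomeomorph.trans_source]; exact ⟨hz, h⟩)
  rw [e1, hcv, e2]
  refine setIntegral_congr_fun hSo.measurableSet fun z hz => ?_
  have hz' := hz
  rw [hS, OpenPartialHomeomorph.trans_source] at hz'
  simp only [smul_eq_mul, Function.comp_apply]
  rw [show |(fderiv ℝ (c' ∘ c.symm) z).det| = _ from abs_det_fderiv_transition hc hc' hz,
    hD.transition c hc c' hc' z hz, c'.left_inv hz'.2]
  ring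

end Transition

/-! ### Integration of densities over X -/

section Integral

variable {n : ℕ} {X : Type*} [TopologicalSpace X] [CompactSpace X] [T2Space X]
  [ChartedSpace (Cn n) X]

variable (n X) in
theorem finite_chartPartition :
    {i : X | (Function.support (chartPartition n X i)).Nonempty}.Finite :=
  (chartPartition n X).locallyFinite.finite_nonempty_of_compact

theorem tsupport_chartPartition (i : X) :
    tsupport (chartPartition n X i) ⊆ (chartAt (Cn n) i).source :=
  (exists_chartPartition n X).choose_spec i

/-- The indices which contribute to the integral. -/
def chartIndices (n : ℕ) (X : Type*) [TopologicalSpace X] [CompactSpace X] [T2Space X]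
    [ChartedSpace (Cn n) X] : Finset X := (finite_chartPartition n X).toFinset

theorem chartPartition_eq_zero {i : X} (hi : i ∉ chartIndices n X) (x : X) :
    chartPartition n X i x = 0 := by
  by_contra h
  exact hi ((finite_chartPartition n X).mem_toFinset.2 ⟨x, h⟩)

theorem sum_chartPartition (x : X) : ∑ i ∈ chartIndices n X, chartPartition n X i x = 1 := by
  rw [← (chartPartition n X).sum_eq_one (mem_univ x)]
  refine (finsum_eq_sum_of_support_subset _ fun i hi => ?_).symm
  by_contra h
  exact hi (chartPartition_eq_zero h x)

/-- The integral of a function against a density. -/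
def densIntegral (f : X → ℝ) (D : OpenPartialHomeomorph X (Cn n) → Cn n → ℝ) : ℝ :=
  ∑ᶠ i : X, ∫ z in (chartAt (Cn n) i).target,
    chartPartition n X i ((chartAt (Cn n) i).symm z) * f ((chartAt (Cn n) i).symm z)
      * D (chartAt (Cn n) i) z

theorem integral_eq_densIntegral (f : X → ℝ) (α : Fin n → TwoForm n X) :
    integral f α = densIntegral f (wedgeInChart α) := rfl

theorem densIntegral_eq_sum (f : X → ℝ) (D : OpenPartialHomeomorph X (Cn n) → Cn n → ℝ) :
    densIntegral f D = ∑ i ∈ chartIndices n X, ∫ z in (chartAt (Cn n) i).target,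
      chartPartition n X i ((chartAt (Cn n) i).symm z) * f ((chartAt (Cn n) i).symm z)
        * D (chartAt (Cn n) i) z := by
  refine finsum_eq_sum_of_support_subset _ fun i hi => ?_
  by_contra h
  refine hi ?_
  simp [chartPartition_eq_zero h]

theorem densIntegral_mul (f g : X → ℝ) {D D' : OpenPartialHomeomorph X (Cn n) → Cn n → ℝ}
    (h : ∀ i : X, ∀ z ∈ (chartAt (Cn n) i).target,
      D (chartAt (Cn n) i) z = g ((chartAt (Cn n) i).symm z) * D' (chartAt (Cn n) i) z) :
    densIntegral f D = densIntegral (fun x => f x * g x) D' := by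
  unfold densIntegral
  refine finsum_congr fun i => ?_
  refine setIntegral_congr_fun (chartAt (Cn n) i).open_target.measurableSet fun z hz => ?_
  simp only [h i z hz]
  ring

theorem densIntegral_const_mul (r : ℝ) (f : X → ℝ)
    (D : OpenPartialHomeomorph X (Cn n) → Cn n → ℝ) :
    densIntegral f (fun c z => r * D c z) = r * densIntegral f D := by
  rw [densIntegral_eq_sum, densIntegral_eq_sum, Finset.mul_sum]
  refine Finset.sum_congr rfl fun i _ => ?_
  rw [← MeasureTheory.integral_const_mul]
  congr 1
  funext z
  ring

theorem tsupport_chartPartition_mul (i : X) (f : X → ℝ) :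
    tsupport (fun x => chartPartition n X i x * f x) ⊆ (chartAt (Cn n) i).source :=
  (tsupport_mul_subset_left (f := chartPartition n X i)).trans (tsupport_chartPartition i)

theorem isBddFunctional_densIntegral {D : OpenPartialHomeomorph X (Cn n) → Cn n → ℝ}
    (hD : IsDensity D) : IsBddFunctional fun f : X → ℝ => densIntegral f D := by
  have h : ∀ i ∈ chartIndices n X, IsBddFunctional fun f : X → ℝ =>
      ∫ z in (chartAt (Cn n) i).target, f ((chartAt (Cn n) i).symm z) *
        (chartPartition n X i ((chartAt (Cn n) i).symm z) * D (chartAt (Cn n) i) z) := by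
    intro i _
    refine isBddFunctional_integral _ _ _ fun f hf => ?_
    have := integrableOn_chart (((chartPartition n X i).continuous).mul hf)
      (tsupport_chartPartition_mul i f) (hD.continuousOn _ (chart_mem_atlas (Cn n) i))
    refine this.congr (Filter.Eventually.of_forall fun z => ?_)
    simp only [Pi.mul_apply]
    ring
  have h2 := isBddFunctional_sum _ h
  convert h2 using 2 with f
  rw [densIntegral_eq_sum]
  refine Finset.sum_congr rfl fun i _ => ?_
  congr 1
  funext z
  ring

theorem densIntegral_nonneg {f : X → ℝ} {D : OpenPartialHomeomorph X (Cn n) → Cn n → ℝ}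
    (hf : ∀ x, 0 ≤ f x)
    (hD : ∀ i : X, ∀ z ∈ (chartAt (Cn n) i).target, 0 ≤ D (chartAt (Cn n) i) z) :
    0 ≤ densIntegral f D :=
  finsum_nonneg fun i => setIntegral_nonneg (chartAt (Cn n) i).open_target.measurableSet
    fun z hz => mul_nonneg (mul_nonneg ((chartPartition n X).nonneg i _) (hf _)) (hD i z hz)

variable [IsManifold 𝓘(ℂ, Cn n) ω X]

/-- The integral of a function supported in a chart can be computed in this chart. -/
theorem densIntegral_eq_setIntegral {D : OpenPartialHomeomorph X (Cn n) → Cn n → ℝ}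
    (hD : IsDensity D) {c : OpenPartialHomeomorph X (Cn n)} (hc : c ∈ atlas (Cn n) X) {f : X → ℝ}
    (hf : Continuous f) (hs : tsupport f ⊆ c.source) :
    densIntegral f D = ∫ z in c.target, f (c.symm z) * D c z := by
  rw [densIntegral_eq_sum]
  have h1 : ∀ i ∈ chartIndices n X, ∫ z in (chartAt (Cn n) i).target,
      chartPartition n X i ((chartAt (Cn n) i).symm z) * f ((chartAt (Cn n) i).symm z)
        * D (chartAt (Cn n) i) z
      = ∫ z in c.target, chartPartition n X i (c.symm z) * f (c.symm z) * D c z := by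
    intro i _
    refine setIntegral_transition hD hc (chart_mem_atlas _ _)
      (f := fun x => chartPartition n X i x * f x) (fun x hx => ?_) fun x hx => ?_
    · rw [image_eq_zero_of_notMem_tsupport fun h => hx (hs h), mul_zero]
    · rw [image_eq_zero_of_notMem_tsupport fun h => hx (tsupport_chartPartition i h), zero_mul]
  rw [Finset.sum_congr rfl h1, ← MeasureTheory.integral_finsetSum]
  · congr 1
    funext z
    rw [← Finset.sum_mul, ← Finset.sum_mul, sum_chartPartition, one_mul]
  · intro i _
    exact integrableOn_chart (g := fun x => chartPartition n X i x * f x)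
      (((chartPartition n X i).continuous).mul hf)
      ((tsupport_mul_subset_right (g := f)).trans hs) (hD.continuousOn c hc)

end Integral

/-! ### Integration by parts on X -/

section Stokes

open Matrix

section Functions

variable {n : ℕ} {X : Type*} [TopologicalSpace X] [ChartedSpace (Cn n) X]

/-- The function `n α ∧ ηⁿ⁻¹ / ω₀ⁿ`. -/
def mixRel (ω₀ α η : TwoForm n X) : X → ℝ := relDens (mixDens α η) (wedgeInChart (powTop ω₀))

/-- The function `⟨∇u, ∇v⟩_η ηⁿ / ω₀ⁿ`. -/
def gradRel (ω₀ η : TwoForm n X) (u v : X → ℝ) : X → ℝ :=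
  relDens (gradDens η u v) (wedgeInChart (powTop ω₀))

theorem volRatio_eq_relDens (η ω₀ : TwoForm n X) :
    volRatio η ω₀ = relDens (wedgeInChart (powTop η)) (wedgeInChart (powTop ω₀)) := rfl

theorem gradRel_comm (ω₀ : TwoForm n X) {η : TwoForm n X} (hη : IsClosedOneOne η) (u v : X → ℝ)
    (x : X) : gradRel ω₀ η u v x = gradRel ω₀ η v u x := by
  simp only [gradRel, relDens, gradDens]
  rw [re_gradPair_comm (hη.isOneOne_inChart _ _).isHermitian_coeffMatrix]

theorem IsSmooth.continuous {f : X → ℝ} (hf : IsSmooth n f) : Continuous f :=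
  ContMDiff.continuous hf

theorem IsSmooth.mul {f g : X → ℝ} (hf : IsSmooth n f) (hg : IsSmooth n g) :
    IsSmooth n fun x => f x * g x := ContMDiff.mul hf hg

theorem tsupport_gradRel_subset (ω₀ η : TwoForm n X) (u v : X → ℝ) : tsupport (gradRel ω₀ η u v) ⊆ tsupport u := by
  refine closure_minimal (fun x hx => ?_) (isClosed_tsupport u)
  by_contra h
  refine hx ?_
  have hu : u =ᶠ[𝓝 x] 0 := notMem_tsupport_iff_eventuallyEq.1 h
  set c := chartAt (Cn n) x
  have hxc : x ∈ c.source := mem_chart_source _ _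
  have h1 : u ∘ c.symm =ᶠ[𝓝 (c x)] fun _ => 0 := by
    have := c.continuousAt_symm (c.map_source hxc)
    rw [ContinuousAt, c.left_inv hxc] at this
    exact this.eventually hu
  have h2 : delFlat (u ∘ c.symm) (c x) = 0 := by
    funext j
    simp [delFlat, h1.fderiv_eq (𝕜 := ℝ)]
  rw [gradRel, relDens, gradDens, h2, gradPair_zero_left]
  simp

variable [IsManifold 𝓘(ℂ, Cn n) ω X] {ω₀ η α : TwoForm n X}

theorem continuous_volRatio (hω₀ : IsKahler ω₀) (hη : IsClosedOneOne η) :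
    Continuous (volRatio η ω₀) :=
  (isDensity_powTop hη).continuous_relDens (isDensity_powTop hω₀.toIsClosedOneOne)
    fun _ hc _ hz => (hω₀.wedgeInChart_pos hc hz).ne'

theorem continuous_mixRel (hω₀ : IsKahler ω₀) (hη : IsClosedOneOne η) (hα : IsClosedOneOne α) :
    Continuous (mixRel ω₀ α η) :=
  (isDensity_mixDens hα hη).continuous_relDens (isDensity_powTop hω₀.toIsClosedOneOne)
    fun _ hc _ hz => (hω₀.wedgeInChart_pos hc hz).ne'

theorem continuous_gradRel (hω₀ : IsKahler ω₀) (hη : IsClosedOneOne η) {u v : X → ℝ}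
    (hu : IsSmooth n u) (hv : IsSmooth n v) : Continuous (gradRel ω₀ η u v) :=
  (isDensity_gradDens hη hu hv).continuous_relDens (isDensity_powTop hω₀.toIsClosedOneOne)
    fun _ hc _ hz => (hω₀.wedgeInChart_pos hc hz).ne'

variable [CompactSpace X]

/-- Extension by zero: the image of the support is compact, hence closed in `ℂⁿ`, and the extension
vanishes on its complement, a neighbourhood of every point outside the target. -/
theorem contDiff_indicator_chart {c : OpenPartialHomeomorph X (Cn n)} (hc : c ∈ atlas (Cn n) X)
    {u : X → ℝ} (hu : IsSmooth n u) (hs : tsupport u ⊆ c.source) :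
    ContDiff ℝ ∞ (c.target.indicator (u ∘ c.symm)) := by
  rw [contDiff_iff_contDiffAt]
  intro z
  by_cases hz : z ∈ c.target
  · refine (hu.contDiffAt hc hz).congr_of_eventuallyEq ?_
    filter_upwards [c.open_target.mem_nhds hz] with y hy
    rw [indicator_of_mem hy]
  · have hz' : z ∉ c '' tsupport u := fun h => hz (image_tsupport_subset hs h)
    have hcl : IsClosed (c '' tsupport u) := (isCompact_image_tsupport hs).isClosed
    refine (contDiffAt_const (c := (0 : ℝ))).congr_of_eventuallyEq ?_
    filter_upwards [hcl.isOpen_compl.mem_nhds hz'] with y hy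
    by_cases hyt : y ∈ c.target
    · rw [indicator_of_mem hyt]
      exact eq_zero_of_notMem_image hyt hy
    · rw [indicator_of_notMem hyt]

end Functions

section Indicator

variable {n : ℕ} {X : Type*} [TopologicalSpace X] [CompactSpace X]

theorem tsupport_indicator_chart {c : OpenPartialHomeomorph X (Cn n)} {u : X → ℝ}
    (hs : tsupport u ⊆ c.source) :
    tsupport (c.target.indicator (u ∘ c.symm)) ⊆ c '' tsupport u := by
  refine closure_minimal (fun z hz => ?_) (isCompact_image_tsupport hs).isClosed
  by_contra h
  refine hz ?_
  by_cases hzt : z ∈ c.target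
  · rw [indicator_of_mem hzt]
    exact eq_zero_of_notMem_image hzt h
  · rw [indicator_of_notMem hzt]

end Indicator

variable {n : ℕ} {X : Type*} [TopologicalSpace X] [CompactSpace X] [T2Space X]
  [ChartedSpace (Cn n) X] [IsManifold 𝓘(ℂ, Cn n) ω X] {ω₀ η α : TwoForm n X}

theorem isBddFunctional_integral_powTop (hω₀ : IsClosedOneOne ω₀) :
    IsBddFunctional fun f : X → ℝ => integral f (powTop ω₀) :=
  isBddFunctional_densIntegral (isDensity_powTop hω₀)

/-- Moves the dependence on `η` from the density into the integrand, so that varying metrics are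
handled by one fixed functional. -/
theorem integral_powTop (hω₀ : IsKahler ω₀) (hη : IsClosedOneOne η) (f : X → ℝ) :
    integral f (powTop η) = integral (fun x => f x * volRatio η ω₀ x) (powTop ω₀) :=
  densIntegral_mul f _ fun i _ hz =>
    (isDensity_powTop hη).eq_relDens_mul (isDensity_powTop hω₀.toIsClosedOneOne)
      (chart_mem_atlas _ i) hz (hω₀.wedgeInChart_pos (chart_mem_atlas _ i) hz).ne'

theorem natCast_mul_integral_wedgePow (hω₀ : IsKahler ω₀) (hη : IsClosedOneOne η)
    (hα : IsClosedOneOne α) (f : X → ℝ) :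
    n * integral f (wedgePow α η) = integral (fun x => f x * mixRel ω₀ α η x) (powTop ω₀) := by
  rw [integral_eq_densIntegral, ← densIntegral_const_mul]
  refine densIntegral_mul f _ fun i z hz => ?_
  rw [natCast_mul_wedgeInChart]
  exact (isDensity_mixDens hα hη).eq_relDens_mul (isDensity_powTop hω₀.toIsClosedOneOne)
    (chart_mem_atlas _ i) hz (hω₀.wedgeInChart_pos (chart_mem_atlas _ i) hz).ne'

/-- Both integrals are computed in the one chart that contains the support, where they become the
two sides of `integral_mul_trace_adjugate` for the extension of `u` by zero. -/
theorem integral_mul_mixRel_ddbar_of_tsupport (hω₀ : IsKahler ω₀) (hη : IsClosedOneOne η)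
    {c : OpenPartialHomeomorph X (Cn n)} (hc : c ∈ atlas (Cn n) X) {u v : X → ℝ}
    (hu : IsSmooth n u) (hv : IsSmooth n v) (hs : tsupport u ⊆ c.source) :
    integral (fun x => u x * mixRel ω₀ (ddbar n v) η x) (powTop ω₀)
      = -integral (gradRel ω₀ η u v) (powTop ω₀) := by
  have hdv := isClosedOneOne_ddbar hv
  have hD₀ := isDensity_powTop hω₀.toIsClosedOneOne
  have hpos : ∀ z ∈ c.target, wedgeInChart (powTop ω₀) c z ≠ 0 := fun z hz =>
    (hω₀.wedgeInChart_pos hc hz).ne'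
  have hmt := c.open_target.measurableSet
  rw [integral_eq_densIntegral, integral_eq_densIntegral,
    densIntegral_eq_setIntegral (f := fun x => u x * mixRel ω₀ (ddbar n v) η x) hD₀ hc
      (hu.continuous.mul (continuous_mixRel hω₀ hη hdv))
      ((tsupport_mul_subset_left (f := u)).trans hs),
    densIntegral_eq_setIntegral hD₀ hc (continuous_gradRel hω₀ hη hu hv)
      ((tsupport_gradRel_subset ω₀ η u v).trans hs)]
  set w := c.target.indicator (u ∘ c.symm) with hw
  have hwt : tsupport w ⊆ c.target :=
    (tsupport_indicator_chart hs).trans (image_tsupport_subset hs)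
  have hwc : HasCompactSupport w :=
    (isCompact_image_tsupport hs).of_isClosed_subset (isClosed_tsupport _)
      (tsupport_indicator_chart hs)
  have key := integral_mul_trace_adjugate c.open_target (α := inChart η c) (v := v ∘ c.symm)
    (w := w) (fun z hz => hη.contDiffAt hc hz) (fun z _ => hη.isOneOne_inChart c z)
    (fun z hz => hη.closed c hc z hz) (fun z hz => hv.contDiffAt hc hz)
    (contDiff_indicator_chart hc hu hs) hwc hwt
  have e1 : ∫ z in c.target, u (c.symm z) * mixRel ω₀ (ddbar n v) η (c.symm z)
        * wedgeInChart (powTop ω₀) c z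
      = volConst n * ∫ z, w z * (trace (adjugate (coeffMatrix (inChart η c z))
        * coeffMatrix (ddbarFlat (v ∘ c.symm) z))).re := by
    rw [← MeasureTheory.integral_const_mul, ← integral_indicator hmt]
    congr 1
    funext z
    by_cases hz : z ∈ c.target
    · rw [indicator_of_mem hz, hw, indicator_of_mem hz, mul_assoc, mixRel,
        ← (isDensity_mixDens hdv hη).eq_relDens_mul hD₀ hc hz (hpos z hz), mixDens,
        inChart_ddbar hv hc hz]
      simp only [Function.comp_apply]
      ring
    · rw [indicator_of_notMem hz, hw, indicator_of_notMem hz]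
      simp
  have e2 : ∫ z in c.target, gradRel ω₀ η u v (c.symm z) * wedgeInChart (powTop ω₀) c z
      = volConst n * ∫ z, (gradPair (coeffMatrix (inChart η c z)) (delFlat w z)
        (delFlat (v ∘ c.symm) z)).re := by
    rw [← MeasureTheory.integral_const_mul, ← integral_indicator hmt]
    congr 1
    funext z
    by_cases hz : z ∈ c.target
    · have hwe : w =ᶠ[𝓝 z] u ∘ c.symm := by
        filter_upwards [c.open_target.mem_nhds hz] with y hy
        rw [hw, indicator_of_mem hy]
      have hdw : delFlat w z = delFlat (u ∘ c.symm) z := by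
        funext j
        simp only [delFlat, hwe.fderiv_eq (𝕜 := ℝ)]
      rw [indicator_of_mem hz, gradRel,
        ← (isDensity_gradDens hη hu hv).eq_relDens_mul hD₀ hc hz (hpos z hz), gradDens, hdw]
    · have hdw : delFlat w z = 0 := by
        funext j
        simp [delFlat, fderiv_of_notMem_tsupport ℝ fun h => hz (hwt h)]
      rw [indicator_of_notMem hz, hdw, gradPair_zero_left]
      simp
  rw [e1, e2, key]
  ring

/-- Integration by parts on `X`. -/
theorem integral_mul_mixRel_ddbar (hω₀ : IsKahler ω₀) (hη : IsClosedOneOne η) {u v : X → ℝ}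
    (hu : IsSmooth n u) (hv : IsSmooth n v) :
    integral (fun x => u x * mixRel ω₀ (ddbar n v) η x) (powTop ω₀)
      = -integral (gradRel ω₀ η u v) (powTop ω₀) := by
  have := isManifold_real n X
  -- `chartPartition` is merely continuous, whereas here the cut-offs are differentiated; a smooth
  -- partition is needed.
  obtain ⟨χ, hχ⟩ := SmoothPartitionOfUnity.exists_isSubordinate_chartAt_source 𝓘(ℝ, Cn n) X
  have hfin : {i : X | (Function.support (χ i)).Nonempty}.Finite :=
    χ.locallyFinite.finite_nonempty_of_compact
  set I := hfin.toFinset with hI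
  have h0 : ∀ i ∉ I, ∀ x, χ i x = 0 := by
    intro i hi x
    by_contra h
    exact hi (hfin.mem_toFinset.2 ⟨x, h⟩)
  have h1 : ∀ x, ∑ i ∈ I, χ i x = 1 := by
    intro x
    rw [← χ.sum_eq_one (mem_univ x)]
    refine (finsum_eq_sum_of_support_subset _ fun i hi => ?_).symm
    by_contra h
    exact hi (h0 i h x)
  have hχs : ∀ i, IsSmooth n (χ i) := fun i => (χ i).contMDiff
  have hus : ∀ i, IsSmooth n fun x => χ i x * u x := fun i => (hχs i).mul hu
  have hsub : ∀ i, tsupport (fun x => χ i x * u x) ⊆ (chartAt (Cn n) i).source := fun i =>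
    (tsupport_mul_subset_left (f := χ i)).trans (hχ i)
  have hsum : ∀ x, u x = ∑ i ∈ I, χ i x * u x := fun x => by
    rw [← Finset.sum_mul, h1, one_mul]
  have hdv := isClosedOneOne_ddbar hv
  have hΛ := isBddFunctional_integral_powTop (X := X) hω₀.toIsClosedOneOne
  have e1 : integral (fun x => u x * mixRel ω₀ (ddbar n v) η x) (powTop ω₀)
      = ∑ i ∈ I, integral (fun x => χ i x * u x * mixRel ω₀ (ddbar n v) η x) (powTop ω₀) := by
    rw [← hΛ.map_sum I (fun i x => χ i x * u x * mixRel ω₀ (ddbar n v) η x)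
      fun i => (hus i).continuous.mul (continuous_mixRel hω₀ hη hdv)]
    congr 1
    funext x
    rw [← Finset.sum_mul, ← hsum]
  have e2 : integral (gradRel ω₀ η u v) (powTop ω₀)
      = ∑ i ∈ I, integral (gradRel ω₀ η (fun x => χ i x * u x) v) (powTop ω₀) := by
    rw [← hΛ.map_sum I (fun i => gradRel ω₀ η (fun x => χ i x * u x) v)
      fun i => continuous_gradRel hω₀ hη (hus i) hv]
    congr 1
    funext x
    set c := chartAt (Cn n) x
    -- The derivatives of the cut-offs need no estimate: the gradient pairing is linear in its first
    -- argument, and the pieces `χ i * u` add up to `u`.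
    have hd : delFlat (u ∘ c.symm) (c x)
        = ∑ i ∈ I, delFlat ((fun y => χ i y * u y) ∘ c.symm) (c x) := by
      have hf : u ∘ c.symm = fun z => ∑ i ∈ I, ((fun y => χ i y * u y) ∘ c.symm) z := by
        funext z
        exact hsum _
      have hfd : fderiv ℝ (u ∘ c.symm) (c x)
          = ∑ i ∈ I, fderiv ℝ ((fun y => χ i y * u y) ∘ c.symm) (c x) := by
        rw [hf]
        exact fderiv_fun_sum fun i _ => ((hus i).contDiffAt (chart_mem_atlas _ x)
          (mem_chart_target _ x)).differentiableAt (by simp)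
      funext j
      simp only [delFlat, hfd, Finset.sum_apply, _root_.sum_apply]
      push_cast
      simp only [Finset.mul_sum, Finset.sum_sub_distrib, mul_sub]
    have hg : ∀ (d : X → Fin n → ℂ) (a : Matrix (Fin n) (Fin n) ℂ) (d' : Fin n → ℂ),
        gradPair a (∑ i ∈ I, d i) d' = ∑ i ∈ I, gradPair a (d i) d' := by
      intro d a d'
      simp only [gradPair_eq_dotProduct, mulVec_sum, dotProduct_sum]
    simp only [gradRel, relDens, gradDens]
    rw [hd, hg, Complex.re_sum, Finset.mul_sum, Finset.sum_div]
  rw [e1, e2, ← Finset.sum_neg_distrib]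
  exact Finset.sum_congr rfl fun i _ =>
    integral_mul_mixRel_ddbar_of_tsupport hω₀ hη (chart_mem_atlas _ i) (hus i) hv (hsub i)

theorem integral_mul_mixRel_ddbar_comm (hω₀ : IsKahler ω₀) (hη : IsClosedOneOne η) {u v : X → ℝ}
    (hu : IsSmooth n u) (hv : IsSmooth n v) :
    integral (fun x => u x * mixRel ω₀ (ddbar n v) η x) (powTop ω₀)
      = integral (fun x => v x * mixRel ω₀ (ddbar n u) η x) (powTop ω₀) := by
  rw [integral_mul_mixRel_ddbar hω₀ hη hu hv, integral_mul_mixRel_ddbar hω₀ hη hv hu,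
    funext (gradRel_comm ω₀ hη u v)]

/-- Integration by parts against the constant `1`, whose gradient vanishes. -/
theorem integral_mixRel_ddbar (hω₀ : IsKahler ω₀) (hη : IsClosedOneOne η) {v : X → ℝ}
    (hv : IsSmooth n v) : integral (mixRel ω₀ (ddbar n v) η) (powTop ω₀) = 0 := by
  have h1 : IsSmooth n (fun _ : X => (1 : ℝ)) := contMDiff_const
  have h := integral_mul_mixRel_ddbar hω₀ hη h1 hv
  have h2 : gradRel ω₀ η (fun _ => 1) v = fun _ => 0 := by
    funext x
    have hd : delFlat ((fun _ : X => (1 : ℝ)) ∘ (chartAt (Cn n) x).symm) (chartAt (Cn n) x x)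
        = 0 := by
      funext j
      simp [delFlat, Function.comp_def]
    rw [gradRel, relDens, gradDens, hd, gradPair_zero_left]
    simp
  rw [h2, (isBddFunctional_integral_powTop hω₀.toIsClosedOneOne).map_zero, neg_zero] at h
  simpa using h

end Stokes

/-! ### Time-dependent functions and forms in coordinates -/

section FlatFamilies

variable {E : Type*} [NormedAddCommGroup E] [NormedSpace ℝ E] {J : Set ℝ} {U : Set E}
  {u : ℝ → E → ℝ}

theorem contDiffAt_slice (hU : IsOpen U)
    (hu : ContDiffOn ℝ ∞ (fun p : ℝ × E => u p.1 p.2) (J ×ˢ U)) {t : ℝ} {z : E} (ht : t ∈ J)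
    (hz : z ∈ U) : ContDiffAt ℝ ∞ (u t) z := by
  have h1 : ContDiffOn ℝ ∞ (fun y : E => (t, y)) U := contDiffOn_const.prodMk contDiffOn_id
  exact (hu.comp h1 fun y hy => ⟨ht, hy⟩).contDiffAt (hU.mem_nhds hz)

theorem fderiv_slice_apply (hU : IsOpen U)
    (hu : ContDiffOn ℝ ∞ (fun p : ℝ × E => u p.1 p.2) (J ×ˢ U)) {t : ℝ} {z : E} (ht : t ∈ J)
    (hz : z ∈ U) (v : E) :
    fderiv ℝ (u t) z v
      = fderivWithin ℝ (fun p : ℝ × E => u p.1 p.2) (J ×ˢ U) (t, z) (0, v) := by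
  have h1 : HasFDerivAt (fun y : E => (t, y)) (ContinuousLinearMap.inr ℝ ℝ E) z :=
    hasFDerivAt_prodMk_right t z
  have h2 := ((hu (t, z) ⟨ht, hz⟩).differentiableWithinAt (by simp)).hasFDerivWithinAt
  have h3 := (h2.comp z (h1.hasFDerivWithinAt (s := U)) fun y hy => ⟨ht, hy⟩).hasFDerivAt
    (hU.mem_nhds hz)
  have h4 : fderiv ℝ (u t) z = _ := h3.fderiv
  rw [h4]
  simp

theorem hasDerivWithinAt_slice
    (hu : ContDiffOn ℝ ∞ (fun p : ℝ × E => u p.1 p.2) (J ×ˢ U)) {t : ℝ} {z : E} (ht : t ∈ J)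
    (hz : z ∈ U) : HasDerivWithinAt (fun s => u s z)
      (fderivWithin ℝ (fun p : ℝ × E => u p.1 p.2) (J ×ˢ U) (t, z) (1, 0)) J t := by
  have h1 : HasFDerivAt (fun s : ℝ => (s, z)) (ContinuousLinearMap.inl ℝ ℝ E) t :=
    hasFDerivAt_prodMk_left t z
  have h2 := ((hu (t, z) ⟨ht, hz⟩).differentiableWithinAt (by simp)).hasFDerivWithinAt
  have hm : MapsTo (fun s : ℝ => (s, z)) J (J ×ˢ U) := fun s hs => ⟨hs, hz⟩
  have h3 := (h2.comp t (h1.hasFDerivWithinAt (s := J)) hm).hasDerivWithinAt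
  simpa [Function.comp_def] using h3

theorem derivWithin_slice (hJ : Convex ℝ J) (hi : (interior J).Nonempty)
    (hu : ContDiffOn ℝ ∞ (fun p : ℝ × E => u p.1 p.2) (J ×ˢ U)) {t : ℝ} {z : E} (ht : t ∈ J)
    (hz : z ∈ U) : derivWithin (fun s => u s z) J t
      = fderivWithin ℝ (fun p : ℝ × E => u p.1 p.2) (J ×ˢ U) (t, z) (1, 0) :=
  (hasDerivWithinAt_slice hu ht hz).derivWithin (uniqueDiffOn_convex hJ hi t ht)

theorem contDiffOn_fderivWithin_apply (hJ : Convex ℝ J) (hi : (interior J).Nonempty)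
    (hU : IsOpen U) (hu : ContDiffOn ℝ ∞ (fun p : ℝ × E => u p.1 p.2) (J ×ˢ U)) (w : ℝ × E) :
    ContDiffOn ℝ ∞ (fun p => fderivWithin ℝ (fun p : ℝ × E => u p.1 p.2) (J ×ˢ U) p w)
      (J ×ˢ U) :=
  (hu.fderivWithin ((uniqueDiffOn_convex hJ hi).prod hU.uniqueDiffOn) (m := ∞)
    (by simp)).clm_apply contDiffOn_const

theorem contDiffOn_fderiv_slice (hJ : Convex ℝ J) (hi : (interior J).Nonempty)
    (hU : IsOpen U) (hu : ContDiffOn ℝ ∞ (fun p : ℝ × E => u p.1 p.2) (J ×ˢ U)) (v : E) :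
    ContDiffOn ℝ ∞ (fun p : ℝ × E => fderiv ℝ (u p.1) p.2 v) (J ×ˢ U) :=
  (contDiffOn_fderivWithin_apply hJ hi hU hu (0, v)).congr fun _ hp =>
    fderiv_slice_apply hU hu hp.1 hp.2 v

theorem contDiffOn_derivWithin_slice (hJ : Convex ℝ J) (hi : (interior J).Nonempty)
    (hU : IsOpen U) (hu : ContDiffOn ℝ ∞ (fun p : ℝ × E => u p.1 p.2) (J ×ˢ U)) :
    ContDiffOn ℝ ∞ (fun p : ℝ × E => derivWithin (fun s => u s p.2) J p.1) (J ×ˢ U) :=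
  (contDiffOn_fderivWithin_apply hJ hi hU hu (1, 0)).congr fun _ hp =>
    derivWithin_slice hJ hi hu hp.1 hp.2

/-- The time derivative commutes with spatial derivatives. -/
theorem hasDerivWithinAt_fderiv_slice (hJ : Convex ℝ J) (hi : (interior J).Nonempty)
    (hU : IsOpen U) (hu : ContDiffOn ℝ ∞ (fun p : ℝ × E => u p.1 p.2) (J ×ˢ U)) {t : ℝ} {z : E}
    (ht : t ∈ J) (hz : z ∈ U) (v : E) :
    HasDerivWithinAt (fun s => fderiv ℝ (u s) z v)
      (fderiv ℝ (fun y => derivWithin (fun s => u s y) J t) z v) J t := by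
  have hud := (uniqueDiffOn_convex hJ hi).prod hU.uniqueDiffOn
  set f := fun p : ℝ × E => u p.1 p.2 with hf
  have hm : (t, z) ∈ J ×ˢ U := ⟨ht, hz⟩
  have hd : DifferentiableWithinAt ℝ (fderivWithin ℝ f (J ×ˢ U)) (J ×ˢ U) (t, z) :=
    (hu.fderivWithin hud (m := ∞) (by simp) (t, z) hm).differentiableWithinAt (by simp)
  have happ : ∀ w w' : ℝ × E, fderivWithin ℝ (fun p => fderivWithin ℝ f (J ×ˢ U) p w) (J ×ˢ U)
      (t, z) w' = fderivWithin ℝ (fderivWithin ℝ f (J ×ˢ U)) (J ×ˢ U) (t, z) w' w := by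
    intro w w'
    rw [fderivWithin_clm_apply (hud _ hm) hd (differentiableWithinAt_const w)]
    simp
  -- Mixed derivatives commute at boundary times too: a convex `J` with nonempty interior lies in
  -- the closure of its interior, which is what symmetry within a set requires.
  have hsym : IsSymmSndFDerivWithinAt ℝ f (J ×ˢ U) (t, z) := by
    refine (hu (t, z) hm).isSymmSndFDerivWithinAt (by simpa using two_le_infty) hud ?_ hm
    rw [interior_prod_eq, closure_prod_eq, hU.interior_eq,
      hJ.closure_interior_eq_closure_of_nonempty_interior hi]
    exact ⟨subset_closure ht, subset_closure hz⟩
  have h1 := hasDerivWithinAt_slice (u := fun s y => fderiv ℝ (u s) y v)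
    (contDiffOn_fderiv_slice hJ hi hU hu v) ht hz
  convert h1 using 1
  have e1 : fderivWithin ℝ (fun p : ℝ × E => derivWithin (fun s => u s p.2) J p.1) (J ×ˢ U) (t, z)
      = fderivWithin ℝ (fun p => fderivWithin ℝ f (J ×ˢ U) p (1, 0)) (J ×ˢ U) (t, z) :=
    fderivWithin_congr' (fun p hp => derivWithin_slice hJ hi hu hp.1 hp.2) hm
  have e2 : fderivWithin ℝ (fun p : ℝ × E => fderiv ℝ (u p.1) p.2 v) (J ×ˢ U) (t, z)
      = fderivWithin ℝ (fun p => fderivWithin ℝ f (J ×ˢ U) p (0, v)) (J ×ˢ U) (t, z) :=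
    fderivWithin_congr' (fun p hp => fderiv_slice_apply hU hu hp.1 hp.2 v) hm
  rw [fderiv_slice_apply (u := fun r y => derivWithin (fun s => u s y) J r) hU
    (contDiffOn_derivWithin_slice hJ hi hU hu) ht hz, e1, e2, happ, happ]
  exact hsym _ _

end FlatFamilies

section FlatForms

variable {n : ℕ} {J : Set ℝ} {U : Set (Cn n)} {u : ℝ → Cn n → ℝ}

theorem continuousOn_secondDeriv_slice (hJ : Convex ℝ J) (hi : (interior J).Nonempty)
    (hU : IsOpen U) (hu : ContDiffOn ℝ ∞ (fun p : ℝ × Cn n => u p.1 p.2) (J ×ˢ U)) (v w : Cn n) :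
    ContinuousOn (fun p : ℝ × Cn n => secondDeriv (u p.1) p.2 v w) (J ×ˢ U) :=
  (contDiffOn_fderiv_slice (u := fun s y => fderiv ℝ (u s) y w) hJ hi hU
    (contDiffOn_fderiv_slice hJ hi hU hu w) v).continuousOn

theorem hasDerivWithinAt_secondDeriv_slice (hJ : Convex ℝ J) (hi : (interior J).Nonempty)
    (hU : IsOpen U) (hu : ContDiffOn ℝ ∞ (fun p : ℝ × Cn n => u p.1 p.2) (J ×ˢ U)) {t : ℝ}
    {z : Cn n} (ht : t ∈ J) (hz : z ∈ U) (v w : Cn n) :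
    HasDerivWithinAt (fun s => secondDeriv (u s) z v w)
      (secondDeriv (fun y => derivWithin (fun s => u s y) J t) z v w) J t := by
  have h := hasDerivWithinAt_fderiv_slice (u := fun s y => fderiv ℝ (u s) y w) hJ hi hU
    (contDiffOn_fderiv_slice hJ hi hU hu w) ht hz v
  have h1 : (fun y => derivWithin (fun s => fderiv ℝ (u s) y w) J t)
      =ᶠ[𝓝 z] fun y => fderiv ℝ (fun y => derivWithin (fun s => u s y) J t) y w := by
    filter_upwards [hU.mem_nhds hz] with y hy
    exact (hasDerivWithinAt_fderiv_slice hJ hi hU hu ht hy w).derivWithin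
      (uniqueDiffOn_convex hJ hi t ht)
  rw [h1.fderiv_eq] at h
  exact h

/-- A finite expression in second derivatives, from which joint continuity and time derivatives of
the coefficients are read off termwise. -/
theorem coeffMatrix_ddbarFlat_eq {f : Cn n → ℝ} {z : Cn n} (hf : ContDiffAt ℝ ∞ f z)
    (j k : Fin n) : coeffMatrix (ddbarFlat f z) j k = (1 / 2 : ℂ) *
      (((-(1 / 2) * (secondDeriv f z (stdVec n j) (cplxJ n (cplxJ n (stdVec n k)))
          - secondDeriv f z (cplxJ n (stdVec n k)) (cplxJ n (stdVec n j))) : ℝ) : ℂ)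
        - Complex.I * ((-(1 / 2) * (secondDeriv f z (stdVec n j) (cplxJ n (stdVec n k))
          - secondDeriv f z (stdVec n k) (cplxJ n (stdVec n j))) : ℝ) : ℂ)) := by
  have hf2 := hf.of_le two_le_infty
  rw [← ddbarFlat_apply hf2, ← ddbarFlat_apply hf2]
  rfl

theorem continuousOn_coeffMatrix_ddbarFlat (hJ : Convex ℝ J) (hi : (interior J).Nonempty)
    (hU : IsOpen U) (hu : ContDiffOn ℝ ∞ (fun p : ℝ × Cn n => u p.1 p.2) (J ×ˢ U)) :
    ContinuousOn (fun p : ℝ × Cn n => coeffMatrix (ddbarFlat (u p.1) p.2)) (J ×ˢ U) := by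
  refine continuousOn_pi.2 fun j => continuousOn_pi.2 fun k => ?_
  have h := fun v w => continuousOn_secondDeriv_slice hJ hi hU hu v w
  refine ContinuousOn.congr (f := fun p : ℝ × Cn n => (1 / 2 : ℂ) *
      (((-(1 / 2) * (secondDeriv (u p.1) p.2 (stdVec n j) (cplxJ n (cplxJ n (stdVec n k)))
          - secondDeriv (u p.1) p.2 (cplxJ n (stdVec n k)) (cplxJ n (stdVec n j))) : ℝ) : ℂ)
        - Complex.I * ((-(1 / 2) * (secondDeriv (u p.1) p.2 (stdVec n j) (cplxJ n (stdVec n k))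
          - secondDeriv (u p.1) p.2 (stdVec n k) (cplxJ n (stdVec n j))) : ℝ) : ℂ))) ?_ ?_
  · exact continuousOn_const.mul
      ((Complex.continuous_ofReal.comp_continuousOn
          (continuousOn_const.mul ((h _ _).sub (h _ _)))).sub
        (continuousOn_const.mul (Complex.continuous_ofReal.comp_continuousOn
          (continuousOn_const.mul ((h _ _).sub (h _ _))))))
  · intro p hp
    exact coeffMatrix_ddbarFlat_eq (contDiffAt_slice hU hu hp.1 hp.2) j k

theorem hasDerivWithinAt_coeffMatrix_ddbarFlat (hJ : Convex ℝ J) (hi : (interior J).Nonempty)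
    (hU : IsOpen U) (hu : ContDiffOn ℝ ∞ (fun p : ℝ × Cn n => u p.1 p.2) (J ×ˢ U)) {t : ℝ}
    {z : Cn n} (ht : t ∈ J) (hz : z ∈ U) (j k : Fin n) :
    HasDerivWithinAt (fun s => coeffMatrix (ddbarFlat (u s) z) j k)
      (coeffMatrix (ddbarFlat (fun y => derivWithin (fun s => u s y) J t) z) j k) J t := by
  have h := fun v w => hasDerivWithinAt_secondDeriv_slice hJ hi hU hu ht hz v w
  have hdot : ContDiffAt ℝ ∞ (fun y => derivWithin (fun s => u s y) J t) z :=
    contDiffAt_slice (u := fun r y => derivWithin (fun s => u s y) J r) hU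
      (contDiffOn_derivWithin_slice hJ hi hU hu) ht hz
  rw [coeffMatrix_ddbarFlat_eq hdot]
  refine HasDerivWithinAt.congr_of_mem ?_
    (fun s hs => coeffMatrix_ddbarFlat_eq (contDiffAt_slice hU hu hs hz) j k) ht
  exact (((((h _ _).sub (h _ _)).const_mul _).ofReal_comp).sub
    (((((h _ _).sub (h _ _)).const_mul _).ofReal_comp).const_mul _)).const_mul _

end FlatForms

/-! ### Time-dependent functions and forms on X -/

section Families

open Matrix

theorem continuousOn_of_charts {n : ℕ} {X P Z : Type*} [TopologicalSpace X]
    [ChartedSpace (Cn n) X] [TopologicalSpace P] [TopologicalSpace Z] {S : Set P} {G : P → X → Z}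
    (h : ∀ c ∈ atlas (Cn n) X,
      ContinuousOn (fun p : P × Cn n => G p.1 (c.symm p.2)) (S ×ˢ c.target)) :
    ContinuousOn (fun p : P × X => G p.1 p.2) (S ×ˢ univ) := by
  rintro ⟨p, x⟩ hp
  set c := chartAt (Cn n) x
  have h1 : ContinuousOn (fun q : P × X => (q.1, c q.2)) (S ×ˢ c.source) :=
    continuousOn_fst.prodMk (c.continuousOn.comp continuousOn_snd fun q hq => hq.2)
  have h2 : ContinuousOn (fun q : P × X => G q.1 q.2) (S ×ˢ c.source) :=
    ((h c (chart_mem_atlas _ _)).comp h1 fun q hq => ⟨hq.1, c.map_source hq.2⟩).congr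
      fun q hq => by
        simp only [Function.comp_apply]
        rw [c.left_inv hq.2]
  refine (h2 (p, x) ⟨hp.1, mem_chart_source _ _⟩).mono_of_mem_nhdsWithin ?_
  have h3 : (univ : Set P) ×ˢ c.source ∈ 𝓝 (p, x) :=
    prod_mem_nhds Filter.univ_mem (c.open_source.mem_nhds (mem_chart_source _ _))
  filter_upwards [self_mem_nhdsWithin, mem_nhdsWithin_of_mem_nhds h3] with q hq hq'
  exact ⟨hq.1, hq'.2⟩

variable {n : ℕ} {X : Type*} [TopologicalSpace X] [ChartedSpace (Cn n) X]

/-- Smoothness of a family of functions, expressed in the charts of `X`. -/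
def IsChartFamily (n : ℕ) {X : Type*} [TopologicalSpace X] [ChartedSpace (Cn n) X] (J : Set ℝ)
    (f : ℝ → X → ℝ) : Prop :=
  ∀ c ∈ atlas (Cn n) X, ContDiffOn ℝ ∞ (fun p : ℝ × Cn n => f p.1 (c.symm p.2)) (J ×ˢ c.target)

theorem IsChartFamily.continuousOn {J : Set ℝ} {f : ℝ → X → ℝ} (hf : IsChartFamily n J f) :
    ContinuousOn (fun p : ℝ × X => f p.1 p.2) (J ×ˢ univ) :=
  continuousOn_of_charts fun c hc => (hf c hc).continuousOn

theorem IsChartFamily.deriv {J : Set ℝ} {f : ℝ → X → ℝ} (hf : IsChartFamily n J f)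
    (hJ : Convex ℝ J) (hi : (interior J).Nonempty) :
    IsChartFamily n J fun t x => derivWithin (fun s => f s x) J t := fun c hc =>
  contDiffOn_derivWithin_slice (u := fun t z => f t (c.symm z)) hJ hi c.open_target (hf c hc)

theorem IsChartFamily.hasDerivWithinAt {J : Set ℝ} {f : ℝ → X → ℝ} (hf : IsChartFamily n J f)
    {t : ℝ} (ht : t ∈ J) (x : X) :
    HasDerivWithinAt (fun s => f s x) (derivWithin (fun s => f s x) J t) J t := by
  set c := chartAt (Cn n) x
  have h := hasDerivWithinAt_slice (u := fun t z => f t (c.symm z)) (hf c (chart_mem_atlas _ _)) ht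
    (mem_chart_target _ x)
  have e : c.symm (c x) = x := c.left_inv (mem_chart_source _ x)
  have h' : HasDerivWithinAt (fun s => f s (c.symm (c x))) _ J t := h
  rw [e] at h'
  exact h'.differentiableWithinAt.hasDerivWithinAt

/-- A continuous family of closed `(1,1)`-forms. -/
structure IsFormFamily {P : Type*} [TopologicalSpace P] (S : Set P) (η : P → TwoForm n X) :
    Prop where
  closed : ∀ p ∈ S, IsClosedOneOne (η p)
  continuousOn : ∀ c ∈ atlas (Cn n) X,
    ContinuousOn (fun p : P × Cn n => coeffMatrix (inChart (η p.1) c p.2)) (S ×ˢ c.target)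

section

variable {P : Type*} [TopologicalSpace P] {S : Set P} {α η : P → TwoForm n X}

theorem isFormFamily_const {β : TwoForm n X} (hβ : IsClosedOneOne β) (S : Set P) : IsFormFamily S fun _ => β where
  closed _ _ := hβ
  continuousOn _ hc := (continuousOn_coeffMatrix hβ hc).comp continuousOn_snd fun _ hp => hp.2

theorem IsFormFamily.add (hα : IsFormFamily S α) (hη : IsFormFamily S η) :
    IsFormFamily S fun p => α p + η p where
  closed p hp := (hα.closed p hp).add (hη.closed p hp)
  continuousOn c hc := by
    simp only [inChart_add, coeffMatrix_add]
    exact (hα.continuousOn c hc).add (hη.continuousOn c hc)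

theorem IsFormFamily.smul (hα : IsFormFamily S α) {r : P → ℝ} (hr : ContinuousOn r S) :
    IsFormFamily S fun p => r p • α p where
  closed p hp := (hα.closed p hp).smul _
  continuousOn c hc := by
    simp only [inChart_smul, coeffMatrix_smul]
    exact (Complex.continuous_ofReal.comp_continuousOn
      (hr.comp continuousOn_fst fun _ hp => hp.1)).smul (hα.continuousOn c hc)

theorem IsFormFamily.comp {Q : Type*} [TopologicalSpace Q] {R : Set Q} {g : Q → P}
    (hα : IsFormFamily S α) (hg : ContinuousOn g R) (hm : MapsTo g R S) :
    IsFormFamily R (α ∘ g) := by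
  refine ⟨fun q hq => ?_, fun c hc => ?_⟩
  · exact hα.closed (g q) (hm hq)
  · have h : ContinuousOn (fun p : Q × Cn n => (g p.1, p.2)) (R ×ˢ c.target) :=
      (hg.comp continuousOn_fst fun _ hp => hp.1).prodMk continuousOn_snd
    have hm' : MapsTo (fun p : Q × Cn n => (g p.1, p.2)) (R ×ˢ c.target) (S ×ˢ c.target) :=
      fun _ hp => ⟨hm hp.1, hp.2⟩
    have h' := (hα.continuousOn c hc).comp h hm'
    simp only [Function.comp_def] at h' ⊢
    exact h'

end

theorem coeffAt_add (α β : TwoForm n X) (x : X) :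
    coeffAt (α + β) x = coeffAt α x + coeffAt β x := by
  rw [coeffAt, coeffAt, coeffAt, inChart_add, coeffMatrix_add]

theorem coeffAt_smul (r : ℝ) (α : TwoForm n X) (x : X) :
    coeffAt (r • α) x = (r : ℂ) • coeffAt α x := by
  rw [coeffAt, coeffAt, inChart_smul, coeffMatrix_smul]

theorem mixRel_smul (ω₀ α η : TwoForm n X) (r : ℝ) (x : X) :
    mixRel ω₀ (r • α) η x = r * mixRel ω₀ α η x := by
  simp only [mixRel, relDens, mixDens, inChart_smul, coeffMatrix_smul, Matrix.mul_smul,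
    trace_smul, smul_eq_mul, Complex.re_ofReal_mul]
  ring

/-- The variation of the volume form. -/
theorem hasDerivWithinAt_volRatio (ω₀ : TwoForm n X) {α : TwoForm n X} {η : ℝ → TwoForm n X}
    {S : Set ℝ} {t : ℝ} {x : X}
    (h : ∀ j k, HasDerivWithinAt (fun s => coeffAt (η s) x j k) (coeffAt α x j k) S t) :
    HasDerivWithinAt (fun s => volRatio (η s) ω₀ x) (mixRel ω₀ α (η t) x) S t := by
  have h1 := hasDerivWithinAt_det (a := fun s => coeffAt (η s) x) h
  have h2 : HasDerivWithinAt (fun s => (coeffAt (η s) x).det.re)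
      (trace (adjugate (coeffAt (η t) x) * coeffAt α x)).re S t :=
    Complex.reCLM.hasFDerivAt.comp_hasDerivWithinAt t h1
  simp only [volRatio, wedgeInChart_powTop (η _)]
  exact (h2.const_mul (volConst n)).div_const _

theorem hasDerivWithinAt_volRatio_add_smul (ω₀ α η : TwoForm n X) (S : Set ℝ) (t : ℝ) (x : X) :
    HasDerivWithinAt (fun s => volRatio (η + s • α) ω₀ x) (mixRel ω₀ α (η + t • α) x) S t := by
  refine hasDerivWithinAt_volRatio ω₀ (η := fun s => η + s • α) fun j k => ?_
  simp only [coeffAt_add, coeffAt_smul, Matrix.add_apply, Matrix.smul_apply, smul_eq_mul]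
  have h : HasDerivWithinAt (fun s : ℝ => (s : ℂ)) 1 S t := by
    simpa using (hasDerivWithinAt_id t S).ofReal_comp
  simpa using (h.mul_const (coeffAt α x j k)).const_add (coeffAt η x j k)

variable [IsManifold 𝓘(ℂ, Cn n) ω X]

theorem isChartFamily_const_smul {ψ : X → ℝ} (hψ : IsSmooth n ψ)
    (J : Set ℝ) : IsChartFamily n J fun s => s • ψ := by
  rintro c hc ⟨s, z⟩ hz
  have h := (hψ.contDiffAt hc hz.2).comp (s, z) (contDiffAt_snd (𝕜 := ℝ))
  exact (contDiffAt_fst.mul h).contDiffWithinAt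

theorem IsSmoothFamily.isChartFamily {J : Set ℝ} {f : ℝ → X → ℝ} (hf : IsSmoothFamily n J f) :
    IsChartFamily n J f := by
  have := isManifold_real n X
  intro c hc
  have h1 : ContMDiffOn 𝓘(ℝ, Cn n) 𝓘(ℝ, Cn n) ∞ c.symm c.target :=
    contMDiffOn_symm_of_mem_maximalAtlas (IsManifold.subset_maximalAtlas hc)
  have h2 : ContMDiffOn (𝓘(ℝ, ℝ).prod 𝓘(ℝ, Cn n)) (𝓘(ℝ, ℝ).prod 𝓘(ℝ, Cn n)) ∞
      (fun p : ℝ × Cn n => (p.1, c.symm p.2)) (J ×ˢ c.target) :=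
    contMDiffOn_fst.prodMk (h1.comp contMDiffOn_snd fun p hp => hp.2)
  have h3 := ContMDiffOn.comp hf h2 fun p hp => ⟨hp.1, mem_univ _⟩
  -- The product of the models is identified with the model of the product space, so that smoothness
  -- of the family becomes ordinary smoothness.
  rw [← modelWithCornersSelf_prod, chartedSpaceSelf_prod] at h3
  exact contMDiffOn_iff_contDiffOn.1 h3

theorem IsChartFamily.isSmooth {J : Set ℝ} {f : ℝ → X → ℝ} (hf : IsChartFamily n J f) {t : ℝ}
    (ht : t ∈ J) : IsSmooth n (f t) :=
  isSmooth_of_contDiffAt fun x => contDiffAt_slice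
    (u := fun t z => f t ((chartAt (Cn n) x).symm z)) (chartAt (Cn n) x).open_target
    (hf _ (chart_mem_atlas _ _)) ht (mem_chart_target _ x)

section

variable {P : Type*} [TopologicalSpace P] {S : Set P} {α η : P → TwoForm n X}
  {ω₀ : TwoForm n X}

theorem IsChartFamily.isFormFamily {J : Set ℝ} {f : ℝ → X → ℝ} (hf : IsChartFamily n J f)
    (hJ : Convex ℝ J) (hi : (interior J).Nonempty) : IsFormFamily J fun t => ddbar n (f t) where
  closed t ht := isClosedOneOne_ddbar (hf.isSmooth ht)
  continuousOn c hc := (continuousOn_coeffMatrix_ddbarFlat (u := fun t z => f t (c.symm z)) hJ hi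
    c.open_target (hf c hc)).congr fun p hp => by
      rw [inChart_ddbar (hf.isSmooth hp.1) hc hp.2]
      rfl

theorem continuousOn_relDens {D : P → OpenPartialHomeomorph X (Cn n) → Cn n → ℝ}
    (hω₀ : IsKahler ω₀) (hD : ∀ p ∈ S, IsDensity (D p))
    (h : ∀ c ∈ atlas (Cn n) X, ContinuousOn (fun p : P × Cn n => D p.1 c p.2) (S ×ˢ c.target)) :
    ContinuousOn (fun p : P × X => relDens (D p.1) (wedgeInChart (powTop ω₀)) p.2)
      (S ×ˢ univ) := by
  have hD₀ := isDensity_powTop hω₀.toIsClosedOneOne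
  refine continuousOn_of_charts (n := n) (G := fun p x => relDens (D p) (wedgeInChart (powTop ω₀)) x)
    fun c hc => ?_
  refine ((h c hc).div ((hD₀.continuousOn c hc).comp continuousOn_snd fun _ hp => hp.2)
    fun p hp => (hω₀.wedgeInChart_pos hc hp.2).ne').congr fun p hp => ?_
  rw [(hD p.1 hp.1).relDens_eq hD₀ hc (c.map_target hp.2), c.right_inv hp.2]
  rfl

theorem IsFormFamily.continuousOn_volRatio (hω₀ : IsKahler ω₀) (hη : IsFormFamily S η) :
    ContinuousOn (fun p : P × X => volRatio (η p.1) ω₀ p.2) (S ×ˢ univ) := by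
  refine continuousOn_relDens (D := fun p => wedgeInChart (powTop (η p))) hω₀
    (fun p hp => isDensity_powTop (hη.closed p hp)) fun c hc => ?_
  simp only [wedgeInChart_powTop]
  exact continuousOn_const.mul (Complex.continuous_re.comp_continuousOn
    (continuous_id.matrix_det.comp_continuousOn (hη.continuousOn c hc)))

theorem IsFormFamily.continuousOn_mixRel (hω₀ : IsKahler ω₀) (hα : IsFormFamily S α)
    (hη : IsFormFamily S η) :
    ContinuousOn (fun p : P × X => mixRel ω₀ (α p.1) (η p.1) p.2) (S ×ˢ univ) := by
  refine continuousOn_relDens (D := fun p => mixDens (α p) (η p)) hω₀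
    (fun p hp => isDensity_mixDens (hα.closed p hp) (hη.closed p hp)) fun c hc => ?_
  simp only [mixDens]
  exact continuousOn_const.mul (Complex.continuous_re.comp_continuousOn
    (continuous_id.matrix_trace.comp_continuousOn
      ((continuous_id.matrix_adjugate.comp_continuousOn (hη.continuousOn c hc)).mul
        (hα.continuousOn c hc))))

end

/-- The scaling `r` is there for the segment `ω₀ + r i∂∂̄ψ` in `aubin`; `r = 1` is the variation of
`ω_tⁿ`. -/
theorem IsChartFamily.hasDerivWithinAt_volRatio {J : Set ℝ} {f : ℝ → X → ℝ}
    (hf : IsChartFamily n J f) (hJ : Convex ℝ J) (hi : (interior J).Nonempty)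
    (ω₀ β : TwoForm n X) (r : ℝ) {t : ℝ} (ht : t ∈ J) (x : X) :
    HasDerivWithinAt (fun s => volRatio (β + r • ddbar n (f s)) ω₀ x)
      (r * mixRel ω₀ (ddbar n fun x => derivWithin (fun s => f s x) J t)
        (β + r • ddbar n (f t)) x) J t := by
  rw [← mixRel_smul]
  refine KahlerFlow.hasDerivWithinAt_volRatio ω₀ (η := fun s => β + r • ddbar n (f s))
    fun j k => ?_
  set c := chartAt (Cn n) x
  have hc : c ∈ atlas (Cn n) X := chart_mem_atlas _ _
  have hx : c x ∈ c.target := mem_chart_target _ x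
  have h := hasDerivWithinAt_coeffMatrix_ddbarFlat (u := fun t z => f t (c.symm z)) hJ hi
    c.open_target (hf c hc) ht hx j k
  simp only [coeffAt_add, coeffAt_smul, Matrix.add_apply, Matrix.smul_apply, smul_eq_mul]
  refine HasDerivWithinAt.const_add _ (HasDerivWithinAt.const_mul _ ?_)
  rw [coeffAt, inChart_ddbar ((hf.deriv hJ hi).isSmooth ht) hc hx]
  refine HasDerivWithinAt.congr_of_mem h (fun s hs => ?_) ht
  rw [coeffAt, inChart_ddbar (hf.isSmooth hs) hc hx]
  rfl

end Families

/-! ### Ricci forms and Ricci potentials -/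

section Ricci

open Matrix

variable {n : ℕ} {X : Type*} [TopologicalSpace X] [ChartedSpace (Cn n) X]

theorem pullAt_eq_add {x : X} {β γ δ : Cn n → (Cn n [⋀^Fin 2]→L[ℝ] ℝ)}
    (h : β (chartAt (Cn n) x x) = γ (chartAt (Cn n) x x) + δ (chartAt (Cn n) x x)) :
    pullAt x β = pullAt x γ + pullAt x δ := by
  simp only [pullAt]
  rw [h]
  rfl

theorem ddbar_smul (r : ℝ) (f : X → ℝ) : ddbar n (r • f) = r • ddbar n f := by
  funext x
  have h : (r • f) ∘ (chartAt (Cn n) x).symm = fun z => r * (f ∘ (chartAt (Cn n) x).symm) z := rfl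
  simp only [ddbar, pullAt, Pi.smul_apply]
  rw [h, ddbarFlat_smul]
  rfl

/-- Positivity is a convex condition: `α + rβ = (1 - r) α + r (α + β)`. Hence the linear path used
in `mu` stays among Kähler potentials. -/
theorem IsPositive.add_smul {α β : TwoForm n X} (hα : IsPositive α) (hβ : IsPositive (α + β))
    {r : ℝ} (hr : r ∈ Icc (0 : ℝ) 1) : IsPositive (α + r • β) := by
  intro x u hu
  have h1 := hα x u hu
  have h2 := hβ x u hu
  have e : (α + r • β) x ![u, Complex.I • u]
      = (1 - r) * α x ![u, Complex.I • u] + r * (α + β) x ![u, Complex.I • u] := by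
    simp only [Pi.add_apply, Pi.smul_apply, ContinuousAlternatingMap.add_apply,
      ContinuousAlternatingMap.smul_apply, smul_eq_mul]
    ring
  rw [e]
  rcases hr.2.lt_or_eq with h | h
  · exact add_pos_of_pos_of_nonneg (mul_pos (by linarith) h1) (mul_nonneg hr.1 h2.le)
  · rw [h]
    simpa using h2

theorem contDiffAt_wedgeInChart_powTop {η : TwoForm n X} (hη : IsClosedOneOne η) {c : OpenPartialHomeomorph X (Cn n)}
    (hc : c ∈ atlas (Cn n) X) {z : Cn n} (hz : z ∈ c.target) :
    ContDiffAt ℝ ∞ (wedgeInChart (powTop η) c) z := by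
  have h : wedgeInChart (powTop η) c
      = fun z => volConst n * ((coeffMatrix (inChart η c z)).det).re :=
    funext fun z => wedgeInChart_powTop η c z
  rw [h]
  have h1 : ContDiffAt ℝ ∞ (fun z => (coeffMatrix (inChart η c z)).det) z :=
    contDiffWithinAt_univ.1 (contDiffWithinAt_det fun j k =>
      (contDiffAt_coeffMatrix (hη.contDiffAt hc hz) j k).contDiffWithinAt)
  exact contDiffAt_const.mul (Complex.reCLM.contDiff.contDiffAt.comp z h1)

variable [IsManifold 𝓘(ℂ, Cn n) ω X] {ω₀ η : TwoForm n X}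

theorem ddbar_add {f g : X → ℝ} (hf : IsSmooth n f) (hg : IsSmooth n g) :
    ddbar n (f + g) = ddbar n f + ddbar n g := by
  funext x
  have hc : chartAt (Cn n) x ∈ atlas (Cn n) X := chart_mem_atlas _ _
  exact pullAt_eq_add (ddbarFlat_add
    ((hf.contDiffAt hc (mem_chart_target _ x)).of_le two_le_infty)
    ((hg.contDiffAt hc (mem_chart_target _ x)).of_le two_le_infty))

theorem IsPotential.isKahler [CompactSpace X] [T2Space X] (hω₀ : IsKahler ω₀) {ψ : X → ℝ}
    (hψ : IsPotential ω₀ ψ) : IsKahler (ω₀ + ddbar n ψ) :=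
  ⟨hω₀.toIsClosedOneOne.add (isClosedOneOne_ddbar hψ.1), hψ.2⟩

theorem IsKahler.volRatio_pos (hη : IsKahler η) (hω₀ : IsKahler ω₀) (x : X) :
    0 < volRatio η ω₀ x :=
  div_pos (hη.wedgeInChart_pos (chart_mem_atlas _ _) (mem_chart_target _ x))
    (hω₀.wedgeInChart_pos (chart_mem_atlas _ _) (mem_chart_target _ x))

theorem contDiffAt_log_wedgeInChart (hη : IsKahler η) {c : OpenPartialHomeomorph X (Cn n)}
    (hc : c ∈ atlas (Cn n) X) {z : Cn n} (hz : z ∈ c.target) :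
    ContDiffAt ℝ ∞ (fun z => Real.log (wedgeInChart (powTop η) c z)) z :=
  (contDiffAt_wedgeInChart_powTop hη.toIsClosedOneOne hc hz).log (hη.wedgeInChart_pos hc hz).ne'

theorem log_volRatio_chart (hη : IsKahler η) (hω₀ : IsKahler ω₀)
    {c : OpenPartialHomeomorph X (Cn n)} (hc : c ∈ atlas (Cn n) X) {z : Cn n} (hz : z ∈ c.target) :
    Real.log (volRatio η ω₀ (c.symm z)) = Real.log (wedgeInChart (powTop η) c z)
      - Real.log (wedgeInChart (powTop ω₀) c z) := by
  rw [volRatio_eq_relDens, (isDensity_powTop hη.toIsClosedOneOne).relDens_eq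
    (isDensity_powTop hω₀.toIsClosedOneOne) hc (c.map_target hz), c.right_inv hz,
    Real.log_div (hη.wedgeInChart_pos hc hz).ne' (hω₀.wedgeInChart_pos hc hz).ne']

theorem isSmooth_log_volRatio (hη : IsKahler η) (hω₀ : IsKahler ω₀) :
    IsSmooth n fun x => Real.log (volRatio η ω₀ x) := by
  refine isSmooth_of_contDiffAt fun x => ?_
  set c := chartAt (Cn n) x
  have hc : c ∈ atlas (Cn n) X := chart_mem_atlas _ _
  have hx : c x ∈ c.target := mem_chart_target _ x
  refine ((contDiffAt_log_wedgeInChart hη hc hx).sub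
    (contDiffAt_log_wedgeInChart hω₀ hc hx)).congr_of_eventuallyEq ?_
  filter_upwards [c.open_target.mem_nhds hx] with z hz
  exact log_volRatio_chart hη hω₀ hc hz

/-- In any chart the logarithms of the two volume densities differ by the globally defined function
`log(ηⁿ/ω₀ⁿ)`. -/
theorem ricci_add_ddbar_log_volRatio (hη : IsKahler η) (hω₀ : IsKahler ω₀) :
    ricci η + ddbar n (fun x => Real.log (volRatio η ω₀ x)) = ricci ω₀ := by
  funext x
  set c := chartAt (Cn n) x with hcdef
  have hc : c ∈ atlas (Cn n) X := chart_mem_atlas _ _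
  have hx : c x ∈ c.target := mem_chart_target _ x
  have h1 : (fun z => Real.log (wedgeInChart (powTop η) c z)) =ᶠ[𝓝 (c x)]
      fun z => ((fun x => Real.log (volRatio η ω₀ x)) ∘ c.symm) z
        + Real.log (wedgeInChart (powTop ω₀) c z) := by
    filter_upwards [c.open_target.mem_nhds hx] with z hz
    rw [Function.comp_apply, log_volRatio_chart hη hω₀ hc hz]
    ring
  have h2 := pullAt_eq_add (x := x)
    (β := ddbarFlat fun z => Real.log (wedgeInChart (powTop η) c z))
    (γ := ddbarFlat ((fun x => Real.log (volRatio η ω₀ x)) ∘ c.symm))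
    (δ := ddbarFlat fun z => Real.log (wedgeInChart (powTop ω₀) c z)) (by
      rw [← hcdef, ddbarFlat_congr h1]
      exact ddbarFlat_add
        (((isSmooth_log_volRatio hη hω₀).contDiffAt hc hx).of_le two_le_infty)
        ((contDiffAt_log_wedgeInChart hω₀ hc hx).of_le two_le_infty))
  simp only [Pi.add_apply, ricci, ddbar]
  rw [← hcdef, h2]
  abel

/-- The Ricci potential of `ω₀ + i∂∂̄ψ`. -/
def ricciPotential (ω₀ : TwoForm n X) (lam : ℝ) (H₀ ψ : X → ℝ) (x : X) : ℝ :=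
  H₀ x - lam * ψ x - Real.log (volRatio (ω₀ + ddbar n ψ) ω₀ x)

variable [CompactSpace X] [T2Space X] {α₀ : TwoForm n X} {lam : ℝ} {H₀ ψ : X → ℝ}

theorem isSmooth_ricciPotential (hω₀ : IsKahler ω₀) (lam : ℝ) (hH₀ : IsSmooth n H₀)
    (hψ : IsPotential ω₀ ψ) : IsSmooth n (ricciPotential ω₀ lam H₀ ψ) :=
  ContMDiff.sub (ContMDiff.sub hH₀ (contMDiff_const.mul hψ.1))
    (isSmooth_log_volRatio (hψ.isKahler hω₀) hω₀)

/-- Passing from `ω₀` to `ω_ψ` changes `Ric` by `-i∂∂̄ log(ω_ψⁿ/ω₀ⁿ)` and `λω` by `λ i∂∂̄ψ`;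
`ricciPotential` corrects `H₀` by exactly these two terms. -/
theorem ricci_sub_eq_ddbar (hω₀ : IsKahler ω₀) (hH₀ : IsRicciPotential ω₀ α₀ lam H₀)
    (hψ : IsPotential ω₀ ψ) :
    ricci (ω₀ + ddbar n ψ) - lam • (ω₀ + ddbar n ψ) - α₀
      = ddbar n (ricciPotential ω₀ lam H₀ ψ) := by
  have hL := isSmooth_log_volRatio (hψ.isKahler hω₀) hω₀
  have hlam : IsSmooth n (lam • ψ) := contMDiff_const.mul hψ.1
  have h1 := ricci_add_ddbar_log_volRatio (hψ.isKahler hω₀) hω₀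
  have h2 := hH₀.eq
  have h3 : H₀ = ricciPotential ω₀ lam H₀ ψ + lam • ψ
      + fun x => Real.log (volRatio (ω₀ + ddbar n ψ) ω₀ x) := by
    funext x
    simp only [ricciPotential, Pi.add_apply, Pi.smul_apply, smul_eq_mul]
    ring
  have h4 := isSmooth_ricciPotential hω₀ lam hH₀.smooth hψ
  have h5 := ddbar_add (ContMDiff.add h4 hlam : IsSmooth n _) hL
  rw [← h3, ddbar_add h4 hlam, ddbar_smul, ← h2, ← h1] at h5
  rw [smul_add]
  funext x
  have h6 := congrFun h5 x
  simp only [Pi.add_apply, Pi.sub_apply, Pi.smul_apply] at h6 ⊢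
  rw [← sub_eq_zero] at h6 ⊢
  rw [← h6]
  abel

end Ricci

/-! ### Primitives of the energy one-forms -/

section Forms

variable {n : ℕ} {X : Type*} [TopologicalSpace X] [ChartedSpace (Cn n) X] {ω₀ β : TwoForm n X}

theorem isFormFamily_add_smul {α : TwoForm n X} (hβ : IsClosedOneOne β) (hα : IsClosedOneOne α)
    (S : Set ℝ) : IsFormFamily S fun r : ℝ => β + r • α :=
  (isFormFamily_const hβ _).add ((isFormFamily_const hα _).smul continuousOn_id)

variable [IsManifold 𝓘(ℂ, Cn n) ω X] {J : Set ℝ} {γ : ℝ → X → ℝ}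

theorem IsChartFamily.isFormFamily_smul (hγ : IsChartFamily n J γ) (hJ : Convex ℝ J)
    (hi : (interior J).Nonempty) (hβ : IsClosedOneOne β) :
    IsFormFamily (J ×ˢ (univ : Set ℝ)) fun p : ℝ × ℝ => β + p.2 • ddbar n (γ p.1) :=
  (isFormFamily_const hβ _).add
    (((hγ.isFormFamily hJ hi).comp continuousOn_fst fun _ hp => hp.1).smul continuousOn_snd)

theorem continuousOn_mixRel_add_smul (hω₀ : IsKahler ω₀) {α : TwoForm n X}
    (hβ : IsClosedOneOne β) (hα : IsClosedOneOne α) {f : X → ℝ} (hf : Continuous f) (S : Set ℝ) :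
    ContinuousOn (fun p : ℝ × X => f p.2 * mixRel ω₀ α (β + p.1 • α) p.2) (S ×ˢ univ) := by
  have h := (isFormFamily_const hα S).continuousOn_mixRel hω₀ (isFormFamily_add_smul hβ hα S)
  exact (hf.comp continuous_snd).continuousOn.mul h

end Forms

section Functionals

variable {n : ℕ} {X : Type*} [TopologicalSpace X] [CompactSpace X] [T2Space X]
  [ChartedSpace (Cn n) X]

/-- The functional whose differential at `ψ` is integration against `ω_ψⁿ`. -/
def aubin (ω₀ : TwoForm n X) (ψ : X → ℝ) : ℝ :=
  ∫ r in (0 : ℝ)..1, integral (fun x => ψ x * volRatio (ω₀ + r • ddbar n ψ) ω₀ x) (powTop ω₀)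

/-- The functional whose differential at `ψ` is the pairing of the variation of `ω_ψⁿ` with the
Ricci potential of `ω_ψ`. -/
def entropyFunctional (ω₀ : TwoForm n X) (lam : ℝ) (H₀ ψ : X → ℝ) : ℝ :=
  integral (fun x => (H₀ x - Real.log (volRatio (ω₀ + ddbar n ψ) ω₀ x))
      * volRatio (ω₀ + ddbar n ψ) ω₀ x) (powTop ω₀)
    - lam * (integral (fun x => ψ x * volRatio (ω₀ + ddbar n ψ) ω₀ x) (powTop ω₀)
      - aubin ω₀ ψ)

variable [IsManifold 𝓘(ℂ, Cn n) ω X] {ω₀ β : TwoForm n X} {J : Set ℝ} {γ : ℝ → X → ℝ}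

theorem hasDerivWithinAt_integral_volRatio_add_smul (hω₀ : IsKahler ω₀) {α : TwoForm n X}
    (hβ : IsClosedOneOne β) (hα : IsClosedOneOne α) {f : X → ℝ} (hf : Continuous f)
    (hJ : Convex ℝ J) {t : ℝ} (ht : t ∈ J) :
    HasDerivWithinAt (fun r => integral (fun x => f x * volRatio (β + r • α) ω₀ x) (powTop ω₀))
      (integral (fun x => f x * mixRel ω₀ α (β + t • α) x) (powTop ω₀)) J t := by
  have hΛ := isBddFunctional_integral_powTop (X := X) hω₀.toIsClosedOneOne
  refine hΛ.hasDerivWithinAt hJ (G := fun r x => f x * volRatio (β + r • α) ω₀ x)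
    (G' := fun r x => f x * mixRel ω₀ α (β + r • α) x)
    (fun r _ => hf.mul (continuous_volRatio hω₀ (hβ.add (hα.smul r))))
    (continuousOn_mixRel_add_smul hω₀ hβ hα hf J)
    (fun r _ x => (hasDerivWithinAt_volRatio_add_smul ω₀ α β J r x).const_mul (f x)) ht

/-- Put `η_r = ω₀ + r i∂∂̄γ` and `δ = γ'`. Under `∫₀¹ dr` the time derivative is `∫ δ η_rⁿ + r ∫ γ n
i∂∂̄δ ∧ η_rⁿ⁻¹`. Self-adjointness exchanges `γ` and `δ` in the second term, which makes the sum the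
`r`-derivative of `r ∫ δ η_rⁿ`; integrating in `r` leaves the value at `r = 1`. -/
theorem hasDerivWithinAt_aubin (hω₀ : IsKahler ω₀) (hγ : IsChartFamily n J γ) (hJ : Convex ℝ J)
    (hi : (interior J).Nonempty) {t : ℝ} (ht : t ∈ J) :
    HasDerivWithinAt (fun s => aubin ω₀ (γ s))
      (integral (fun x => derivWithin (fun s => γ s x) J t
        * volRatio (ω₀ + ddbar n (γ t)) ω₀ x) (powTop ω₀)) J t := by
  have hΛ := isBddFunctional_integral_powTop (X := X) hω₀.toIsClosedOneOne
  set δ : ℝ → X → ℝ := fun s x => derivWithin (fun s => γ s x) J s with hδ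
  have hγ' : IsChartFamily n J δ := hγ.deriv hJ hi
  set η : ℝ × ℝ → TwoForm n X := fun p => ω₀ + p.2 • ddbar n (γ p.1) with hη
  have hηf : IsFormFamily (J ×ˢ (univ : Set ℝ)) η :=
    hγ.isFormFamily_smul hJ hi hω₀.toIsClosedOneOne
  have hδf : IsFormFamily (J ×ˢ (univ : Set ℝ)) fun p : ℝ × ℝ => ddbar n (δ p.1) :=
    (hγ'.isFormFamily hJ hi).comp continuousOn_fst fun _ hp => hp.1
  have hvol := hηf.continuousOn_volRatio hω₀
  have hmix := hδf.continuousOn_mixRel hω₀ hηf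
  have hc : ∀ {f : ℝ → X → ℝ}, IsChartFamily n J f → ContinuousOn
      (fun p : (ℝ × ℝ) × X => f p.1.1 p.2) ((J ×ˢ (univ : Set ℝ)) ×ˢ (univ : Set X)) := by
    intro f hf
    exact hf.continuousOn.comp (f := fun p : (ℝ × ℝ) × X => (p.1.1, p.2)) (by fun_prop)
      fun p hp => ⟨hp.1.1, mem_univ _⟩
  set Φ : ℝ × ℝ → X → ℝ := fun p x => γ p.1 x * volRatio (η p) ω₀ x with hΦ
  set Φ' : ℝ × ℝ → X → ℝ := fun p x => δ p.1 x * volRatio (η p) ω₀ x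
    + γ p.1 x * (p.2 * mixRel ω₀ (ddbar n (δ p.1)) (η p) x) with hΦ'
  have hΦc : ContinuousOn (fun p : (ℝ × ℝ) × X => Φ p.1 p.2)
      ((J ×ˢ (univ : Set ℝ)) ×ˢ (univ : Set X)) := (hc hγ).mul hvol
  have hΦ'c : ContinuousOn (fun p : (ℝ × ℝ) × X => Φ' p.1 p.2)
      ((J ×ˢ (univ : Set ℝ)) ×ˢ (univ : Set X)) :=
    ((hc hγ').mul hvol).add ((hc hγ).mul
      ((by fun_prop : Continuous fun p : (ℝ × ℝ) × X => p.1.2).continuousOn.mul hmix))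
  have hd : ∀ r s, s ∈ J →
      HasDerivWithinAt (fun s => integral (Φ (s, r)) (powTop ω₀))
        (integral (Φ' (s, r)) (powTop ω₀)) J s := by
    intro r s hs
    have hmap : MapsTo (fun p : ℝ × X => ((p.1, r), p.2)) (J ×ˢ (univ : Set X))
        ((J ×ˢ (univ : Set ℝ)) ×ˢ (univ : Set X)) :=
      fun p hp => ⟨⟨hp.1, mem_univ _⟩, mem_univ _⟩
    refine hΛ.hasDerivWithinAt hJ (G := fun s => Φ (s, r)) (G' := fun s => Φ' (s, r))
      (fun q hq => continuous_slice hΦc (t := (q, r)) ⟨hq, mem_univ _⟩)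
      (hΦ'c.comp (by fun_prop) hmap) (fun q hq x => ?_) hs
    exact (hγ.hasDerivWithinAt hq x).mul (hγ.hasDerivWithinAt_volRatio hJ hi ω₀ ω₀ r hq x)
  -- The differentiation lemma wants a compact parameter space, so the `r`-integral is rewritten as
  -- a functional of functions on the subtype `[0,1]`.
  have hI : ∀ g : ℝ → ℝ, ∫ r in (0 : ℝ)..1, g (projIcc 0 1 zero_le_one r)
      = ∫ r in (0 : ℝ)..1, g r := by
    intro g
    refine intervalIntegral.integral_congr fun r hr => ?_
    rw [uIcc_of_le zero_le_one] at hr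
    simp only [projIcc_of_mem zero_le_one hr]
  have hΛΦ := hΛ.continuousOn hΦc
  have hΛΦ' := hΛ.continuousOn hΦ'c
  have h1 := isBddFunctional_unitInterval.hasDerivWithinAt hJ
    (G := fun s (r : Icc (0 : ℝ) 1) => integral (Φ (s, r)) (powTop ω₀))
    (G' := fun s (r : Icc (0 : ℝ) 1) => integral (Φ' (s, r)) (powTop ω₀))
    (fun s hs => hΛΦ.comp_continuous (f := fun r : Icc (0 : ℝ) 1 => (s, (r : ℝ)))
      (by fun_prop) fun r => ⟨hs, mem_univ _⟩)
    (hΛΦ'.comp (f := fun p : ℝ × Icc (0 : ℝ) 1 => (p.1, (p.2 : ℝ))) (by fun_prop)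
      fun p hp => ⟨hp.1, mem_univ _⟩)
    (fun s hs r => hd r s hs) ht
  have h2 : HasDerivWithinAt (fun s => aubin ω₀ (γ s))
      (∫ r in (0 : ℝ)..1, integral (Φ' (t, r)) (powTop ω₀)) J t := by
    convert h1 using 1
    · funext s
      exact (hI fun r => integral (Φ (s, r)) (powTop ω₀)).symm
    · exact (hI fun r => integral (Φ' (t, r)) (powTop ω₀)).symm
  convert h2 using 1
  have hγt := hγ.isSmooth ht
  have hδt := hγ'.isSmooth ht
  have hηt : ∀ r : ℝ, IsClosedOneOne (η (t, r)) := fun r => hηf.closed _ ⟨ht, mem_univ _⟩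
  -- The integrand as an exact derivative in `r`, after the exchange of `γ` and `δ`.
  have hf : ∀ r ∈ Icc (0 : ℝ) 1,
      HasDerivWithinAt (fun r => r * integral (fun x => δ t x * volRatio (η (t, r)) ω₀ x)
        (powTop ω₀)) (integral (Φ' (t, r)) (powTop ω₀)) (Icc 0 1) r := by
    intro r hr
    have hid : HasDerivWithinAt (fun r : ℝ => r) 1 (Icc 0 1) r := hasDerivWithinAt_id r _
    have h2 := hid.fun_mul
      (hasDerivWithinAt_integral_volRatio_add_smul hω₀ hω₀.toIsClosedOneOne
        (isClosedOneOne_ddbar hγt) hδt.continuous (convex_Icc 0 1) hr)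
    have cvol := continuous_volRatio hω₀ (hηt r)
    have cmix := continuous_mixRel hω₀ (hηt r) (isClosedOneOne_ddbar hδt)
    have h3 : integral (Φ' (t, r)) (powTop ω₀)
        = integral (fun x => δ t x * volRatio (η (t, r)) ω₀ x) (powTop ω₀)
          + r * integral (fun x => δ t x * mixRel ω₀ (ddbar n (γ t)) (η (t, r)) x)
            (powTop ω₀) := by
      rw [integral_mul_mixRel_ddbar_comm hω₀ (hηt r) hδt hγt, ← hΛ.map_smul r
        (fun x => γ t x * mixRel ω₀ (ddbar n (δ t)) (η (t, r)) x) (hγt.continuous.mul cmix),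
        ← hΛ.map_add (fun x => δ t x * volRatio (η (t, r)) ω₀ x)
          (fun x => r * (γ t x * mixRel ω₀ (ddbar n (δ t)) (η (t, r)) x))
          (hδt.continuous.mul cvol) (continuous_const.mul (hγt.continuous.mul cmix))]
      congr 1
      funext x
      simp only [hΦ']
      ring
    rw [one_mul] at h2
    rw [h3]
    exact h2
  rw [integral_eq_sub_of_hasDerivWithinAt_Icc hf
    (hΛΦ'.comp (f := fun r : ℝ => (t, r)) (by fun_prop) fun r _ => ⟨ht, mem_univ _⟩)]
  simp only [hη, one_smul, one_mul, zero_mul, sub_zero]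
  rfl

end Functionals

section Forms

variable {n : ℕ} {X : Type*} [TopologicalSpace X] [ChartedSpace (Cn n) X]
  [IsManifold 𝓘(ℂ, Cn n) ω X] {J : Set ℝ} {γ : ℝ → X → ℝ}

theorem IsChartFamily.isFormFamily_add (hγ : IsChartFamily n J γ) (hJ : Convex ℝ J)
    (hi : (interior J).Nonempty) {β : TwoForm n X} (hβ : IsClosedOneOne β) :
    IsFormFamily J fun t => β + ddbar n (γ t) :=
  (isFormFamily_const hβ _).add (hγ.isFormFamily hJ hi)

theorem IsChartFamily.hasDerivWithinAt_volRatio_add (hγ : IsChartFamily n J γ) (hJ : Convex ℝ J)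
    (hi : (interior J).Nonempty) (ω₀ β : TwoForm n X) {t : ℝ} (ht : t ∈ J) (x : X) :
    HasDerivWithinAt (fun s => volRatio (β + ddbar n (γ s)) ω₀ x)
      (mixRel ω₀ (ddbar n fun x => derivWithin (fun s => γ s x) J t) (β + ddbar n (γ t)) x) J t := by
  simpa only [one_smul, one_mul] using hγ.hasDerivWithinAt_volRatio hJ hi ω₀ β 1 ht x

end Forms

/-! ### First variation and path independence -/

section Mabuchi

variable {n : ℕ} {X : Type*} [TopologicalSpace X] [CompactSpace X] [T2Space X]
  [ChartedSpace (Cn n) X] [IsManifold 𝓘(ℂ, Cn n) ω X] {ω₀ α₀ : TwoForm n X} {lam : ℝ}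
  {H₀ : X → ℝ} {J : Set ℝ} {γ : ℝ → X → ℝ}

/-- Differentiation of `∫ f_t ω_tⁿ`. -/
theorem hasDerivWithinAt_integral_mul_volRatio (hω₀ : IsKahler ω₀) (hγ : IsChartFamily n J γ)
    (hJ : Convex ℝ J) (hi : (interior J).Nonempty) {f f' : ℝ → X → ℝ}
    (hf : ContinuousOn (fun p : ℝ × X => f p.1 p.2) (J ×ˢ univ))
    (hf' : ContinuousOn (fun p : ℝ × X => f' p.1 p.2) (J ×ˢ univ))
    (hd : ∀ t ∈ J, ∀ x, HasDerivWithinAt (fun s => f s x) (f' t x) J t) {t : ℝ} (ht : t ∈ J) :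
    HasDerivWithinAt
      (fun s => integral (fun x => f s x * volRatio (ω₀ + ddbar n (γ s)) ω₀ x) (powTop ω₀))
      (integral (fun x => f' t x * volRatio (ω₀ + ddbar n (γ t)) ω₀ x) (powTop ω₀)
        + integral (fun x => f t x * mixRel ω₀ (ddbar n fun x => derivWithin (fun s => γ s x) J t)
          (ω₀ + ddbar n (γ t)) x) (powTop ω₀)) J t := by
  have hΛ := isBddFunctional_integral_powTop (X := X) hω₀.toIsClosedOneOne
  have hη := hγ.isFormFamily_add hJ hi hω₀.toIsClosedOneOne
  have hvol := hη.continuousOn_volRatio hω₀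
  have hmix := ((hγ.deriv hJ hi).isFormFamily hJ hi).continuousOn_mixRel hω₀ hη
  have h1 := hf'.mul hvol
  have h2 := hf.mul hmix
  rw [← hΛ.map_add _ _ (continuous_slice (G := fun t x => f' t x
      * volRatio (ω₀ + ddbar n (γ t)) ω₀ x) h1 ht)
    (continuous_slice (G := fun t x => f t x * mixRel ω₀
      (ddbar n fun x => derivWithin (fun s => γ s x) J t) (ω₀ + ddbar n (γ t)) x) h2 ht)]
  exact hΛ.hasDerivWithinAt hJ
    (G := fun s x => f s x * volRatio (ω₀ + ddbar n (γ s)) ω₀ x)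
    (G' := fun s x => f' s x * volRatio (ω₀ + ddbar n (γ s)) ω₀ x + f s x * mixRel ω₀
      (ddbar n fun x => derivWithin (fun s => γ s x) J s) (ω₀ + ddbar n (γ s)) x)
    (fun s hs => continuous_slice (G := fun t x => f t x
      * volRatio (ω₀ + ddbar n (γ t)) ω₀ x) (hf.mul hvol) hs) (h1.add h2)
    (fun s hs x => (hd s hs x).fun_mul (hγ.hasDerivWithinAt_volRatio_add hJ hi ω₀ ω₀ hs x)) ht

theorem continuousOn_log_volRatio (hω₀ : IsKahler ω₀) (hγ : IsChartFamily n J γ)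
    (hJ : Convex ℝ J) (hi : (interior J).Nonempty)
    (hpos : ∀ s ∈ J, IsPositive (ω₀ + ddbar n (γ s))) :
    ContinuousOn (fun p : ℝ × X => Real.log (volRatio (ω₀ + ddbar n (γ p.1)) ω₀ p.2))
      (J ×ˢ univ) :=
  ((hγ.isFormFamily_add hJ hi hω₀.toIsClosedOneOne).continuousOn_volRatio hω₀).log fun p hp =>
    ((IsPotential.isKahler hω₀ ⟨hγ.isSmooth hp.1, hpos p.1 hp.1⟩).volRatio_pos hω₀ p.2).ne'

/-- The first variation of the entropy functional. -/
theorem hasDerivWithinAt_entropyFunctional (hω₀ : IsKahler ω₀) (lam : ℝ) (hH₀ : IsSmooth n H₀)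
    (hγ : IsChartFamily n J γ) (hJ : Convex ℝ J) (hi : (interior J).Nonempty)
    (hpos : ∀ s ∈ J, IsPositive (ω₀ + ddbar n (γ s))) {t : ℝ} (ht : t ∈ J) :
    HasDerivWithinAt (fun s => entropyFunctional ω₀ lam H₀ (γ s))
      (integral (fun x => ricciPotential ω₀ lam H₀ (γ t) x
        * mixRel ω₀ (ddbar n fun x => derivWithin (fun s => γ s x) J t)
          (ω₀ + ddbar n (γ t)) x) (powTop ω₀)) J t := by
  have hΛ := isBddFunctional_integral_powTop (X := X) hω₀.toIsClosedOneOne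
  have hη := hγ.isFormFamily_add hJ hi hω₀.toIsClosedOneOne
  have hK : ∀ s ∈ J, IsKahler (ω₀ + ddbar n (γ s)) := fun s hs =>
    IsPotential.isKahler hω₀ ⟨hγ.isSmooth hs, hpos s hs⟩
  have hvol0 : ∀ s ∈ J, ∀ x, volRatio (ω₀ + ddbar n (γ s)) ω₀ x ≠ 0 := fun s hs x =>
    ((hK s hs).volRatio_pos hω₀ x).ne'
  have hvol := hη.continuousOn_volRatio hω₀
  have hγ' := hγ.deriv hJ hi
  have hmix := (hγ'.isFormFamily hJ hi).continuousOn_mixRel hω₀ hη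
  have hlog := continuousOn_log_volRatio hω₀ hγ hJ hi hpos
  have hH : ContinuousOn (fun p : ℝ × X => H₀ p.2) (J ×ˢ univ) :=
    (hH₀.continuous.comp continuous_snd).continuousOn
  have h1 := hasDerivWithinAt_integral_mul_volRatio hω₀ hγ hJ hi
    (f := fun s x => H₀ x - Real.log (volRatio (ω₀ + ddbar n (γ s)) ω₀ x))
    (f' := fun s x => -(mixRel ω₀ (ddbar n fun x => derivWithin (fun s => γ s x) J s)
      (ω₀ + ddbar n (γ s)) x / volRatio (ω₀ + ddbar n (γ s)) ω₀ x))
    (hH.sub hlog) (hmix.div hvol fun p hp => hvol0 p.1 hp.1 p.2).neg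
    (fun s hs x => ((hγ.hasDerivWithinAt_volRatio_add hJ hi ω₀ ω₀ hs x).log
      (hvol0 s hs x)).const_sub (H₀ x)) ht
  have h2 := hasDerivWithinAt_integral_mul_volRatio hω₀ hγ hJ hi hγ.continuousOn
    hγ'.continuousOn (fun s hs x => hγ.hasDerivWithinAt hs x) ht
  have h3 := hasDerivWithinAt_aubin hω₀ hγ hJ hi ht
  -- The term `∫ γ' ω_γⁿ` occurs in both `h2` and `h3` and cancels; this is why `aubin` is part of
  -- the functional.
  have h4 := h1.fun_sub ((h2.fun_sub h3).const_mul lam)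
  refine h4.congr_deriv ?_
  have hηt := (hK t ht).toIsClosedOneOne
  have hδt := hγ'.isSmooth ht
  set R := volRatio (ω₀ + ddbar n (γ t)) ω₀ with hR
  set R' := mixRel ω₀ (ddbar n fun x => derivWithin (fun s => γ s x) J t)
    (ω₀ + ddbar n (γ t)) with hR'
  -- The derivative of the logarithm, weighted by `R`, is just `-R'`, whose integral vanishes by
  -- integration by parts.
  have e1 : integral (fun x => -(R' x / R x) * R x) (powTop ω₀) = 0 := by
    have e : (fun x => -(R' x / R x) * R x) = fun x => (-1) * R' x := by
      funext x
      have := hvol0 t ht x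
      rw [← hR] at this
      field_simp
    rw [e, hΛ.map_smul _ _ (continuous_mixRel hω₀ hηt (isClosedOneOne_ddbar hδt)),
      integral_mixRel_ddbar hω₀ hηt hδt, mul_zero]
  have cR' : Continuous R' := continuous_mixRel hω₀ hηt (isClosedOneOne_ddbar hδt)
  have cL : Continuous fun x => H₀ x - Real.log (R x) :=
    hH₀.continuous.sub (isSmooth_log_volRatio (hK t ht) hω₀).continuous
  have cγ : Continuous (γ t) := (hγ.isSmooth ht).continuous
  have e2 : integral (fun x => ricciPotential ω₀ lam H₀ (γ t) x * R' x) (powTop ω₀)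
      = integral (fun x => (H₀ x - Real.log (R x)) * R' x) (powTop ω₀)
        - lam * integral (fun x => γ t x * R' x) (powTop ω₀) := by
    rw [← hΛ.map_smul lam (fun x => γ t x * R' x) (cγ.mul cR'),
      ← hΛ.map_sub (f := fun x => (H₀ x - Real.log (R x)) * R' x)
        (g := fun x => lam * (γ t x * R' x)) (cL.mul cR') (continuous_const.mul (cγ.mul cR'))]
    congr 1
    funext x
    simp only [ricciPotential]
    ring
  rw [e1, e2]
  ring

theorem continuousOn_integral_ricciPotential (hω₀ : IsKahler ω₀) (lam : ℝ) (hH₀ : IsSmooth n H₀)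
    (hγ : IsChartFamily n J γ) (hJ : Convex ℝ J) (hi : (interior J).Nonempty)
    (hpos : ∀ s ∈ J, IsPositive (ω₀ + ddbar n (γ s))) :
    ContinuousOn (fun t => integral (fun x => ricciPotential ω₀ lam H₀ (γ t) x
        * mixRel ω₀ (ddbar n fun x => derivWithin (fun s => γ s x) J t)
          (ω₀ + ddbar n (γ t)) x) (powTop ω₀)) J := by
  have hη := hγ.isFormFamily_add hJ hi hω₀.toIsClosedOneOne
  have hmix := ((hγ.deriv hJ hi).isFormFamily hJ hi).continuousOn_mixRel hω₀ hη
  have hlog := continuousOn_log_volRatio hω₀ hγ hJ hi hpos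
  have hH : ContinuousOn (fun p : ℝ × X => H₀ p.2) (J ×ˢ univ) :=
    (hH₀.continuous.comp continuous_snd).continuousOn
  have h := ((hH.sub ((continuousOn_const (c := lam)).mul hγ.continuousOn)).sub hlog).mul hmix
  exact (isBddFunctional_integral_powTop (X := X) hω₀.toIsClosedOneOne).continuousOn
    (G := fun t x => ricciPotential ω₀ lam H₀ (γ t) x
      * mixRel ω₀ (ddbar n fun x => derivWithin (fun s => γ s x) J t) (ω₀ + ddbar n (γ t)) x) h

/-- On Kähler potentials the form in the integrand is `i∂∂̄` of the Ricci potential.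
Self-adjointness moves `i∂∂̄` onto the velocity of the path, and the integrand becomes the
derivative of `entropyFunctional`; only the endpoints survive. -/
theorem muAlong_eq (hω₀ : IsKahler ω₀) (hH₀ : IsRicciPotential ω₀ α₀ lam H₀)
    (hγ : IsChartFamily n (Icc 0 1) γ)
    (hpos : ∀ s ∈ Icc (0 : ℝ) 1, IsPositive (ω₀ + ddbar n (γ s))) :
    muAlong ω₀ α₀ lam γ = -(1 / vol ω₀)
      * (entropyFunctional ω₀ lam H₀ (γ 1) - entropyFunctional ω₀ lam H₀ (γ 0)) := by
  have hJ : Convex ℝ (Icc (0 : ℝ) 1) := convex_Icc 0 1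
  have hi : (interior (Icc (0 : ℝ) 1)).Nonempty := by simp
  rw [← integral_eq_sub_of_hasDerivWithinAt_Icc
    (fun t ht => hasDerivWithinAt_entropyFunctional hω₀ lam hH₀.smooth hγ hJ hi hpos ht)
    (continuousOn_integral_ricciPotential hω₀ lam hH₀.smooth hγ hJ hi hpos), muAlong,
    show -((n : ℝ) / vol ω₀) = -(1 / vol ω₀) * n by ring, mul_assoc,
    ← intervalIntegral.integral_const_mul]
  congr 1
  refine intervalIntegral.integral_congr fun s hs => ?_
  rw [uIcc_of_le zero_le_one] at hs
  have hp : IsPotential ω₀ (γ s) := ⟨hγ.isSmooth hs, hpos s hs⟩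
  have hη := (hp.isKahler hω₀).toIsClosedOneOne
  have hh := isSmooth_ricciPotential hω₀ lam hH₀.smooth hp
  rw [ricci_sub_eq_ddbar hω₀ hH₀ hp, natCast_mul_integral_wedgePow hω₀ hη (isClosedOneOne_ddbar hh),
    integral_mul_mixRel_ddbar_comm hω₀ hη ((hγ.deriv hJ hi).isSmooth hs) hh]

theorem mu_eq (hω₀ : IsKahler ω₀) (hH₀ : IsRicciPotential ω₀ α₀ lam H₀) {ψ : X → ℝ}
    (hψ : IsPotential ω₀ ψ) :
    mu ω₀ α₀ lam ψ = -(1 / vol ω₀)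
      * (entropyFunctional ω₀ lam H₀ ψ - entropyFunctional ω₀ lam H₀ 0) := by
  have h := muAlong_eq hω₀ hH₀ (isChartFamily_const_smul hψ.1 (Icc 0 1)) fun s hs => by
    rw [ddbar_smul]
    exact hω₀.pos.add_smul hψ.2 hs
  rw [one_smul, zero_smul] at h
  exact h

end Mabuchi

/-! ### Traces and gradients of a Kähler metric -/

section Positivity

open Matrix
open scoped ComplexOrder

variable {n : ℕ} {X : Type*} [TopologicalSpace X] [ChartedSpace (Cn n) X]
  [IsManifold 𝓘(ℂ, Cn n) ω X] {ω₀ η : TwoForm n X}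

theorem IsKahler.posDef_coeffAt (hη : IsKahler η) (x : X) : (coeffAt η x).PosDef :=
  (hη.isOneOne_inChart _ _).posDef_coeffMatrix
    (hη.pos.inChart_pos (chart_mem_atlas _ _) (mem_chart_target _ x))

/-- Positivity makes the determinant real as well as nonzero. This links the division-free densities
with traces and gradient norms, which are defined through the inverse metric. -/
theorem adjugate_eq_smul_inv {ι : Type*} [Fintype ι] [DecidableEq ι] {a : Matrix ι ι ℂ}
    (ha : a.PosDef) : adjugate a = (a.det.re : ℂ) • a⁻¹ := by
  have h := Complex.lt_def.1 ha.det_pos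
  have h1 : ((a.det.re : ℝ) : ℂ) = a.det := Complex.ext rfl h.2
  have h2 : a.det ≠ 0 := ha.det_pos.ne'
  rw [h1, inv_def, smul_smul, Ring.inverse_eq_inv', mul_inv_cancel₀ h2, one_smul]

theorem IsKahler.traceForm_mul_volRatio (hη : IsKahler η) (ω₀ α : TwoForm n X) (x : X) :
    traceForm η α x * volRatio η ω₀ x = mixRel ω₀ α η x := by
  have h := adjugate_eq_smul_inv (hη.posDef_coeffAt x)
  rw [mixRel, relDens, mixDens, volRatio, wedgeInChart_powTop η, traceForm]
  change _ = volConst n * (trace (adjugate (coeffAt η x) * coeffAt α x)).re / _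
  rw [h, smul_mul, trace_smul, smul_eq_mul, Complex.re_ofReal_mul, coeffAt]
  ring

theorem IsKahler.gradSq_mul_volRatio (hη : IsKahler η) (ω₀ : TwoForm n X) (f : X → ℝ) (x : X) :
    gradSq η f x * volRatio η ω₀ x = gradRel ω₀ η f f x := by
  have h := adjugate_eq_smul_inv (hη.posDef_coeffAt x)
  rw [gradRel, relDens, gradDens, volRatio, wedgeInChart_powTop η, gradSq]
  change _ = volConst n * (gradPair (coeffAt η x) _ _).re / _
  simp only [gradPair, h, Matrix.smul_apply, smul_eq_mul, mul_assoc, ← Finset.mul_sum,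
    Complex.re_ofReal_mul]
  simp only [coeffAt]
  ring

theorem IsKahler.gradSq_nonneg (hη : IsKahler η) (f : X → ℝ) (x : X) : 0 ≤ gradSq η f x := by
  set d := delFlat (f ∘ (chartAt (Cn n) x).symm) (chartAt (Cn n) x x)
  have h := (hη.posDef_coeffAt x).inv.posSemidef.dotProduct_mulVec_nonneg d
  have e : gradSq η f x = (star d ⬝ᵥ ((coeffAt η x)⁻¹ *ᵥ d)).re := by
    simp only [gradSq, dotProduct, mulVec, Finset.mul_sum]
    rw [Finset.sum_comm]
    refine congrArg Complex.re (Finset.sum_congr rfl fun k _ => Finset.sum_congr rfl fun j _ => ?_)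
    rw [Pi.star_apply, starRingEnd_apply]
    ring
  rw [e]
  exact (Complex.le_def.1 h).1

end Positivity

/-! ### Cohomological invariance of volumes -/

section Volume

variable {n : ℕ} {X : Type*} [TopologicalSpace X] [CompactSpace X] [T2Space X]
  [ChartedSpace (Cn n) X] [IsManifold 𝓘(ℂ, Cn n) ω X] {ω₀ β α : TwoForm n X} {ψ : X → ℝ}

theorem IsKahler.integral_nonneg (hη : IsKahler β) {f : X → ℝ} (hf : ∀ x, 0 ≤ f x) :
    0 ≤ integral f (powTop β) :=
  densIntegral_nonneg hf fun _ _ hz => (hη.wedgeInChart_pos (chart_mem_atlas _ _) hz).le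

/-- The `r`-derivative of `∫ (β + r i∂∂̄ψ)ⁿ` is the integral of `n i∂∂̄ψ ∧ (β + r i∂∂̄ψ)ⁿ⁻¹`, which
is zero. No positivity of `β` is required, so `β = ω₀ + rα` is allowed in the polarisation that
follows. -/
theorem integral_volRatio_add_ddbar (hω₀ : IsKahler ω₀) (hβ : IsClosedOneOne β)
    (hψ : IsSmooth n ψ) :
    integral (volRatio (β + ddbar n ψ) ω₀) (powTop ω₀) = integral (volRatio β ω₀) (powTop ω₀) := by
  have hd := isClosedOneOne_ddbar hψ
  have h0 : ∀ r : ℝ, integral (mixRel ω₀ (ddbar n ψ) (β + r • ddbar n ψ)) (powTop ω₀) = 0 :=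
    fun r => integral_mixRel_ddbar hω₀ (hβ.add (hd.smul r)) hψ
  have h1 : ∀ r ∈ Icc (0 : ℝ) 1, HasDerivWithinAt
      (fun r => integral (volRatio (β + r • ddbar n ψ) ω₀) (powTop ω₀)) 0 (Icc 0 1) r := by
    intro r hr
    have h := hasDerivWithinAt_integral_volRatio_add_smul hω₀ hβ hd
      (continuous_const (y := (1 : ℝ))) (convex_Icc 0 1) hr
    simp only [one_mul] at h
    exact h.congr_deriv (h0 r)
  have h := integral_eq_sub_of_hasDerivWithinAt_Icc h1 continuousOn_const
  rw [intervalIntegral.integral_zero, one_smul, zero_smul, add_zero] at h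
  exact (sub_eq_zero.1 h.symm)

/-- The cohomological invariance of `∫ α ∧ ω_ψⁿ⁻¹`. -/
theorem integral_mixRel_add_ddbar (hω₀ : IsKahler ω₀) (hα : IsClosedOneOne α)
    (hψ : IsSmooth n ψ) :
    integral (mixRel ω₀ α (ω₀ + ddbar n ψ)) (powTop ω₀)
      = integral (mixRel ω₀ α ω₀) (powTop ω₀) := by
  have hd := isClosedOneOne_ddbar hψ
  have h1 := hasDerivWithinAt_integral_volRatio_add_smul hω₀ (hω₀.toIsClosedOneOne.add hd) hα
    (continuous_const (y := (1 : ℝ))) convex_univ (mem_univ 0)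
  have h2 := hasDerivWithinAt_integral_volRatio_add_smul hω₀ hω₀.toIsClosedOneOne hα
    (continuous_const (y := (1 : ℝ))) convex_univ (mem_univ 0)
  -- Polarisation: the two volumes agree for every `r`, and comparing their derivatives at `r = 0`
  -- gives the mixed integrals.
  have e : ∀ r : ℝ, integral (volRatio (ω₀ + ddbar n ψ + r • α) ω₀) (powTop ω₀)
      = integral (volRatio (ω₀ + r • α) ω₀) (powTop ω₀) := fun r => by
    rw [add_right_comm, integral_volRatio_add_ddbar hω₀ (hω₀.toIsClosedOneOne.add (hα.smul r)) hψ]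
  simp only [one_mul, zero_smul, add_zero] at h1 h2
  have h3 : HasDerivWithinAt (fun r : ℝ => integral (volRatio (ω₀ + r • α) ω₀) (powTop ω₀))
      (integral (mixRel ω₀ α (ω₀ + ddbar n ψ)) (powTop ω₀)) univ 0 := by
    simpa only [← e] using h1
  exact (hasDerivWithinAt_univ.1 h3).unique (hasDerivWithinAt_univ.1 h2)

theorem integral_volRatio_eq_vol (hω₀ : IsKahler ω₀) (hψ : IsSmooth n ψ) :
    integral (volRatio (ω₀ + ddbar n ψ) ω₀) (powTop ω₀) = vol ω₀ := by
  have h := integral_powTop hω₀ hω₀.toIsClosedOneOne fun _ => 1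
  simp only [one_mul] at h
  rw [integral_volRatio_add_ddbar hω₀ hω₀.toIsClosedOneOne hψ]
  exact h.symm

theorem vol_mul_bConst (hω₀ : IsKahler ω₀) (hα : IsClosedOneOne α) (hV : vol ω₀ ≠ 0) :
    bConst ω₀ α * vol ω₀ = integral (mixRel ω₀ α ω₀) (powTop ω₀) := by
  have h := natCast_mul_integral_wedgePow hω₀ hω₀.toIsClosedOneOne hα fun _ => 1
  simp only [one_mul] at h
  rw [bConst]
  field_simp
  exact h

end Volume

/-! ### The modified Mabuchi energy along the flow -/

section Flow

variable {n : ℕ} {X : Type*} [TopologicalSpace X] [CompactSpace X] [T2Space X]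
  [ChartedSpace (Cn n) X] [IsManifold 𝓘(ℂ, Cn n) ω X] {ω₀ α₀ : TwoForm n X} {lam κ : ℝ}
  {H₀ : X → ℝ} {T : EReal} {φ F : ℝ → X → ℝ}

theorem convex_timeInterval (T : EReal) : Convex ℝ (timeInterval T) := by
  refine OrdConnected.convex ⟨fun s hs t ht r hr => ⟨hs.1.trans hr.1, ?_⟩⟩
  exact (EReal.coe_le_coe_iff.2 hr.2).trans_lt ht.2

theorem nonempty_interior_timeInterval {t : ℝ} (ht : t ∈ timeInterval T) :
    (interior (timeInterval T)).Nonempty := by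
  obtain ⟨r, hr, hrT⟩ := EReal.lt_iff_exists_real_btwn.1 ht.2
  have h : Ioo t r ⊆ interior (timeInterval T) :=
    interior_maximal (fun s hs => ⟨ht.1.trans hs.1.le,
      (EReal.coe_lt_coe_iff.2 hs.2).trans hrT⟩) isOpen_Ioo
  exact (nonempty_Ioo.2 (EReal.coe_lt_coe_iff.1 hr)).mono h

theorem IsPotentialFlow.isPotential (h : IsPotentialFlow ω₀ α₀ lam κ H₀ T φ F) {t : ℝ}
    (ht : t ∈ timeInterval T) : IsPotential ω₀ (φ t) :=
  ⟨h.smooth_φ.isChartFamily.isSmooth ht, h.pos t ht⟩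

/-- By the second flow equation this is `κ (∫ ΔF - ∫ tr α₀ + bV)` for `ω_tⁿ`. The Laplacian
integrates to zero, and the other two terms cancel because `∫ α₀ ∧ ω_tⁿ⁻¹` and the volume depend
only on the class of `ω₀`. -/
theorem IsPotentialFlow.integral_derivWithin_mul_volRatio (hω₀ : IsKahler ω₀)
    (hα₀ : IsClosedOneOne α₀) (h : IsPotentialFlow ω₀ α₀ lam κ H₀ T φ F) (hV : vol ω₀ ≠ 0) {t : ℝ}
    (ht : t ∈ timeInterval T) :
    integral (fun x => derivWithin (fun s => F s x) (timeInterval T) t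
      * volRatio (ω₀ + ddbar n (φ t)) ω₀ x) (powTop ω₀) = 0 := by
  have hΛ := isBddFunctional_integral_powTop (X := X) hω₀.toIsClosedOneOne
  have hK := (h.isPotential ht).isKahler hω₀
  have hη := hK.toIsClosedOneOne
  have hF := h.smooth_F.isChartFamily.isSmooth ht
  have hud := uniqueDiffOn_convex (convex_timeInterval T) (nonempty_interior_timeInterval ht) t ht
  have c1 := continuous_mixRel hω₀ hη (isClosedOneOne_ddbar hF)
  have c2 := continuous_mixRel hω₀ hη hα₀
  have c3 := continuous_volRatio hω₀ hη
  have e : (fun x => derivWithin (fun s => F s x) (timeInterval T) t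
      * volRatio (ω₀ + ddbar n (φ t)) ω₀ x) = fun x =>
        κ * (mixRel ω₀ (ddbar n (F t)) (ω₀ + ddbar n (φ t)) x
          - mixRel ω₀ α₀ (ω₀ + ddbar n (φ t)) x
          + bConst ω₀ α₀ * volRatio (ω₀ + ddbar n (φ t)) ω₀ x) := by
    funext x
    rw [(h.eq_F t ht x).derivWithin hud, ← hK.traceForm_mul_volRatio ω₀ α₀,
      ← hK.traceForm_mul_volRatio ω₀ (ddbar n (F t)), laplacian]
    ring
  set A := mixRel ω₀ (ddbar n (F t)) (ω₀ + ddbar n (φ t))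
  set B := mixRel ω₀ α₀ (ω₀ + ddbar n (φ t))
  set R := volRatio (ω₀ + ddbar n (φ t)) ω₀
  have c4 : Continuous fun x => bConst ω₀ α₀ * R x := continuous_const.mul c3
  have c5 : Continuous fun x => A x - B x := c1.sub c2
  rw [e, hΛ.map_smul κ (fun x => A x - B x + bConst ω₀ α₀ * R x) (c5.add c4),
    hΛ.map_add (fun x => A x - B x) (fun x => bConst ω₀ α₀ * R x) c5 c4, hΛ.map_sub c1 c2,
    hΛ.map_smul _ _ c3, integral_mixRel_ddbar hω₀ hη hF,
    integral_mixRel_add_ddbar hω₀ hα₀ (h.isPotential ht).1,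
    integral_volRatio_eq_vol hω₀ (h.isPotential ht).1, vol_mul_bConst hω₀ hα₀ hV]
  ring

/-- The variations of `μ` and of `∫ F ω_φⁿ` both pair with `n i∂∂̄φ̇ ∧ ω_tⁿ⁻¹`, with total weight `h
+ F`. The first flow equation says that this weight is `-φ̇`, and integration by parts produces the
squared gradient. -/
theorem IsPotentialFlow.hasDerivWithinAt_mabuchi (hω₀ : IsKahler ω₀) (hα₀ : IsClosedOneOne α₀)
    (hH₀ : IsRicciPotential ω₀ α₀ lam H₀) (h : IsPotentialFlow ω₀ α₀ lam κ H₀ T φ F) {t : ℝ}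
    (ht : t ∈ timeInterval T) :
    HasDerivWithinAt (fun s => mabuchi ω₀ α₀ lam (φ s) (F s))
      (-(1 / vol ω₀) * integral (gradSq (ω₀ + ddbar n (φ t))
        (fun x => derivWithin (fun s => φ s x) (timeInterval T) t))
        (powTop (ω₀ + ddbar n (φ t)))) (timeInterval T) t := by
  have hΛ := isBddFunctional_integral_powTop (X := X) hω₀.toIsClosedOneOne
  set J := timeInterval T with hJdef
  have hJ : Convex ℝ J := convex_timeInterval T
  have hi : (interior J).Nonempty := nonempty_interior_timeInterval ht
  have hφ := h.smooth_φ.isChartFamily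
  have hF := h.smooth_F.isChartFamily
  have hud := uniqueDiffOn_convex hJ hi t ht
  have hK := (h.isPotential ht).isKahler hω₀
  have hη := hK.toIsClosedOneOne
  have h1 := hasDerivWithinAt_entropyFunctional hω₀ lam hH₀.smooth hφ hJ hi h.pos ht
  have h2 := hasDerivWithinAt_integral_mul_volRatio hω₀ hφ hJ hi hF.continuousOn
    (hF.deriv hJ hi).continuousOn (fun s hs x => hF.hasDerivWithinAt hs x) ht
  have h3 := ((h1.sub_const (entropyFunctional ω₀ lam H₀ 0)).const_mul (-(1 / vol ω₀))).fun_sub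
    (h2.const_mul (1 / vol ω₀))
  have e : ∀ s ∈ J, mabuchi ω₀ α₀ lam (φ s) (F s)
      = -(1 / vol ω₀) * (entropyFunctional ω₀ lam H₀ (φ s) - entropyFunctional ω₀ lam H₀ 0)
        - 1 / vol ω₀ * integral (fun x => F s x * volRatio (ω₀ + ddbar n (φ s)) ω₀ x)
          (powTop ω₀) := by
    intro s hs
    rw [mabuchi, mu_eq hω₀ hH₀ (h.isPotential hs),
      integral_powTop hω₀ ((h.isPotential hs).isKahler hω₀).toIsClosedOneOne]
  refine (h3.congr_of_mem e ht).congr_deriv ?_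
  -- `X` may be empty. If `V = 0`, then `1 / V = 0` by convention and both sides vanish; `V ≠ 0` is
  -- needed to use the definition of `b`.
  by_cases hV : vol ω₀ = 0
  · simp [hV]
  rw [h.integral_derivWithin_mul_volRatio hω₀ hα₀ hV ht, zero_add]
  set δ : X → ℝ := fun x => derivWithin (fun s => φ s x) J t with hδ
  have hδs : IsSmooth n δ := (hφ.deriv hJ hi).isSmooth ht
  have cR' := continuous_mixRel hω₀ hη (isClosedOneOne_ddbar hδs)
  have ch := (isSmooth_ricciPotential hω₀ lam hH₀.smooth (h.isPotential ht)).continuous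
  have cF := (hF.isSmooth ht).continuous
  -- The Ricci potential plus `F` is `-φ̇` by the first flow equation, so the sum equals `-∫ φ̇ n
  -- i∂∂̄φ̇ ∧ ω_tⁿ⁻¹`.
  have e1 : integral (fun x => ricciPotential ω₀ lam H₀ (φ t) x
        * mixRel ω₀ (ddbar n δ) (ω₀ + ddbar n (φ t)) x) (powTop ω₀)
      + integral (fun x => F t x * mixRel ω₀ (ddbar n δ) (ω₀ + ddbar n (φ t)) x) (powTop ω₀)
      = integral (gradRel ω₀ (ω₀ + ddbar n (φ t)) δ δ) (powTop ω₀) := by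
    rw [← hΛ.map_add (fun x => ricciPotential ω₀ lam H₀ (φ t) x
        * mixRel ω₀ (ddbar n δ) (ω₀ + ddbar n (φ t)) x)
      (fun x => F t x * mixRel ω₀ (ddbar n δ) (ω₀ + ddbar n (φ t)) x) (ch.mul cR') (cF.mul cR'),
      ← neg_neg (integral (gradRel _ _ _ _) _), ← integral_mul_mixRel_ddbar hω₀ hη hδs hδs,
      ← neg_one_mul, ← hΛ.map_smul (-1) (fun x => δ x * mixRel ω₀ (ddbar n δ)
        (ω₀ + ddbar n (φ t)) x) (hδs.continuous.mul cR')]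
    congr 1
    funext x
    have := (h.eq_φ t ht x).derivWithin hud
    simp only [ricciPotential, hδ] at this ⊢
    rw [this]
    ring
  have e2 : integral (gradSq (ω₀ + ddbar n (φ t)) δ) (powTop (ω₀ + ddbar n (φ t)))
      = integral (gradRel ω₀ (ω₀ + ddbar n (φ t)) δ δ) (powTop ω₀) := by
    rw [integral_powTop hω₀ hη]
    congr 1
    funext x
    exact hK.gradSq_mul_volRatio ω₀ δ x
  rw [e2, ← e1]
  ring

theorem IsPotentialFlow.antitoneOn_mabuchi (hω₀ : IsKahler ω₀) (hα₀ : IsClosedOneOne α₀)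
    (hH₀ : IsRicciPotential ω₀ α₀ lam H₀) (h : IsPotentialFlow ω₀ α₀ lam κ H₀ T φ F) :
    AntitoneOn (fun t => mabuchi ω₀ α₀ lam (φ t) (F t)) (timeInterval T) := by
  refine antitoneOn_of_hasDerivWithinAt_nonpos (convex_timeInterval T)
    (fun t ht => (h.hasDerivWithinAt_mabuchi hω₀ hα₀ hH₀ ht).continuousWithinAt)
    (fun t ht => (h.hasDerivWithinAt_mabuchi hω₀ hα₀ hH₀ (interior_subset ht)).mono
      interior_subset) fun t ht => ?_
  have hK := (h.isPotential (interior_subset ht)).isKahler hω₀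
  have hV : 0 ≤ vol ω₀ := hω₀.integral_nonneg fun _ => zero_le_one
  exact mul_nonpos_of_nonpos_of_nonneg (neg_nonpos.2 (by positivity))
    (hK.integral_nonneg (hK.gradSq_nonneg _))

end Flow

end KahlerFlow

end

theorem lemma10 {n : ℕ} {X : Type*} [TopologicalSpace X] [CompactSpace X] [T2Space X]
    [ChartedSpace (KahlerFlow.Cn n) X] [IsManifold 𝓘(ℂ, KahlerFlow.Cn n) ω X]
    (ω₀ α₀ : KahlerFlow.TwoForm n X) (lam κ : ℝ) (H₀ : X → ℝ) (T : EReal) (φ F : ℝ → X → ℝ)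
    (hω₀ : KahlerFlow.IsKahler ω₀) (hα₀ : KahlerFlow.IsClosedOneOne α₀) (hκ : 0 < κ)
    (hH₀ : KahlerFlow.IsRicciPotential ω₀ α₀ lam H₀)
    (hflow : KahlerFlow.IsPotentialFlow ω₀ α₀ lam κ H₀ T φ F) :
    (∀ ψ : X → ℝ, KahlerFlow.IsPotential ω₀ ψ → ∀ γ : ℝ → X → ℝ,
      KahlerFlow.IsPotentialPath ω₀ ψ γ →
        KahlerFlow.muAlong ω₀ α₀ lam γ = KahlerFlow.mu ω₀ α₀ lam ψ) ∧
    (∀ t ∈ KahlerFlow.timeInterval T,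
      HasDerivWithinAt (fun s => KahlerFlow.mabuchi ω₀ α₀ lam (φ s) (F s))
        (-(1 / KahlerFlow.vol ω₀) *
          KahlerFlow.integral
            (KahlerFlow.gradSq (ω₀ + KahlerFlow.ddbar n (φ t))
              (fun x => derivWithin (fun s => φ s x) (KahlerFlow.timeInterval T) t))
            (KahlerFlow.powTop (ω₀ + KahlerFlow.ddbar n (φ t))))
        (KahlerFlow.timeInterval T) t) ∧
    AntitoneOn (fun t => KahlerFlow.mabuchi ω₀ α₀ lam (φ t) (F t))
      (KahlerFlow.timeInterval T) := by
  refine ⟨fun ψ hψ γ hγ => ?_, fun t ht => hflow.hasDerivWithinAt_mabuchi hω₀ hα₀ hH₀ ht,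
    hflow.antitoneOn_mabuchi hω₀ hα₀ hH₀⟩
  rw [KahlerFlow.muAlong_eq hω₀ hH₀ hγ.smooth.isChartFamily hγ.pos,
    KahlerFlow.mu_eq hω₀ hH₀ hψ, hγ.source, hγ.target]
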